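/- **Setup.** Let $p$ be a prime, $\kappa$ a perfect field of characteristic $p$, $O_F = W(\kappa)$ and $d \ge 0$. Let $R^\square$ be the $p$-adic completion of $O_F[X_1^{\pm 1},\dots,X_d^{\pm 1}]$ and let $R$ be the $p$-adic completion of an étale $R^\square$-algebra with nonempty geometrically integral special fibre. Fix an algebraic closure $\Omega$ of $\mathrm{Frac}(R)$, a compatible system $\varepsilon = (\zeta_{p^n})_n$ of primitive $p^n$-th roots of unity and compatible systems $X_i^\flat = (X_i^{1/p^n})_n$ of $p$-power roots of the $X_i$ in $\Omega$. Put $R_\infty[1/p] = R[\mu_{p^\infty}, X_1^{1/p^\infty},\dots,X_d^{1/p^\infty}, 1/p]$ and let $\Gamma_R$ be the profinite group of automorphisms of $R_\infty[1/p]$ over $R[1/p]$. Let $\chi$ be the $p$-adic cyclotomic character of $\Gamma_R$, and define $c_i : \Gamma_R \to \mathbb{Z}_p$ by $g(X_i^{1/p^n}) = \zeta_{p^n}^{c_i(g)} X_i^{1/p^n}$ for all $n$. Let $\gamma_1,\dots,\gamma_d \in \Gamma_R$ be the elements that fix all $\zeta_{p^n}$ and satisfy $\gamma_j(X_i^\flat)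 = \varepsilon X_i^\flat$ if $i = j$ and $\gamma_j(X_i^\flat)=X_i^\flat$ otherwise; they are topological generators of the geometric part $\Gamma_R'$ of $\Gamma_R$. Let $A = \mathbf{A}_R^+ = R[[\mu]]$, where $\mu = [\varepsilon]-1$ and $X_i \in R$ is identified with $[X_i^\flat]$. It carries the Frobenius $\varphi$, the unique ring endomorphism that lifts the $p$-power map on $A/p$, extends the Frobenius of $W(\kappa)$ and satisfies $\varphi([X_i^\flat]) = [X_i^\flat]^p$, $\varphi(\mu) = (1+\mu)^p - 1$. It also carries the action of $\Gamma_R$: each $g$ acts by the unique $O_F$-linear ring endomorphism that is trivial modulo $\mu$ and satisfies $g([X_i^\flat]) = (1+\mu)^{c_i(g)}[X_i^\flat]$ and $g(1+\mu) = (1+\mu)^{\chi(g)}$. Put $D = \mathbb{Z}_p[[\mu]]$ with $\varphi$ the identity on $\mathbb{Z}_p$ and $\varphi(\mu) = (1+\mu)^p-1$; put $q = 1+\mu$, $[p]_q = 1+q+\dots+q^{p-1} = \varphi(\mu)/\mu$ and $U_i = [X_i^\flat]$. **Wach modules.** Let $a \le b$ be integers. A Wach module over $A$ with weights in $[a,b]$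 is a finitely generated $A$-module $N$ with a semilinear action of $\Gamma_R$, continuous for the $(p,\mu)$-adic topology, such that: (1) $\{p,\mu\}$ is strictly $N$-regular, i.e. $N$ and $N/\mu N$ are $p$-torsion free and $N$ and $N/pN$ are $\mu$-torsion free; (2) $\Gamma_R$ acts trivially on $N/\mu N$; (3) $N$ is equipped with a $\varphi$-semilinear map $\varphi : N[1/\mu] \to N[1/\varphi(\mu)]$ that commutes with $\Gamma_R$, satisfies $\varphi(\mu^b N) \subset \mu^b N$, and is such that $1\otimes\varphi : \varphi^*(\mu^b N) \to \mu^b N$ is injective with cokernel killed by $[p]_q^{b-a}$. **$q$-connections.** Let $q\Omega^\bullet = q\Omega^\bullet_{A/D}$ be the differential graded $D$-algebra with $q\Omega^0 = A$ in which $q\Omega^k$ is the free left $A$-module on the products $d\log(U_{i_1})\cdots d\log(U_{i_k})$, $i_1<\dots<i_k$, with $d\log(U_i)\cdot f = \gamma_i(f)\,d\log(U_i)$ for $f\in A$, $d\log(U_i)\,d\log(U_j) = -d\log(U_j)\,d\log(U_i)$ for $i \neq j$, $d\log(U_i)^2=0$, differential $d_q f = \sum_i \frac{\gamma_i(f)-f}{q-1}\,d\log(U_i)$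 on $A$, and $d_q(d\log(U_i))=0$. - A $q$-connection on an $A$-module $N$ is a $D$-linear map $\nabla : N \to N\otimes_A q\Omega^1$ with $\nabla(xf) = \nabla(x)f + x\otimes d_q f$. - It extends uniquely to a graded $D$-linear map $\nabla: N\otimes q\Omega^\bullet\to N\otimes q\Omega^{\bullet+1}$ with $\nabla((n\otimes\omega)\omega') = \nabla(n\otimes\omega)\,\omega' + (-1)^{\deg\omega}(n\otimes\omega)\, d_q\omega'$, and it is flat if $\nabla\circ\nabla=0$. - It is $(p,[p]_q)$-adically quasi-nilpotent if the connection $\nabla \bmod (q-1)$ on the $R$-module $N/(q-1)N$ is $p$-adically quasi-nilpotent, i.e. for each $i$ the iterates of $\nabla(\partial/\partial U_i)$ tend to $0$ $p$-adically on every element of $N/(q-1)N$. - The Frobenius pullback is $\varphi^*\nabla : \varphi^*N\to\varphi^*N\otimes_A q\Omega^1$, $x\otimes f\mapsto (1\otimes\varphi_\Omega)(\nabla x)\cdot f + x\otimes d_q f$, where $\varphi^*N = N\otimes_{A,\varphi}A$ and $\varphi_\Omega(\sum_i f_i\, d\log(U_i)) = [p]_q\sum_i\varphi(f_i)\, d\log(U_i)$.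 - A $\varphi$-module with $q$-connection is a module with $q$-connection $(N,\nabla)$ together with an $A$-linear isomorphism $\varphi_N : (\varphi^*N)[1/[p]_q]\to N[1/[p]_q]$ such that $\nabla\circ\varphi_N = (\varphi_N\otimes 1)\circ\varphi^*\nabla$. **Proposition.** Let $N$ be a Wach module over $A=\mathbf{A}_R^+$, with weights in some interval $[a,b]$. Then $$\nabla_q : N\to N\otimes_A q\Omega^1_{A/D},\qquad x\mapsto\sum_{i=1}^d\frac{\gamma_i(x)-x}{\mu}\,d\log([X_i^\flat])$$ is a well-defined $q$-connection; it is flat and $(p,[p]_q)$-adically quasi-nilpotent. Moreover there is an $A$-linear isomorphism $\varphi_N : (\varphi^*N)[1/[p]_q]\to N[1/[p]_q]$ induced by the Frobenius of $N$ (that is, the image of $\varphi_N(x\otimes 1)$ in $N[1/\varphi(\mu)]$ is $\varphi(x)$ for $x\in N$) which makes $(N,\nabla_q)$ a $\varphi$-module with $q$-connection over $\mathbf{A}_R^+$. -/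

import Mathlib

set_option linter.unusedSectionVars false

open scoped TensorProduct

namespace WachQ


/-! ### Completions and lifting -/

section Rings

variable (p : ℕ)

/-- The `p`-adic completion of a commutative ring. -/
abbrev PCompl (S : Type*) [CommRing S] : Type _ :=
  AdicCompletion (Ideal.span {(p : S)}) S

instance PCompl.isAdicComplete (S : Type*) [CommRing S] :
    IsAdicComplete (Ideal.span {(p : PCompl p S)}) (PCompl p S) := by
  have h := AdicCompletion.isAdicComplete (I := Ideal.span {(p : S)}) (M := S)
    (Submodule.fg_span_singleton _)
  rw [← IsAdicComplete.map_algebraMap_iff (S := PCompl p S)] at h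
  simpa [Ideal.map_span] using h

variable {p}

theorem PCompl.exists_sub_dvd {S : Type*} [CommRing S] (n : ℕ) (r : PCompl p S) :
    ∃ s : S, (p : PCompl p S) ^ n ∣ r - algebraMap S (PCompl p S) s := by
  obtain ⟨s, hs⟩ := Ideal.Quotient.mk_surjective (AdicCompletion.evalₐ (Ideal.span {(p : S)}) n r)
  refine ⟨s, ?_⟩
  have h1 : r - algebraMap S (PCompl p S) s ∈
      (AdicCompletion.eval (Ideal.span {(p : S)}) S n).ker := by
    rw [LinearMap.mem_ker]
    have h2 : AdicCompletion.evalₐ (Ideal.span {(p : S)}) n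
        (r - algebraMap S (PCompl p S) s) = 0 := by
      rw [map_sub, ← hs]
      simp
    have h3 := AdicCompletion.factor_evalₐ_eq_eval
      (r - algebraMap S (PCompl p S) s) (I := Ideal.span {(p : S)}) (n := n)
      (le_of_eq (by simp))
    rw [← h3, h2, map_zero]
  rw [← AdicCompletion.pow_smul_top_eq_ker_eval (Submodule.fg_span_singleton _)] at h1
  have h4 : ∀ y ∈ (Ideal.span {(p : S)} ^ n • ⊤ : Submodule S (PCompl p S)),
      (p : PCompl p S) ^ n ∣ y := by
    intro y hy
    refine Submodule.smul_induction_on hy ?_ ?_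
    · intro a ha y _
      rw [Ideal.span_singleton_pow, Ideal.mem_span_singleton] at ha
      obtain ⟨b, rfl⟩ := ha
      rw [Algebra.smul_def, map_mul, map_pow, map_natCast, mul_assoc]
      exact dvd_mul_right _ _
    · intro a b ha hb
      exact dvd_add ha hb
  exact h4 _ h1

/-- `p`-adic separatedness in elementary form. -/
def PSep (p : ℕ) (T : Type*) [CommRing T] : Prop :=
  ∀ t : T, (∀ n : ℕ, (p : T) ^ n ∣ t) → t = 0

theorem PSep.of_isAdicComplete (T : Type*) [CommRing T]
    [IsAdicComplete (Ideal.span {(p : T)}) T] : PSep p T := by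
  intro t ht
  refine IsHausdorff.haus (I := Ideal.span {(p : T)}) inferInstance t fun n => ?_
  rw [SModEq.zero, Ideal.span_singleton_pow, smul_eq_mul, Ideal.mul_top,
    Ideal.mem_span_singleton]
  exact ht n

theorem PCompl.psep (S : Type*) [CommRing S] : PSep p (PCompl p S) :=
  PSep.of_isAdicComplete _

theorem PSep.powerSeries {T : Type*} [CommRing T] (h : PSep p T) : PSep p (PowerSeries T) := by
  intro f hf
  ext k
  refine h _ fun n => ?_
  obtain ⟨g, hg⟩ := hf n
  rw [hg]
  have : (p : PowerSeries T) ^ n = PowerSeries.C ((p : T) ^ n) := by simp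
  rw [this, PowerSeries.coeff_C_mul]
  exact dvd_mul_right _ _

/-- A ring homomorphism out of a ring with a `p`-adically dense subring is determined by its
restriction to that subring. -/
theorem hom_ext_dense {S R T : Type*} [CommRing S] [CommRing R] [CommRing T]
    (i : S →+* R) (hi : ∀ (n : ℕ) (r : R), ∃ s : S, (p : R) ^ n ∣ r - i s) (hT : PSep p T)
    {F G : R →+* T} (h : F.comp i = G.comp i) : F = G := by
  ext r
  rw [← sub_eq_zero]
  refine hT _ fun n => ?_
  obtain ⟨s, u, hu⟩ := hi n r
  have h1 : F (i s) = G (i s) := RingHom.congr_fun h s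
  have h2 : r = i s + (p : R) ^ n * u := by rw [← hu]; ring
  rw [h2]
  simp only [map_add, map_mul, map_pow, map_natCast, h1]
  exact ⟨F u - G u, by ring⟩

theorem hom_ext_powerSeries {S R T : Type*} [CommRing S] [CommRing R] [CommRing T]
    (i : S →+* R) (hi : ∀ (n : ℕ) (r : R), ∃ s : S, (p : R) ^ n ∣ r - i s) (hT : PSep p T)
    {F G : PowerSeries R →+* PowerSeries T}
    (h : ∀ s, F (PowerSeries.C (i s)) = G (PowerSeries.C (i s)))
    (hX : F PowerSeries.X = G PowerSeries.X)
    (hX0 : PowerSeries.X ∣ F PowerSeries.X) : F = G := by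
  have h1 : F.comp PowerSeries.C = G.comp PowerSeries.C :=
    hom_ext_dense i hi hT.powerSeries (by ext1 s; exact h s)
  have h2 : ∀ q : Polynomial R, F q = G q := by
    intro q
    induction q using Polynomial.induction_on' with
    | add a b ha hb => simp [ha, hb]
    | monomial n a =>
      have := RingHom.congr_fun h1 a
      simp only [RingHom.comp_apply] at this
      rw [← Polynomial.C_mul_X_pow_eq_monomial]
      simp [this, hX]
  ext f k
  have hf : ∃ g : PowerSeries R, f = ((f.trunc (k + 1) : Polynomial R) : PowerSeries R) +
      PowerSeries.X ^ (k + 1) * g := by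
    have : (PowerSeries.X : PowerSeries R) ^ (k + 1) ∣
        f - ((f.trunc (k + 1) : Polynomial R) : PowerSeries R) := by
      rw [PowerSeries.X_pow_dvd_iff]
      intro m hm
      simp [Polynomial.coeff_coe, PowerSeries.coeff_trunc, hm]
    obtain ⟨g, hg⟩ := this
    exact ⟨g, by rw [← hg, add_sub_cancel]⟩
  obtain ⟨g, hg⟩ := hf
  have h3 : ∀ H : PowerSeries R →+* PowerSeries T, PowerSeries.X ∣ H PowerSeries.X →
      PowerSeries.coeff k (H f) = PowerSeries.coeff k (H ((f.trunc (k + 1) : Polynomial R) : PowerSeries R)) := by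
    intro H hH
    conv_lhs => rw [hg]
    rw [map_add, map_mul, map_pow, map_add]
    have : (PowerSeries.X : PowerSeries T) ^ (k + 1) ∣ H PowerSeries.X ^ (k + 1) * H g :=
      (pow_dvd_pow_of_dvd hH _).mul_right _
    rw [PowerSeries.X_pow_dvd_iff] at this
    rw [this k (Nat.lt_succ_self k), add_zero]
  rw [h3 F hX0, h3 G (hX ▸ hX0), h2]

/-- Extension of a ring homomorphism to the `p`-adic completion. -/
theorem exists_extend_completion {L B : Type*} [CommRing L] [CommRing B]
    [IsAdicComplete (Ideal.span {(p : B)}) B] (f : L →+* B) :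
    ∃ F : PCompl p L →+* B, F.comp (algebraMap L (PCompl p L)) = f := by
  have key : ∀ n : ℕ, Ideal.span {(p : L)} ^ n ≤
      RingHom.ker ((Ideal.Quotient.mk (Ideal.span {(p : B)} ^ n)).comp f) := by
    intro n x hx
    rw [Ideal.span_singleton_pow, Ideal.mem_span_singleton] at hx
    obtain ⟨y, rfl⟩ := hx
    rw [RingHom.mem_ker, RingHom.comp_apply, Ideal.Quotient.eq_zero_iff_mem,
      Ideal.span_singleton_pow, Ideal.mem_span_singleton]
    simp
  let g : (n : ℕ) → PCompl p L →+* B ⧸ Ideal.span {(p : B)} ^ n := fun n =>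
    (Ideal.Quotient.lift (Ideal.span {(p : L)} ^ n) _ (fun x hx => RingHom.mem_ker.mp (key n hx))).comp
      (AdicCompletion.evalₐ (Ideal.span {(p : L)}) n : PCompl p L →+* _)
  have hg : ∀ {m n : ℕ} (hle : m ≤ n),
      (Ideal.Quotient.factorPow (Ideal.span {(p : B)}) hle).comp (g n) = g m := by
    intro m n hle
    ext x
    obtain ⟨x, rfl⟩ := AdicCompletion.mk_surjective _ _ x
    simp only [g, RingHom.comp_apply, RingHom.coe_coe, AdicCompletion.evalₐ_mk,
      Ideal.Quotient.lift_mk, Ideal.Quotient.factor_mk]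
    rw [← sub_eq_zero, ← map_sub, Ideal.Quotient.eq_zero_iff_mem, ← map_sub,
      Ideal.span_singleton_pow, Ideal.mem_span_singleton]
    have h5 := x.2 hle
    rw [SModEq.sub_mem, smul_eq_mul, Ideal.mul_top, Ideal.span_singleton_pow,
      Ideal.mem_span_singleton] at h5
    obtain ⟨y, hy⟩ := h5
    refine ⟨- f y, ?_⟩
    have h6 : (x n : L) - x m = (p : L) ^ m * (-y) := by
      rw [mul_neg]
      erw [← hy]
      ring
    rw [h6]
    simp
  refine ⟨IsAdicComplete.liftRingHom _ g hg, ?_⟩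
  symm
  have : ∀ n, (Ideal.Quotient.mk (Ideal.span {(p : B)} ^ n)).comp f =
      (g n).comp (algebraMap L (PCompl p L)) := by
    intro n
    ext x
    simp [g]
  rw [IsAdicComplete.eq_liftRingHom _ (fun n => (g n).comp (algebraMap L (PCompl p L)))
    (fun hle => by rw [← RingHom.comp_assoc, hg hle]) f this]
  symm
  refine IsAdicComplete.eq_liftRingHom _ _ _ _ fun n => ?_
  rw [← RingHom.comp_assoc, IsAdicComplete.mk_comp_liftRingHom]

/-- Lifting along an étale algebra into a complete ring: existence. -/
theorem exists_etale_lift {R₀ S B T : Type*} [CommRing R₀] [CommRing S] [CommRing B] [CommRing T]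
    [Algebra R₀ S] [Algebra.FormallyEtale R₀ S] (π : B →+* T) (hπ : Function.Surjective π)
    [IsAdicComplete (RingHom.ker π) B] (h : R₀ →+* B) (s : S →+* T)
    (hs : s.comp (algebraMap R₀ S) = π.comp h) :
    ∃ f : S →+* B, f.comp (algebraMap R₀ S) = h ∧ π.comp f = s := by
  let := h.toAlgebra
  let e := RingHom.quotientKerEquivOfSurjective hπ
  let s' : S →ₐ[R₀] B ⧸ RingHom.ker π :=
    { (e.symm : T →+* _).comp s with
      commutes' := fun r => by
        have := RingHom.congr_fun hs r
        simp only [RingHom.comp_apply] at this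
        simp only [RingHom.toMonoidHom_eq_coe, OneHom.toFun_eq_coe, MonoidHom.toOneHom_coe,
          MonoidHom.coe_coe, RingHom.comp_apply, RingHom.coe_coe, this]
        rw [RingEquiv.symm_apply_eq]
        rfl }
  obtain ⟨g, hg⟩ := Algebra.FormallySmooth.exists_mkₐ_comp_eq_of_isAdicComplete s'
  refine ⟨g, ?_, ?_⟩
  · ext r
    exact g.commutes r
  · ext x
    have h1 := AlgHom.congr_fun hg x
    have h2 : e (s' x) = s x := by
      change e (e.symm (s x)) = s x
      simp
    rw [← h2, ← h1]
    rfl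

/-- Lifting along an étale algebra into a separated ring: uniqueness. -/
theorem etale_lift_unique {R₀ S B : Type*} [CommRing R₀] [CommRing S] [CommRing B]
    [Algebra R₀ S] [Algebra.FormallyEtale R₀ S] (J : Ideal B) (hJ : ⨅ n : ℕ, J ^ n = ⊥)
    {f g : S →+* B} (h : f.comp (algebraMap R₀ S) = g.comp (algebraMap R₀ S))
    (hmod : ∀ x, f x - g x ∈ J) : f = g := by
  let := (f.comp (algebraMap R₀ S)).toAlgebra
  let f' : S →ₐ[R₀] B := { f with commutes' := fun r => rfl }
  let g' : S →ₐ[R₀] B := { g with commutes' := fun r => (RingHom.congr_fun h r).symm }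
  have : f' = g' := by
    refine Algebra.FormallyUnramified.ext_of_iInf (I := J) hJ fun x => ?_
    rw [Ideal.Quotient.mk_eq_mk_iff_sub_mem]
    exact hmod x
  ext x
  exact AlgHom.congr_fun this x

theorem iInf_pow_span_p_eq_bot {T : Type*} [CommRing T] (h : PSep p T) :
    ⨅ n : ℕ, Ideal.span {(p : T)} ^ n = ⊥ := by
  rw [eq_bot_iff]
  intro t ht
  rw [Ideal.mem_bot]
  refine h t fun n => ?_
  have := (Ideal.mem_iInf.mp ht) n
  rwa [Ideal.span_singleton_pow, Ideal.mem_span_singleton] at this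

theorem iInf_pow_span_X_eq_bot (T : Type*) [CommRing T] :
    ⨅ n : ℕ, Ideal.span {(PowerSeries.X : PowerSeries T)} ^ n = ⊥ := by
  rw [eq_bot_iff]
  intro t ht
  rw [Ideal.mem_bot]
  ext k
  have := (Ideal.mem_iInf.mp ht) (k + 1)
  rw [Ideal.span_singleton_pow, Ideal.mem_span_singleton, PowerSeries.X_pow_dvd_iff] at this
  simpa using this k (Nat.lt_succ_self k)

instance powerSeries_isAdicComplete_p (T : Type*) [CommRing T]
    [IsAdicComplete (Ideal.span {(p : T)}) T] :
    IsAdicComplete (Ideal.span {(p : PowerSeries T)}) (PowerSeries T) where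
  haus' f hf := by
    refine (PSep.of_isAdicComplete (p := p) T).powerSeries f fun n => ?_
    have := hf n
    rwa [SModEq.zero, Ideal.span_singleton_pow, smul_eq_mul, Ideal.mul_top,
      Ideal.mem_span_singleton] at this
  prec' f hf := by
    have hconv : ∀ {T' : Type _} [CommRing T'] (n : ℕ) (a b : T'),
        a ≡ b [SMOD (Ideal.span {(p : T')} ^ n • ⊤ : Ideal T')] ↔ (p : T') ^ n ∣ a - b := by
      intro T' _ n a b
      rw [SModEq.sub_mem, Ideal.span_singleton_pow, smul_eq_mul, Ideal.mul_top,
        Ideal.mem_span_singleton]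
    have hC : ∀ n : ℕ, (p : PowerSeries T) ^ n = PowerSeries.C ((p : T) ^ n) := by simp
    have h1 : ∀ k : ℕ, ∃ L : T, ∀ n, PowerSeries.coeff k (f n) ≡ L
        [SMOD (Ideal.span {(p : T)} ^ n • ⊤ : Ideal T)] := by
      intro k
      refine IsPrecomplete.prec (I := Ideal.span {(p : T)}) inferInstance ?_
      intro m n hmn
      have := hf hmn
      rw [hconv] at this ⊢
      obtain ⟨g, hg⟩ := this
      rw [← map_sub, hg, hC, PowerSeries.coeff_C_mul]
      exact dvd_mul_right _ _
    choose L hL using h1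
    refine ⟨PowerSeries.mk L, fun n => ?_⟩
    rw [hconv]
    have h2 : ∀ k, (p : T) ^ n ∣ PowerSeries.coeff k (f n) - L k := fun k => by
      have := hL k n
      rwa [hconv] at this
    choose g hg using h2
    refine ⟨PowerSeries.mk g, ?_⟩
    ext k
    rw [hC, PowerSeries.coeff_C_mul, map_sub, PowerSeries.coeff_mk, PowerSeries.coeff_mk, hg]

open scoped PowerSeries.WithPiTopology in
/-- Extension of `f : R → T⟦X⟧` to `R⟦X⟧ → T⟦X⟧` with prescribed value `ν ∈ (X)` on `X`. -/
theorem exists_extend_powerSeries {R T : Type*} [CommRing R] [CommRing T]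
    (f : R →+* PowerSeries T) (ν : PowerSeries T) (hν : PowerSeries.constantCoeff ν = 0) :
    ∃ F : PowerSeries R →+* PowerSeries T, (∀ r, F (PowerSeries.C r) = f r) ∧
      F PowerSeries.X = ν := by
  let : UniformSpace R := ⊥
  let : UniformSpace T := ⊥
  have : DiscreteTopology R := ⟨rfl⟩
  have : DiscreteTopology T := ⟨rfl⟩
  have : IsUniformAddGroup R := inferInstance
  have : IsUniformAddGroup T := inferInstance
  have : CompleteSpace T := inferInstance
  have hev : PowerSeries.HasEval ν :=
    PowerSeries.WithPiTopology.isTopologicallyNilpotent_of_constantCoeff_zero hν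
  have hc : Continuous f := continuous_of_discreteTopology
  refine ⟨PowerSeries.eval₂Hom hc hev, ?_, ?_⟩
  · intro r
    rw [PowerSeries.coe_eval₂Hom, PowerSeries.eval₂_C]
  · rw [PowerSeries.coe_eval₂Hom, PowerSeries.eval₂_X]

end Rings


/-! ### The ring `ℤ_p⟦μ⟧` and the powers `(1 + μ) ^ c` -/

section QPow

variable (p : ℕ) [Fact p.Prime]

/-- The base ring `D = ℤ_p⟦μ⟧`. -/
abbrev DRing : Type := PowerSeries ℤ_[p]

/-- The binomial series `(1 + μ) ^ c = ∑ k, (c choose k) μ ^ k` for `c ∈ ℤ_p`. -/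
noncomputable def qpow (c : ℤ_[p]) : DRing p := PowerSeries.binomialSeries ℤ_[p] c

theorem qpow_add (c c' : ℤ_[p]) : qpow p (c + c') = qpow p c * qpow p c' :=
  PowerSeries.binomialSeries_add c c'

theorem qpow_zero : qpow p 0 = 1 := PowerSeries.binomialSeries_zero

theorem qpow_natCast (n : ℕ) : qpow p n = (1 + PowerSeries.X) ^ n :=
  PowerSeries.binomialSeries_nat n

theorem qpow_one : qpow p 1 = 1 + PowerSeries.X := by
  have := qpow_natCast p 1
  rwa [Nat.cast_one, pow_one] at this

theorem qpow_coeff (c : ℤ_[p]) (k : ℕ) : PowerSeries.coeff k (qpow p c) = Ring.choose c k := by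
  simp [qpow]

theorem qpow_constantCoeff (c : ℤ_[p]) : PowerSeries.constantCoeff (qpow p c) = 1 :=
  PowerSeries.binomialSeries_constantCoeff c

theorem exists_natCast_sub_dvd (n : ℕ) (r : ℤ_[p]) :
    ∃ s : ℤ, (p : ℤ_[p]) ^ n ∣ r - Int.castRingHom ℤ_[p] s := by
  refine ⟨(r.appr n : ℕ), ?_⟩
  have := PadicInt.appr_spec n r
  rw [Ideal.mem_span_singleton] at this
  simpa using this

variable {p}

theorem PadicInt_psep : PSep p ℤ_[p] := by
  intro t ht
  refine PadicInt.ext_of_toZModPow.mp fun n => ?_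
  obtain ⟨u, rfl⟩ := ht n
  have : ((p : ZMod (p ^ n)) ^ n) = 0 := by
    rw [← Nat.cast_pow, ZMod.natCast_self]
  simp [this]

/-- A ring homomorphism `ℤ_p⟦μ⟧ → T⟦μ⟧` sending `1 + μ` to the image of `(1 + μ) ^ u` sends
`(1 + μ) ^ c` to the image of `(1 + μ) ^ (u c)`. -/
theorem map_qpow {T : Type*} [CommRing T] (hT : PSep p T) (f : ℤ_[p] →+* T) (u : ℤ_[p])
    (E : DRing p →+* PowerSeries T)
    (hE : E PowerSeries.X = PowerSeries.map f (qpow p u - 1)) (c : ℤ_[p]) :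
    E (qpow p c) = PowerSeries.map f (qpow p (u * c)) := by
  have h0 : PowerSeries.constantCoeff (qpow p u - 1) = 0 := by
    rw [map_sub, qpow_constantCoeff, map_one, sub_self]
  obtain ⟨K, hKC, hKX⟩ := exists_extend_powerSeries
    (PowerSeries.C : ℤ_[p] →+* PowerSeries ℤ_[p]) (qpow p u - 1) h0
  have hEK : E = (PowerSeries.map f).comp K := by
    refine hom_ext_powerSeries (Int.castRingHom ℤ_[p]) (exists_natCast_sub_dvd p) hT ?_ ?_ ?_
    · intro s
      simp
    · rw [hE, RingHom.comp_apply, hKX]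
    · rw [hE, PowerSeries.X_dvd_iff, ← PowerSeries.coeff_zero_eq_constantCoeff_apply,
        PowerSeries.coeff_map, PowerSeries.coeff_zero_eq_constantCoeff_apply, h0, map_zero]
  rw [hEK, RingHom.comp_apply]
  congr 1
  ext k
  have hX : (PowerSeries.X : PowerSeries ℤ_[p]) ∣ K PowerSeries.X := by
    rw [hKX, PowerSeries.X_dvd_iff, h0]
  have key : ∀ g : DRing p, PowerSeries.coeff k (K g) =
      ∑ j ∈ Finset.range (k + 1), PowerSeries.coeff j g *
        PowerSeries.coeff k ((qpow p u - 1) ^ j) := by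
    intro g
    have h1 : (PowerSeries.X : PowerSeries ℤ_[p]) ^ (k + 1) ∣
        g - ((g.trunc (k + 1) : Polynomial ℤ_[p]) : PowerSeries ℤ_[p]) := by
      rw [PowerSeries.X_pow_dvd_iff]
      intro m hm
      simp [Polynomial.coeff_coe, PowerSeries.coeff_trunc, hm]
    obtain ⟨w, hw⟩ := h1
    have h2 : g = ((g.trunc (k + 1) : Polynomial ℤ_[p]) : PowerSeries ℤ_[p]) +
        PowerSeries.X ^ (k + 1) * w := by rw [← hw, add_sub_cancel]
    have h3 : (PowerSeries.X : PowerSeries ℤ_[p]) ^ (k + 1) ∣ K PowerSeries.X ^ (k + 1) * K w :=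
      (pow_dvd_pow_of_dvd hX _).mul_right _
    rw [PowerSeries.X_pow_dvd_iff] at h3
    conv_lhs => rw [h2]
    rw [map_add, map_mul, map_pow, map_add, h3 k (Nat.lt_succ_self k), add_zero]
    have h4 : ((g.trunc (k + 1) : Polynomial ℤ_[p]) : PowerSeries ℤ_[p]) =
        ∑ i ∈ Finset.range (k + 1), PowerSeries.C (PowerSeries.coeff i g) * PowerSeries.X ^ i := by
      ext m
      simp [Polynomial.coeff_coe, PowerSeries.coeff_trunc, PowerSeries.coeff_X_pow]
    rw [h4, map_sum, map_sum]
    refine Finset.sum_congr rfl fun i _ => ?_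
    rw [map_mul, map_pow, hKC, hKX, PowerSeries.coeff_C_mul]
  have hcont : Continuous fun c : ℤ_[p] => PowerSeries.coeff k (K (qpow p c)) := by
    simp only [key, qpow_coeff]
    fun_prop
  have hcont' : Continuous fun c : ℤ_[p] => PowerSeries.coeff k (qpow p (u * c)) := by
    simp only [qpow_coeff]
    exact (PadicInt.continuous_choose k).comp (continuous_const.mul continuous_id)
  refine congr_fun (PadicInt.denseRange_natCast.equalizer hcont hcont' ?_) c
  ext n
  simp only [Function.comp_apply]
  rw [qpow_natCast, map_pow, map_add, map_one, hKX, add_sub_cancel]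
  congr 1
  induction n with
  | zero => simp [qpow_zero]
  | succ n ih => rw [pow_succ, ih, Nat.cast_succ, mul_add, mul_one, qpow_add]

end QPow


/-! ### The base rings -/

section BaseRings

variable (p : ℕ) [Fact p.Prime] (κ : Type*) [Field κ] (d : ℕ)

/-- The Laurent polynomial ring `W(κ)[X₁^±1, …, X_d^±1]`. -/
abbrev Laurent : Type _ := AddMonoidAlgebra (WittVector p κ) (Fin d → ℤ)

/-- `R^□`, the `p`-adic completion of `W(κ)[X₁^±1, …, X_d^±1]`. -/
abbrev RSquare : Type _ := PCompl p (Laurent p κ d)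

variable (S : Type*) [CommRing S] [Algebra (RSquare p κ d) S]

/-- The structure map `W(κ)[X₁^±1, …, X_d^±1] → R`, where `R` is the `p`-adic completion of the
`R^□`-algebra `S`. -/
noncomputable def ofLaurent : Laurent p κ d →+* PCompl p S :=
  (algebraMap S (PCompl p S)).comp
    ((algebraMap (RSquare p κ d) S).comp (algebraMap (Laurent p κ d) (RSquare p κ d)))

/-- The monomial `w X₁^(n 1) ⋯ X_d^(n d)` in `R`. -/
noncomputable def mono (n : Fin d → ℤ) (w : WittVector p κ) : PCompl p S :=
  ofLaurent p κ d S (AddMonoidAlgebra.single n w)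

/-- The coordinate `X_i` in `R`. -/
noncomputable def coord (i : Fin d) : PCompl p S := mono p κ d S (Pi.single i 1) 1

/-- The structure map `W(κ) → R`. -/
noncomputable def wittToR : WittVector p κ →+* PCompl p S :=
  (ofLaurent p κ d S).comp AddMonoidAlgebra.singleZeroRingHom

/-- The inclusion `ℤ_p = W(𝔽_p) → W(κ) → R`. -/
noncomputable def padicToR [CharP κ p] : ℤ_[p] →+* PCompl p S :=
  (wittToR p κ d S).comp
    ((WittVector.map (ZMod.castHom (dvd_refl p) κ)).comp
      ((WittVector.equiv p).symm : ℤ_[p] →+* WittVector p (ZMod p)))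

/-- The structure map `ℤ_p⟦μ⟧ → A_R^+ = R⟦μ⟧`. -/
noncomputable def dToA [CharP κ p] : DRing p →+* PowerSeries (PCompl p S) :=
  PowerSeries.map (padicToR p κ d S)

variable {p κ d S}

theorem mono_mul (m n : Fin d → ℤ) (v w : WittVector p κ) :
    mono p κ d S (m + n) (v * w) = mono p κ d S m v * mono p κ d S n w := by
  rw [mono, mono, mono, ← map_mul, AddMonoidAlgebra.single_mul_single]

theorem mono_zero_one : mono p κ d S 0 1 = 1 := by
  rw [mono, ← AddMonoidAlgebra.one_def, map_one]

/-- Existence of liftings along `S` of homomorphisms out of the Laurent polynomial ring. -/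
theorem exists_lift_S [Algebra.FormallyEtale (RSquare p κ d) S] {B T : Type*} [CommRing B]
    [CommRing T] [IsAdicComplete (Ideal.span {(p : B)}) B] (hT : PSep p T) (π : B →+* T)
    (hπ : Function.Surjective π) [IsAdicComplete (RingHom.ker π) B] (h : Laurent p κ d →+* B)
    (s : S →+* T)
    (hs : s.comp ((algebraMap (RSquare p κ d) S).comp
      (algebraMap (Laurent p κ d) (RSquare p κ d))) = π.comp h) :
    ∃ f : PCompl p S →+* B, f.comp (ofLaurent p κ d S) = h ∧
      ∀ x, π (f (algebraMap S (PCompl p S) x)) = s x := by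
  obtain ⟨h', hh'⟩ := exists_extend_completion (p := p) h
  have h1 : s.comp (algebraMap (RSquare p κ d) S) = π.comp h' := by
    refine hom_ext_dense (algebraMap (Laurent p κ d) (RSquare p κ d))
      (PCompl.exists_sub_dvd) hT ?_
    rw [RingHom.comp_assoc, hs, RingHom.comp_assoc, hh']
  obtain ⟨f₀, hf₀, hf₀'⟩ := exists_etale_lift π hπ h' s h1
  obtain ⟨f, hf⟩ := exists_extend_completion (p := p) f₀
  refine ⟨f, ?_, fun x => ?_⟩
  · rw [ofLaurent, ← RingHom.comp_assoc, hf, ← RingHom.comp_assoc, hf₀, hh']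
  · rw [← hf₀', ← hf]
    rfl

/-- Uniqueness of liftings along `S` of homomorphisms out of the Laurent polynomial ring. -/
theorem lift_S_unique [Algebra.FormallyEtale (RSquare p κ d) S] {B : Type*} [CommRing B]
    (hB : PSep p B) (J : Ideal B) (hJ : ⨅ n : ℕ, J ^ n = ⊥) {f g : PCompl p S →+* B}
    (h : ∀ n w, f (mono p κ d S n w) = g (mono p κ d S n w))
    (hmod : ∀ x, f (algebraMap S (PCompl p S) x) - g (algebraMap S (PCompl p S) x) ∈ J) :
    f = g := by
  refine hom_ext_dense (algebraMap S (PCompl p S)) PCompl.exists_sub_dvd hB ?_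
  refine etale_lift_unique (R₀ := RSquare p κ d) J hJ ?_ hmod
  refine hom_ext_dense (algebraMap (Laurent p κ d) (RSquare p κ d)) PCompl.exists_sub_dvd hB ?_
  refine AddMonoidAlgebra.ringHom_ext (fun r => ?_) (fun m => ?_)
  · exact h 0 r
  · exact h m 1

/-- Uniqueness for endomorphisms of `R⟦μ⟧`. -/
theorem powerSeries_hom_unique [Algebra.FormallyEtale (RSquare p κ d) S]
    (J : Ideal (PowerSeries (PCompl p S))) (hJ : ⨅ n : ℕ, J ^ n = ⊥)
    {F G : PowerSeries (PCompl p S) →+* PowerSeries (PCompl p S)}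
    (h : ∀ n w, F (PowerSeries.C (mono p κ d S n w)) = G (PowerSeries.C (mono p κ d S n w)))
    (hmod : ∀ x, F (PowerSeries.C x) - G (PowerSeries.C x) ∈ J)
    (hX : F PowerSeries.X = G PowerSeries.X) (hX0 : PowerSeries.X ∣ F PowerSeries.X) : F = G := by
  have hs : PSep p (PCompl p S) := PCompl.psep S
  have h1 : F.comp PowerSeries.C = G.comp PowerSeries.C :=
    lift_S_unique (p := p) (κ := κ) (d := d) hs.powerSeries J hJ h fun x => hmod _
  refine hom_ext_powerSeries (RingHom.id _) (fun n r => ⟨r, by simp⟩) hs ?_ hX hX0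
  intro s
  exact RingHom.congr_fun h1 s

end BaseRings

/-! ### The Galois action on `A_R^+ = R⟦μ⟧` -/

section Gamma

variable (p : ℕ) [Fact p.Prime] (κ : Type*) [Field κ] [CharP κ p] (d : ℕ)
variable (S : Type*) [CommRing S] [Algebra (RSquare p κ d) S]

/-- The ring endomorphism `E` of `A_R^+` is `W(κ)`-linear, trivial modulo `μ`, and satisfies
`E [X_i^♭] = (1 + μ) ^ (c i) [X_i^♭]` and `E (1 + μ) = (1 + μ) ^ u`. -/
structure IsGammaLift (c : Fin d → ℤ_[p]) (u : ℤ_[p])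
    (E : PowerSeries (PCompl p S) →+* PowerSeries (PCompl p S)) : Prop where
  map_mono : ∀ n w, E (PowerSeries.C (mono p κ d S n w)) =
    dToA p κ d S (qpow p (∑ i, (n i : ℤ_[p]) * c i)) * PowerSeries.C (mono p κ d S n w)
  map_X : E PowerSeries.X = dToA p κ d S (qpow p u - 1)
  mod_X : ∀ a, PowerSeries.constantCoeff (E a) = PowerSeries.constantCoeff a

variable {p κ d S}

theorem dToA_sub_one_constantCoeff (u : ℤ_[p]) :
    PowerSeries.constantCoeff (dToA p κ d S (qpow p u - 1)) = 0 := by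
  rw [dToA, ← PowerSeries.coeff_zero_eq_constantCoeff_apply, PowerSeries.coeff_map,
    PowerSeries.coeff_zero_eq_constantCoeff_apply, map_sub, qpow_constantCoeff, map_one, sub_self,
    map_zero]

theorem dToA_constantCoeff (u : ℤ_[p]) :
    PowerSeries.constantCoeff (dToA p κ d S (qpow p u)) = 1 := by
  have := dToA_sub_one_constantCoeff (κ := κ) (d := d) (S := S) u
  rw [map_sub, map_sub, map_one, map_one, sub_eq_zero] at this
  exact this

/-- An endomorphism of `A_R^+` with `1 + μ ↦ (1 + μ) ^ u` maps `(1 + μ) ^ c` to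
`(1 + μ) ^ (u c)`. -/
theorem map_dToA_qpow {E : PowerSeries (PCompl p S) →+* PowerSeries (PCompl p S)} {u : ℤ_[p]}
    (hE : E PowerSeries.X = dToA p κ d S (qpow p u - 1)) (c : ℤ_[p]) :
    E (dToA p κ d S (qpow p c)) = dToA p κ d S (qpow p (u * c)) := by
  refine map_qpow (PCompl.psep S) (padicToR p κ d S) u (E.comp (dToA p κ d S)) ?_ c
  rw [RingHom.comp_apply, dToA, PowerSeries.map_X, hE, dToA]

theorem exists_isGammaLift [Algebra.FormallyEtale (RSquare p κ d) S] (c : Fin d → ℤ_[p])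
    (u : ℤ_[p]) : ∃ E, IsGammaLift p κ d S c u E := by
  let g : Multiplicative (Fin d → ℤ) →* PowerSeries (PCompl p S) :=
    { toFun := fun n => dToA p κ d S (qpow p (∑ i, ((n.toAdd i : ℤ) : ℤ_[p]) * c i)) *
        PowerSeries.C (mono p κ d S n.toAdd 1)
      map_one' := by simp [qpow_zero, mono_zero_one]
      map_mul' := fun m n => by
        have h1 : mono p κ d S (m.toAdd + n.toAdd) 1 =
            mono p κ d S m.toAdd 1 * mono p κ d S n.toAdd 1 := by
          rw [← mono_mul, one_mul]
        simp only [toAdd_mul, h1, Pi.add_apply, Int.cast_add, add_mul, Finset.sum_add_distrib,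
          qpow_add, map_mul]
        ring }
  let h : Laurent p κ d →+* PowerSeries (PCompl p S) :=
    AddMonoidAlgebra.liftNCRingHom (PowerSeries.C.comp (wittToR p κ d S)) g
      (fun _ _ => Commute.all _ _)
  have hh : ∀ n w, h (AddMonoidAlgebra.single n w) =
      dToA p κ d S (qpow p (∑ i, ((n i : ℤ) : ℤ_[p]) * c i)) *
        PowerSeries.C (mono p κ d S n w) := by
    intro n w
    have h2 : mono p κ d S n w = wittToR p κ d S w * mono p κ d S n 1 := by
      have := mono_mul (S := S) 0 n w 1
      rw [zero_add, mul_one] at this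
      exact this
    have h3 : h (AddMonoidAlgebra.single n w) =
      PowerSeries.C (wittToR p κ d S w) * g (Multiplicative.ofAdd n) :=
      AddMonoidAlgebra.liftNCRingHom_single _ _ _ _ _
    rw [h3, h2, map_mul]
    change _ * (dToA p κ d S (qpow p (∑ i, ((n i : ℤ) : ℤ_[p]) * c i)) *
        PowerSeries.C (mono p κ d S n 1)) = _
    ring
  have hker : RingHom.ker (PowerSeries.constantCoeff : PowerSeries (PCompl p S) →+* _) =
      Ideal.span {PowerSeries.X} := by
    ext f
    rw [RingHom.mem_ker, Ideal.mem_span_singleton, PowerSeries.X_dvd_iff]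
  have : IsAdicComplete (RingHom.ker
      (PowerSeries.constantCoeff : PowerSeries (PCompl p S) →+* _)) (PowerSeries (PCompl p S)) := by
    rw [hker]
    infer_instance
  obtain ⟨f, hf, hf'⟩ := exists_lift_S (p := p) (κ := κ) (d := d) (PCompl.psep S)
    (PowerSeries.constantCoeff : PowerSeries (PCompl p S) →+* _)
    (fun r => ⟨PowerSeries.C r, by simp⟩) h (algebraMap S (PCompl p S)) (by
      refine AddMonoidAlgebra.ringHom_ext (fun r => ?_) (fun m => ?_)
      · change mono p κ d S 0 r = PowerSeries.constantCoeff (h _)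
        erw [hh]
        rw [map_mul, dToA_constantCoeff, PowerSeries.constantCoeff_C, one_mul]
      · change mono p κ d S m 1 = PowerSeries.constantCoeff (h _)
        erw [hh]
        rw [map_mul, dToA_constantCoeff, PowerSeries.constantCoeff_C, one_mul])
  obtain ⟨E, hE, hEX⟩ := exists_extend_powerSeries f (dToA p κ d S (qpow p u - 1))
    (dToA_sub_one_constantCoeff u)
  refine ⟨E, ?_, hEX, ?_⟩
  · intro n w
    rw [hE, ← hh, ← hf]
    rfl
  · have h4 : (PowerSeries.constantCoeff : PowerSeries (PCompl p S) →+* _).comp f =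
        RingHom.id _ := by
      refine hom_ext_dense (algebraMap S (PCompl p S)) PCompl.exists_sub_dvd (PCompl.psep S) ?_
      exact RingHom.ext hf'
    intro a
    obtain ⟨b, hb⟩ : ∃ b, a = PowerSeries.C (PowerSeries.constantCoeff a) + PowerSeries.X * b := by
      have : (PowerSeries.X : PowerSeries (PCompl p S)) ∣
          a - PowerSeries.C (PowerSeries.constantCoeff a) := by
        rw [PowerSeries.X_dvd_iff]
        simp
      obtain ⟨b, hb⟩ := this
      exact ⟨b, by rw [← hb, add_sub_cancel]⟩
    have h5 := RingHom.congr_fun h4 (PowerSeries.constantCoeff a)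
    simp only [RingHom.comp_apply, RingHom.id_apply] at h5
    conv_lhs => rw [hb]
    rw [map_add, map_add, map_mul, map_mul, hEX, dToA_sub_one_constantCoeff, zero_mul, add_zero,
      hE, h5]

theorem IsGammaLift.unique [Algebra.FormallyEtale (RSquare p κ d) S] {c : Fin d → ℤ_[p]}
    {u : ℤ_[p]} {E E' : PowerSeries (PCompl p S) →+* PowerSeries (PCompl p S)}
    (hE : IsGammaLift p κ d S c u E) (hE' : IsGammaLift p κ d S c u E') : E = E' := by
  refine powerSeries_hom_unique (p := p) (κ := κ) (d := d) (Ideal.span {PowerSeries.X})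
    (iInf_pow_span_X_eq_bot _) ?_ ?_ ?_ ?_
  · intro n w
    rw [hE.map_mono, hE'.map_mono]
  · intro x
    rw [Ideal.mem_span_singleton, PowerSeries.X_dvd_iff, map_sub, hE.mod_X, hE'.mod_X, sub_self]
  · rw [hE.map_X, hE'.map_X]
  · rw [hE.map_X, PowerSeries.X_dvd_iff, dToA_sub_one_constantCoeff]

theorem IsGammaLift.id : IsGammaLift p κ d S 0 1 (RingHom.id _) where
  map_mono n w := by simp [qpow_zero]
  map_X := by simp [qpow_one, dToA]
  mod_X _ := rfl

theorem IsGammaLift.comp {c c' : Fin d → ℤ_[p]} {u u' : ℤ_[p]}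
    {E E' : PowerSeries (PCompl p S) →+* PowerSeries (PCompl p S)}
    (hE : IsGammaLift p κ d S c u E) (hE' : IsGammaLift p κ d S c' u' E') :
    IsGammaLift p κ d S (c + u • c') (u * u') (E.comp E') where
  map_mono n w := by
    have h1 : ∑ i, (n i : ℤ_[p]) * (c + u • c') i =
        u * (∑ i, (n i : ℤ_[p]) * c' i) + ∑ i, (n i : ℤ_[p]) * c i := by
      rw [Finset.mul_sum, ← Finset.sum_add_distrib]
      refine Finset.sum_congr rfl fun i _ => ?_
      simp only [Pi.add_apply, Pi.smul_apply, smul_eq_mul]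
      ring
    rw [RingHom.comp_apply, hE'.map_mono, map_mul, hE.map_mono, map_dToA_qpow hE.map_X, h1,
      qpow_add, map_mul, mul_assoc]
  map_X := by
    rw [RingHom.comp_apply, hE'.map_X, map_sub, map_sub, map_dToA_qpow hE.map_X, map_one, map_one,
      map_sub, map_one]
  mod_X a := by rw [RingHom.comp_apply, hE.mod_X, hE'.mod_X]

variable (p κ d S)

/-- The endomorphism of `A_R^+` attached to `(c, u)`: the unique one with
`IsGammaLift p κ d S c u`. -/
noncomputable def gammaLift [Algebra.FormallyEtale (RSquare p κ d) S] (c : Fin d → ℤ_[p])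
    (u : ℤ_[p]) : PowerSeries (PCompl p S) →+* PowerSeries (PCompl p S) :=
  (exists_isGammaLift (κ := κ) (S := S) c u).choose

theorem gammaLift_spec [Algebra.FormallyEtale (RSquare p κ d) S] (c : Fin d → ℤ_[p])
    (u : ℤ_[p]) : IsGammaLift p κ d S c u (gammaLift p κ d S c u) :=
  (exists_isGammaLift (κ := κ) (S := S) c u).choose_spec

end Gamma


/-! ### The Frobenius on `A_R^+ = R⟦μ⟧` -/

section Frob

variable (p : ℕ) [Fact p.Prime] (κ : Type*) [Field κ] [CharP κ p] (d : ℕ)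
variable (S : Type*) [CommRing S] [Algebra (RSquare p κ d) S]

/-- The ring endomorphism `F` of `A_R^+` extends the Witt vector Frobenius on `W(κ)`, satisfies
`F [X_i^♭] = [X_i^♭] ^ p` and `F μ = (1 + μ) ^ p - 1`, and lifts the Frobenius modulo `p`. -/
structure IsFrobLift (F : PowerSeries (PCompl p S) →+* PowerSeries (PCompl p S)) : Prop where
  map_mono : ∀ n w, F (PowerSeries.C (mono p κ d S n w)) =
    PowerSeries.C (mono p κ d S (p • n) (WittVector.frobenius w))
  map_X : F PowerSeries.X = (1 + PowerSeries.X) ^ p - 1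
  mod_p : ∀ a, (p : PowerSeries (PCompl p S)) ∣ F a - a ^ p

variable {p κ d S}

theorem exists_pow_hom {T : Type*} [CommRing T] (hT : (p : T) = 0) :
    ∃ f : T →+* T, ∀ x, f x = x ^ p := by
  have hp : p.Prime := Fact.out
  exact ⟨{
    toFun := fun x => x ^ p
    map_one' := one_pow p
    map_mul' := fun x y => mul_pow x y p
    map_zero' := zero_pow hp.ne_zero
    map_add' := fun x y => by
      obtain ⟨r, hr⟩ := exists_add_pow_prime_eq hp x y
      rw [hr, hT]
      ring }, fun _ => rfl⟩

/-- A lift of Frobenius on a dense subring gives a lift of Frobenius on power series. -/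
theorem frob_mod_p {S' R : Type*} [CommRing S'] [CommRing R] (i : S' →+* R)
    (hi : ∀ (n : ℕ) (r : R), ∃ s : S', (p : R) ^ n ∣ r - i s)
    {F : PowerSeries R →+* PowerSeries R} (hFX : F PowerSeries.X = (1 + PowerSeries.X) ^ p - 1)
    (hF : ∀ s, PowerSeries.map (Ideal.Quotient.mk (Ideal.span {(p : R)}))
      (F (PowerSeries.C (i s))) = PowerSeries.map (Ideal.Quotient.mk (Ideal.span {(p : R)}))
      (PowerSeries.C (i s)) ^ p) (a : PowerSeries R) :
    (p : PowerSeries R) ∣ F a - a ^ p := by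
  have hpT : (p : R ⧸ Ideal.span {(p : R)}) = 0 := by
    have : (Ideal.Quotient.mk (Ideal.span {(p : R)})) (p : R) = 0 :=
      Ideal.Quotient.eq_zero_iff_mem.mpr (Ideal.mem_span_singleton_self _)
    simpa using this
  have hpT' : (p : PowerSeries (R ⧸ Ideal.span {(p : R)})) = 0 := by
    rw [← map_natCast (PowerSeries.C : R ⧸ Ideal.span {(p : R)} →+* _), hpT, map_zero]
  obtain ⟨P', hP'⟩ := exists_pow_hom hpT'
  have h6 : (PowerSeries.map (Ideal.Quotient.mk (Ideal.span {(p : R)}))).comp F =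
      P'.comp (PowerSeries.map (Ideal.Quotient.mk (Ideal.span {(p : R)}))) := by
    refine hom_ext_powerSeries (p := p) i hi (fun t ht => ?_) (fun s => ?_) ?_ ?_
    · obtain ⟨u, hu⟩ := ht 1
      rw [hu, pow_one, hpT, zero_mul]
    · rw [RingHom.comp_apply, hF, RingHom.comp_apply, hP']
    · rw [RingHom.comp_apply, hFX, RingHom.comp_apply, PowerSeries.map_X, hP', map_sub, map_pow,
        map_add, map_one, PowerSeries.map_X, ← hP', map_add, hP', hP']
      ring
    · rw [RingHom.comp_apply, hFX, map_sub, map_pow, map_add, map_one, PowerSeries.map_X,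
        PowerSeries.X_dvd_iff]
      simp
  have h7 := RingHom.congr_fun h6 a
  rw [RingHom.comp_apply, RingHom.comp_apply, hP', ← map_pow, ← sub_eq_zero, ← map_sub] at h7
  have h8 : ∀ k, ∃ b, PowerSeries.coeff k (F a - a ^ p) = p * b := by
    intro k
    have := congr_arg (PowerSeries.coeff k) h7
    rw [PowerSeries.coeff_map, map_zero, Ideal.Quotient.eq_zero_iff_mem] at this
    exact Ideal.mem_span_singleton.mp this
  choose b hb using h8
  refine ⟨PowerSeries.mk b, ?_⟩
  ext k
  rw [hb, ← map_natCast (PowerSeries.C : R →+* _), PowerSeries.coeff_C_mul, PowerSeries.coeff_mk]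

theorem exists_isFrobLift [PerfectRing κ p] [Algebra.FormallyEtale (RSquare p κ d) S] :
    ∃ F, IsFrobLift p κ d S F := by
  have hp : p.Prime := Fact.out
  let I : Ideal (PCompl p S) := Ideal.span {(p : PCompl p S)}
  have hpT : (p : PCompl p S ⧸ I) = 0 := by
    have : (Ideal.Quotient.mk I) (p : PCompl p S) = 0 :=
      Ideal.Quotient.eq_zero_iff_mem.mpr (Ideal.mem_span_singleton_self _)
    simpa using this
  obtain ⟨P, hP⟩ := exists_pow_hom hpT
  let g : Multiplicative (Fin d → ℤ) →* PCompl p S :=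
    { toFun := fun n => mono p κ d S (p • n.toAdd) 1
      map_one' := by simp [mono_zero_one]
      map_mul' := fun m n => by rw [toAdd_mul, smul_add, ← mono_mul, one_mul] }
  let h : Laurent p κ d →+* PCompl p S :=
    AddMonoidAlgebra.liftNCRingHom ((wittToR p κ d S).comp WittVector.frobenius) g
      (fun _ _ => Commute.all _ _)
  have hh : ∀ n w, h (AddMonoidAlgebra.single n w) =
      mono p κ d S (p • n) (WittVector.frobenius w) := by
    intro n w
    have h3 : h (AddMonoidAlgebra.single n w) =
      (wittToR p κ d S (WittVector.frobenius w)) * g (Multiplicative.ofAdd n) :=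
      AddMonoidAlgebra.liftNCRingHom_single _ _ _ _ _
    rw [h3]
    have := mono_mul (S := S) 0 (p • n) (WittVector.frobenius w) 1
    rw [zero_add, mul_one] at this
    exact this.symm
  have hker : RingHom.ker (Ideal.Quotient.mk I) = Ideal.span {(p : PCompl p S)} :=
    Ideal.mk_ker
  have : IsAdicComplete (RingHom.ker (Ideal.Quotient.mk I)) (PCompl p S) := by
    rw [hker]
    infer_instance
  have hW : ∀ w : WittVector p κ, ∃ v, WittVector.frobenius w = w ^ p + p * v := by
    intro w
    have : WittVector.frobenius w - w ^ p ∈ Ideal.span {(p : WittVector p κ)} := by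
      rw [WittVector.mem_span_p_iff_coeff_zero_eq_zero]
      change WittVector.constantCoeff (WittVector.frobenius w - w ^ p) = 0
      rw [map_sub, map_pow]
      change (WittVector.frobenius w).coeff 0 - w.coeff 0 ^ p = 0
      rw [WittVector.coeff_frobenius_charP, sub_self]
    obtain ⟨v, hv⟩ := Ideal.mem_span_singleton.mp this
    exact ⟨v, by rw [← hv]; ring⟩
  have hpow : ∀ (n : Fin d → ℤ) (w : WittVector p κ) (k : ℕ),
      mono p κ d S n w ^ k = mono p κ d S (k • n) (w ^ k) := by
    intro n w k
    induction k with
    | zero => simp [mono_zero_one]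
    | succ k ih => rw [pow_succ, ih, ← mono_mul, succ_nsmul, pow_succ]
  have hmon : ∀ (n : Fin d → ℤ) (w : WittVector p κ),
      P (Ideal.Quotient.mk I (mono p κ d S n w)) =
        Ideal.Quotient.mk I (mono p κ d S (p • n) (WittVector.frobenius w)) := by
    intro n w
    obtain ⟨v, hv⟩ := hW w
    have h5 : mono p κ d S (p • n) (w ^ p + p * v) =
        mono p κ d S n w ^ p + (p : PCompl p S) * mono p κ d S (p • n) v := by
      rw [hpow, mono, mono, mono, ← map_natCast (ofLaurent p κ d S) p, ← map_mul, ← map_add,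
        AddMonoidAlgebra.single_add, ← nsmul_eq_mul, ← nsmul_eq_mul, AddMonoidAlgebra.smul_single]
    rw [hP, hv, h5, map_add, map_mul, map_pow, map_natCast, hpT, zero_mul, add_zero]
  obtain ⟨f, hf, hf'⟩ := exists_lift_S (p := p) (κ := κ) (d := d) (T := PCompl p S ⧸ I)
    (fun t ht => by
      obtain ⟨u, hu⟩ := ht 1
      rw [hu, pow_one, hpT, zero_mul])
    (Ideal.Quotient.mk I) Ideal.Quotient.mk_surjective h
    ((P.comp (Ideal.Quotient.mk I)).comp (algebraMap S (PCompl p S))) (by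
      refine AddMonoidAlgebra.ringHom_ext (fun r => ?_) (fun m => ?_)
      · change P (Ideal.Quotient.mk I (mono p κ d S 0 r)) = Ideal.Quotient.mk I (h _)
        erw [hh]
        exact hmon 0 r
      · change P (Ideal.Quotient.mk I (mono p κ d S m 1)) = Ideal.Quotient.mk I (h _)
        erw [hh]
        exact hmon m 1)
  have hν : PowerSeries.constantCoeff
      ((1 + PowerSeries.X) ^ p - 1 : PowerSeries (PCompl p S)) = 0 := by simp
  obtain ⟨F, hF, hFX⟩ := exists_extend_powerSeries
    ((PowerSeries.C : PCompl p S →+* _).comp f) _ hν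
  refine ⟨F, ?_, hFX, frob_mod_p (algebraMap S (PCompl p S)) PCompl.exists_sub_dvd hFX ?_⟩
  · intro n w
    rw [hF, RingHom.comp_apply, ← hh, ← hf]
    rfl
  · intro s
    have := hf' s
    rw [hF, RingHom.comp_apply, PowerSeries.map_C, PowerSeries.map_C]
    rw [RingHom.comp_apply, RingHom.comp_apply, hP] at this
    rw [this, map_pow]

theorem IsFrobLift.X_dvd {F : PowerSeries (PCompl p S) →+* PowerSeries (PCompl p S)}
    (hF : IsFrobLift p κ d S F) : PowerSeries.X ∣ F PowerSeries.X := by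
  rw [hF.map_X, PowerSeries.X_dvd_iff]
  simp

theorem IsFrobLift.unique [Algebra.FormallyEtale (RSquare p κ d) S]
    {F F' : PowerSeries (PCompl p S) →+* PowerSeries (PCompl p S)}
    (hF : IsFrobLift p κ d S F) (hF' : IsFrobLift p κ d S F') : F = F' := by
  refine powerSeries_hom_unique (p := p) (κ := κ) (d := d) (Ideal.span {(p : PowerSeries (PCompl p S))})
    (iInf_pow_span_p_eq_bot (PCompl.psep S).powerSeries) ?_ ?_ ?_ hF.X_dvd
  · intro n w
    rw [hF.map_mono, hF'.map_mono]
  · intro x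
    rw [Ideal.mem_span_singleton, ← sub_sub_sub_cancel_right _ _ (PowerSeries.C x ^ p)]
    exact dvd_sub (hF.mod_p _) (hF'.mod_p _)
  · rw [hF.map_X, hF'.map_X]

theorem IsFrobLift.map_X' {F : PowerSeries (PCompl p S) →+* PowerSeries (PCompl p S)}
    (hF : IsFrobLift p κ d S F) : F PowerSeries.X = dToA p κ d S (qpow p (p : ℤ_[p]) - 1) := by
  rw [hF.map_X, qpow_natCast]
  simp [dToA]

/-- The Frobenius commutes with the Galois action. -/
theorem IsFrobLift.comm [Algebra.FormallyEtale (RSquare p κ d) S]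
    {F E : PowerSeries (PCompl p S) →+* PowerSeries (PCompl p S)}
    {c : Fin d → ℤ_[p]} {u : ℤ_[p]}
    (hF : IsFrobLift p κ d S F) (hE : IsGammaLift p κ d S c u E) : E.comp F = F.comp E := by
  have hEX : PowerSeries.X ∣ E PowerSeries.X := by
    rw [hE.map_X, PowerSeries.X_dvd_iff, dToA_sub_one_constantCoeff]
  refine powerSeries_hom_unique (p := p) (κ := κ) (d := d) (Ideal.span {(p : PowerSeries (PCompl p S))})
    (iInf_pow_span_p_eq_bot (PCompl.psep S).powerSeries) ?_ ?_ ?_ ?_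
  · intro n w
    have h1 : ∑ i, (((p • n) i : ℤ) : ℤ_[p]) * c i = p * ∑ i, ((n i : ℤ) : ℤ_[p]) * c i := by
      rw [Finset.mul_sum]
      refine Finset.sum_congr rfl fun i _ => ?_
      simp
      ring
    rw [RingHom.comp_apply, RingHom.comp_apply, hF.map_mono, hE.map_mono, hE.map_mono, map_mul,
      hF.map_mono, map_dToA_qpow hF.map_X', h1]
  · intro x
    rw [Ideal.mem_span_singleton, RingHom.comp_apply, RingHom.comp_apply]
    have h1 : (p : PowerSeries (PCompl p S)) ∣ E (F (PowerSeries.C x) - PowerSeries.C x ^ p) := by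
      obtain ⟨y, hy⟩ := hF.mod_p (PowerSeries.C x)
      rw [hy, map_mul, map_natCast]
      exact dvd_mul_right _ _
    rw [map_sub, map_pow] at h1
    rw [← sub_sub_sub_cancel_right _ _ (E (PowerSeries.C x) ^ p)]
    exact dvd_sub h1 (hF.mod_p _)
  · rw [RingHom.comp_apply, RingHom.comp_apply, hF.map_X', hE.map_X, map_sub, map_sub, map_sub,
      map_sub, map_dToA_qpow hE.map_X, map_dToA_qpow hF.map_X']
    simp [mul_comm]
  · rw [RingHom.comp_apply, hF.map_X']
    have h2 := map_dToA_qpow hE.map_X (p : ℤ_[p])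
    rw [map_sub, map_sub, h2, map_one, map_one, ← map_one (dToA p κ d S), ← map_sub,
      PowerSeries.X_dvd_iff, dToA_sub_one_constantCoeff]

variable (p κ d S)

/-- The Frobenius of `A_R^+`: the unique endomorphism with `IsFrobLift p κ d S`. -/
noncomputable def frobLift [PerfectRing κ p] [Algebra.FormallyEtale (RSquare p κ d) S] :
    PowerSeries (PCompl p S) →+* PowerSeries (PCompl p S) :=
  (exists_isFrobLift (κ := κ) (d := d) (S := S)).choose

theorem frobLift_spec [PerfectRing κ p] [Algebra.FormallyEtale (RSquare p κ d) S] :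
    IsFrobLift p κ d S (frobLift p κ d S) :=
  (exists_isFrobLift (κ := κ) (d := d) (S := S)).choose_spec

end Frob


/-! ### The Galois group `Γ_R` -/

section Galois

variable (p : ℕ) [Fact p.Prime] (κ : Type*) [Field κ] (d : ℕ)
variable (S : Type*) [CommRing S] [Algebra (RSquare p κ d) S]
variable (Ω : Type*) [Field Ω] [Algebra (PCompl p S) Ω]

/-- A compatible system `ζ_n` of primitive `p ^ n`-th roots of unity and compatible systems
`X_i ^ (1 / p ^ n)` of `p`-power roots of the coordinates, in an overfield `Ω` of `R`. -/
structure RootData where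
  ζ : ℕ → Ω
  ζ_zero : ζ 0 = 1
  ζ_one : ζ 1 ≠ 1
  ζ_succ : ∀ n, ζ (n + 1) ^ p = ζ n
  x : Fin d → ℕ → Ω
  x_zero : ∀ i, x i 0 = algebraMap (PCompl p S) Ω (coord p κ d S i)
  x_succ : ∀ i n, x i (n + 1) ^ p = x i n

variable {p κ d S Ω}

/-- The ring `R_∞[1/p] = R[μ_{p^∞}, X_1^{1/p^∞}, …, X_d^{1/p^∞}, 1/p]` inside `Ω`. -/
noncomputable abbrev RootData.RInf (r : RootData p κ d S Ω) : Subalgebra (PCompl p S) Ω :=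
  Algebra.adjoin (PCompl p S)
    (Set.range r.ζ ∪ Set.range (fun t : Fin d × ℕ => r.x t.1 t.2) ∪ {(p : Ω)⁻¹})

/-- `ζ_n` as an element of `R_∞[1/p]`. -/
noncomputable def RootData.ζInf (r : RootData p κ d S Ω) (n : ℕ) : r.RInf :=
  ⟨r.ζ n, Algebra.subset_adjoin (Or.inl (Or.inl ⟨n, rfl⟩))⟩

/-- `X_i ^ (1 / p ^ n)` as an element of `R_∞[1/p]`. -/
noncomputable def RootData.xInf (r : RootData p κ d S Ω) (i : Fin d) (n : ℕ) : r.RInf :=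
  ⟨r.x i n, Algebra.subset_adjoin (Or.inl (Or.inr ⟨(i, n), rfl⟩))⟩

/-- The group `Γ_R` of automorphisms of `R_∞[1/p]` over `R[1/p]` (equivalently, over `R`). -/
noncomputable abbrev RootData.Gal (r : RootData p κ d S Ω) : Type _ := r.RInf ≃ₐ[PCompl p S] r.RInf

/-- The profinite topology on `Γ_R`: pointwise convergence on the discrete ring `R_∞[1/p]`. -/
noncomputable instance RootData.galTopology (r : RootData p κ d S Ω) : TopologicalSpace r.Gal :=
  TopologicalSpace.induced (fun (g : r.Gal) (y : r.RInf) => g y)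
    (@Pi.topologicalSpace r.RInf (fun _ => r.RInf) (fun _ => ⊥))

/-- `ζ_n ^ a` for `a ∈ ℤ_p`. -/
noncomputable def RootData.pow (r : RootData p κ d S Ω) (n : ℕ) (a : ℤ_[p]) : r.RInf :=
  r.ζInf n ^ (PadicInt.toZModPow n a).val

variable (r : RootData p κ d S Ω)

theorem RootData.ζInf_succ (n : ℕ) : r.ζInf (n + 1) ^ p = r.ζInf n :=
  Subtype.ext (r.ζ_succ n)

theorem RootData.xInf_succ (i : Fin d) (n : ℕ) : r.xInf i (n + 1) ^ p = r.xInf i n :=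
  Subtype.ext (r.x_succ i n)

theorem RootData.ζInf_add_pow (n k : ℕ) : r.ζInf (n + k) ^ p ^ k = r.ζInf n := by
  induction k with
  | zero => simp
  | succ k ih => rw [← add_assoc, pow_succ', pow_mul, r.ζInf_succ, ih]

theorem RootData.ζInf_zero : r.ζInf 0 = 1 := Subtype.ext r.ζ_zero

theorem RootData.ζInf_pow (n : ℕ) : r.ζInf n ^ p ^ n = 1 := by
  have := r.ζInf_add_pow 0 n
  rwa [zero_add, r.ζInf_zero] at this

theorem RootData.orderOf_ζInf (n : ℕ) : orderOf (r.ζInf n) = p ^ n := by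
  cases n with
  | zero => rw [r.ζInf_zero, orderOf_one, pow_zero]
  | succ n =>
    refine orderOf_eq_prime_pow ?_ (r.ζInf_pow (n + 1))
    have h := r.ζInf_add_pow 1 n
    rw [add_comm] at h
    rw [h]
    intro h1
    exact r.ζ_one (congr_arg Subtype.val h1)

theorem RootData.isPrimitiveRoot (n : ℕ) : IsPrimitiveRoot (r.ζInf n) (p ^ n) := by
  rw [← r.orderOf_ζInf n]
  exact IsPrimitiveRoot.orderOf _

theorem RootData.ζInf_pow_eq_iff (n k l : ℕ) :
    r.ζInf n ^ k = r.ζInf n ^ l ↔ (k : ZMod (p ^ n)) = l := by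
  have hp : p.Prime := Fact.out
  have : IsOfFinOrder (r.ζInf n) :=
    isOfFinOrder_iff_pow_eq_one.mpr ⟨p ^ n, pow_pos hp.pos n, r.ζInf_pow n⟩
  rw [this.pow_eq_pow_iff_modEq, r.orderOf_ζInf, ZMod.natCast_eq_natCast_iff]

theorem RootData.pow_add (n : ℕ) (a b : ℤ_[p]) : r.pow n (a + b) = r.pow n a * r.pow n b := by
  have hp : p.Prime := Fact.out
  have : NeZero (p ^ n) := ⟨(pow_pos hp.pos n).ne'⟩
  rw [RootData.pow, RootData.pow, RootData.pow, ← _root_.pow_add, r.ζInf_pow_eq_iff]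
  simp

theorem RootData.pow_one (n : ℕ) : r.pow n 1 = r.ζInf n := by
  have hp : p.Prime := Fact.out
  have : NeZero (p ^ n) := ⟨(pow_pos hp.pos n).ne'⟩
  conv_rhs => rw [← _root_.pow_one (r.ζInf n)]
  rw [RootData.pow, r.ζInf_pow_eq_iff]
  simp

theorem RootData.pow_zero (n : ℕ) : r.pow n 0 = 1 := by
  have hp : p.Prime := Fact.out
  have : NeZero (p ^ n) := ⟨(pow_pos hp.pos n).ne'⟩
  rw [← _root_.pow_zero (r.ζInf n), RootData.pow, r.ζInf_pow_eq_iff]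
  simp

theorem RootData.pow_mul (n : ℕ) (a b : ℤ_[p]) :
    r.pow n a ^ (PadicInt.toZModPow n b).val = r.pow n (a * b) := by
  have hp : p.Prime := Fact.out
  have : NeZero (p ^ n) := ⟨(pow_pos hp.pos n).ne'⟩
  rw [RootData.pow, RootData.pow, ← _root_.pow_mul, r.ζInf_pow_eq_iff]
  simp

theorem RootData.pow_injective {a b : ℤ_[p]} (h : ∀ n, r.pow n a = r.pow n b) : a = b := by
  have hp : p.Prime := Fact.out
  refine PadicInt.ext_of_toZModPow.mp fun n => ?_
  have : NeZero (p ^ n) := ⟨(pow_pos hp.pos n).ne'⟩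
  have := h n
  rw [RootData.pow, RootData.pow, r.ζInf_pow_eq_iff] at this
  simpa using this

/-- A compatible system `y_n` with `y_0 = 1` is of the form `ζ_n ^ a` for some `a ∈ ℤ_p`. -/
theorem RootData.exists_pow_eq (y : ℕ → r.RInf) (h0 : y 0 = 1) (hs : ∀ n, y (n + 1) ^ p = y n) :
    ∃ a : ℤ_[p], ∀ n, y n = r.pow n a := by
  have hp : p.Prime := Fact.out
  have hpow : ∀ n, y n ^ p ^ n = 1 := by
    intro n
    induction n with
    | zero => simp [h0]
    | succ n ih => rw [pow_succ', _root_.pow_mul, hs, ih]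
  have h1 : ∀ n, ∃ k : ℕ, r.ζInf n ^ k = y n := by
    intro n
    have : NeZero (p ^ n) := ⟨(pow_pos hp.pos n).ne'⟩
    obtain ⟨i, -, hi⟩ := (r.isPrimitiveRoot n).eq_pow_of_pow_eq_one (hpow n)
    exact ⟨i, hi⟩
  choose k hk using h1
  have hdvd : ∀ n, (p : ℤ) ^ n ∣ (k (n + 1) : ℤ) - k n := by
    intro n
    have h2 : r.ζInf n ^ k (n + 1) = r.ζInf n ^ k n := by
      rw [hk n, ← hs n, ← hk (n + 1), ← _root_.pow_mul, mul_comm, _root_.pow_mul, r.ζInf_succ]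
    rw [r.ζInf_pow_eq_iff, ZMod.natCast_eq_natCast_iff] at h2
    have := (Nat.modEq_iff_dvd.mp h2.symm)
    rwa [Nat.cast_pow] at this
  refine ⟨PadicInt.ofIntSeq _ (PadicInt.isCauSeq_padicNorm_of_pow_dvd_sub (fun n => (k n : ℤ)) p hdvd),
    fun n => ?_⟩
  have : NeZero (p ^ n) := ⟨(pow_pos hp.pos n).ne'⟩
  rw [RootData.pow, ← hk, r.ζInf_pow_eq_iff, PadicInt.toZModPow_ofIntSeq_of_pow_dvd_sub _ _ hdvd]
  simp

theorem RootData.coord_ne_zero (i : Fin d) :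
    algebraMap (PCompl p S) Ω (coord p κ d S i) ≠ 0 := by
  intro h
  have h1 : coord p κ d S i * mono p κ d S (-Pi.single i 1) 1 = 1 := by
    rw [coord, ← mono_mul, add_neg_cancel, one_mul, mono_zero_one]
  have h2 := congr_arg (algebraMap (PCompl p S) Ω) h1
  rw [map_mul, h, zero_mul, map_one] at h2
  exact zero_ne_one h2

theorem RootData.xInf_ne_zero (i : Fin d) (n : ℕ) : r.xInf i n ≠ 0 := by
  have hp : p.Prime := Fact.out
  induction n with
  | zero =>
    intro h
    have := congr_arg Subtype.val h
    exact RootData.coord_ne_zero (Ω := Ω) i ((r.x_zero i).symm.trans this)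
  | succ n ih =>
    intro h
    apply ih
    rw [← r.xInf_succ, h, zero_pow hp.ne_zero]

theorem RootData.exists_chi (g : r.Gal) : ∃ u : ℤ_[p], ∀ n, g (r.ζInf n) = r.pow n u :=
  r.exists_pow_eq (fun n => g (r.ζInf n)) (by rw [r.ζInf_zero, map_one])
    fun n => by rw [← map_pow, r.ζInf_succ]

theorem RootData.exists_kummer (g : r.Gal) (i : Fin d) :
    ∃ c : ℤ_[p], ∀ n, g (r.xInf i n) = r.pow n c * r.xInf i n := by
  have hp : p.Prime := Fact.out
  have h0 : g (r.xInf i 0) = r.xInf i 0 := by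
    have : r.xInf i 0 = algebraMap (PCompl p S) r.RInf (coord p κ d S i) :=
      Subtype.ext (r.x_zero i)
    rw [this, AlgEquiv.commutes]
  have hpow : ∀ n, r.xInf i n ^ p ^ n = r.xInf i 0 := by
    intro n
    induction n with
    | zero => simp
    | succ n ih => rw [pow_succ', _root_.pow_mul, r.xInf_succ, ih]
  have h1 : ∀ n, ∃ y : r.RInf, g (r.xInf i n) = y * r.xInf i n := by
    intro n
    have hx := r.xInf_ne_zero i n
    have : NeZero (p ^ n) := ⟨(pow_pos hp.pos n).ne'⟩
    have hx' : (r.xInf i n : Ω) ≠ 0 := fun h => hx (Subtype.ext h)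
    have h2 : ((g (r.xInf i n) : Ω) / r.xInf i n) ^ p ^ n = 1 := by
      have h3 : g (r.xInf i n) ^ p ^ n = r.xInf i n ^ p ^ n := by
        rw [← map_pow, hpow, h0]
      have h4 := congr_arg Subtype.val h3
      simp only [SubmonoidClass.coe_pow] at h4
      rw [div_pow, h4, div_self (pow_ne_zero _ hx')]
    have h5 : IsPrimitiveRoot (r.ζInf n : Ω) (p ^ n) :=
      (r.isPrimitiveRoot n).map_of_injective (f := r.RInf.val) Subtype.val_injective
    obtain ⟨k, -, hk⟩ := h5.eq_pow_of_pow_eq_one h2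
    refine ⟨r.ζInf n ^ k, Subtype.ext ?_⟩
    simp only [MulMemClass.coe_mul, SubmonoidClass.coe_pow]
    rw [hk, div_mul_cancel₀ _ hx']
  choose y hy using h1
  obtain ⟨c, hc⟩ := r.exists_pow_eq y
    (by
      have := hy 0
      rw [h0] at this
      exact (mul_eq_right₀ (r.xInf_ne_zero i 0)).mp this.symm)
    (fun n => by
      refine mul_right_cancel₀ (r.xInf_ne_zero i n) ?_
      rw [← hy n, ← r.xInf_succ, ← mul_pow, ← hy, map_pow])
  exact ⟨c, fun n => by rw [hy, hc]⟩

/-- The `p`-adic cyclotomic character `χ` of `Γ_R`. -/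
noncomputable def RootData.chi (g : r.Gal) : ℤ_[p] := (r.exists_chi g).choose

theorem RootData.chi_spec (g : r.Gal) (n : ℕ) : g (r.ζInf n) = r.pow n (r.chi g) :=
  (r.exists_chi g).choose_spec n

/-- The Kummer cocycle `c_i` of `Γ_R`, with `g (X_i ^ (1/p^n)) = ζ_n ^ (c_i g) X_i ^ (1/p^n)`. -/
noncomputable def RootData.kummer (g : r.Gal) (i : Fin d) : ℤ_[p] := (r.exists_kummer g i).choose

theorem RootData.kummer_spec (g : r.Gal) (i : Fin d) (n : ℕ) :
    g (r.xInf i n) = r.pow n (r.kummer g i) * r.xInf i n :=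
  (r.exists_kummer g i).choose_spec n

theorem RootData.map_pow (g : r.Gal) (n : ℕ) (a : ℤ_[p]) :
    g (r.pow n a) = r.pow n (r.chi g * a) := by
  rw [← r.pow_mul, ← r.chi_spec]
  exact _root_.map_pow g _ _

theorem RootData.chi_eq {g : r.Gal} {u : ℤ_[p]} (h : ∀ n, g (r.ζInf n) = r.pow n u) :
    r.chi g = u :=
  r.pow_injective fun n => by rw [← r.chi_spec, h]

theorem RootData.kummer_eq {g : r.Gal} {i : Fin d} {c : ℤ_[p]}
    (h : ∀ n, g (r.xInf i n) = r.pow n c * r.xInf i n) : r.kummer g i = c :=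
  r.pow_injective fun n => mul_right_cancel₀ (r.xInf_ne_zero i n) (by rw [← r.kummer_spec, h])

theorem RootData.chi_one : r.chi 1 = 1 :=
  r.chi_eq fun n => by rw [r.pow_one]; rfl

theorem RootData.kummer_one : r.kummer 1 = 0 := by
  ext1 i
  exact r.kummer_eq fun n => by rw [Pi.zero_apply, r.pow_zero, one_mul]; rfl

theorem RootData.chi_mul (g h : r.Gal) : r.chi (g * h) = r.chi g * r.chi h :=
  r.chi_eq fun n => by rw [AlgEquiv.mul_apply, r.chi_spec, r.map_pow]

theorem RootData.kummer_mul (g h : r.Gal) :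
    r.kummer (g * h) = r.kummer g + r.chi g • r.kummer h := by
  ext1 i
  refine r.kummer_eq fun n => ?_
  rw [AlgEquiv.mul_apply, r.kummer_spec, map_mul, r.map_pow, r.kummer_spec, Pi.add_apply,
    r.pow_add, Pi.smul_apply, smul_eq_mul]
  ring

end Galois

/-! ### The ring `A_R^+` with its Frobenius and its action of `Γ_R` -/

section APlus

variable (p : ℕ) [Fact p.Prime] (κ : Type*) [Field κ] [CharP κ p] (d : ℕ)
variable (S : Type*) [CommRing S] [Algebra (RSquare p κ d) S]

/-- The ring `A_R^+ = R⟦μ⟧`, where `R` is the `p`-adic completion of `S`. -/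
def APlus (p : ℕ) (_κ : Type*) (_d : ℕ) (S : Type*) [CommRing S] : Type _ := PowerSeries (PCompl p S)

noncomputable instance : CommRing (APlus p κ d S) :=
  inferInstanceAs (CommRing (PowerSeries (PCompl p S)))

noncomputable instance : Algebra (DRing p) (APlus p κ d S) := (dToA p κ d S).toAlgebra

/-- The element `μ = [ε] - 1` of `A_R^+`. -/
noncomputable def APlus.μ : APlus p κ d S := (PowerSeries.X : PowerSeries (PCompl p S))

/-- The element `[X_i^♭]` of `A_R^+`. -/
noncomputable def APlus.U (i : Fin d) : APlus p κ d S := PowerSeries.C (coord p κ d S i)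

variable [Algebra.Etale (RSquare p κ d) S]

/-- The Frobenius of `A_R^+`. -/
noncomputable def APlus.frob [PerfectRing κ p] : APlus p κ d S →+* APlus p κ d S :=
  frobLift p κ d S

variable {p κ d S} {Ω : Type*} [Field Ω] [Algebra (PCompl p S) Ω]

/-- The action of `Γ_R` on `A_R^+`. -/
noncomputable def RootData.act (r : RootData p κ d S Ω) :
    r.Gal →* (APlus p κ d S →+* APlus p κ d S) where
  toFun g := gammaLift p κ d S (r.kummer g) (r.chi g)
  map_one' := by
    rw [r.chi_one, r.kummer_one]
    exact (gammaLift_spec p κ d S 0 1).unique IsGammaLift.id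
  map_mul' g h := by
    rw [r.chi_mul, r.kummer_mul]
    exact (gammaLift_spec p κ d S _ _).unique ((gammaLift_spec p κ d S _ _).comp
      (gammaLift_spec p κ d S _ _))

end APlus


/-! ### Maps out of localized modules -/

section Loc

variable {A : Type*} [CommRing A] (S : Submonoid A) {M P : Type*} [AddCommGroup M] [Module A M]
  [AddCommGroup P] [Module A P]

/-- Let `T : M → P` be additive with `T (s x) = σ(s) T x` for `s ∈ S`, where `σ(s)` acts
invertibly on `P`. Then `T` extends to `M[S⁻¹]` by `x / s ↦ σ(s)⁻¹ T x`. -/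
noncomputable def locLift (σ : A →* A) (T : M →+ P) (hT : ∀ (s : S) (x : M),
    T ((s : A) • x) = σ s • T x)
    (hσ : ∀ s : S, IsUnit (algebraMap A (Module.End A P) (σ s))) : LocalizedModule S M →+ P :=
  have inv_iff : ∀ (s : S) (y z : P), (hσ s).unit⁻¹.val y = z ↔ y = σ s • z := fun s y z => by
    constructor
    · rintro rfl
      exact (congr_arg (fun f : Module.End A P => f y) (hσ s).mul_val_inv).symm
    · rintro rfl
      exact congr_arg (fun f : Module.End A P => f z) (hσ s).val_inv_mul
  { toFun := fun z => z.liftOn (fun t => (hσ t.2).unit⁻¹.val (T t.1)) (by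
      rintro ⟨x, s⟩ ⟨x', s'⟩ ⟨u, hu⟩
      simp only [Submonoid.smul_def] at hu
      have h1 := congr_arg T hu
      rw [hT, hT, hT, hT] at h1
      have h2 : Function.Injective fun y : P => σ u • y := by
        intro y y' hy
        have h3 := (inv_iff u (σ u • y) y).mpr rfl
        have h4 := (inv_iff u (σ u • y') y').mpr rfl
        simp only at hy
        rw [← h3, hy, h4]
      have h5 := h2 h1
      simp only
      rw [inv_iff]
      rw [← (hσ s').unit⁻¹.val.map_smul, eq_comm, inv_iff]
      exact h5.symm)
    map_zero' := by
      rw [← LocalizedModule.zero_mk 1, LocalizedModule.liftOn_mk, map_zero, map_zero]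
    map_add' := by
      intro y z
      induction y with | h x s => ?_
      induction z with | h x' s' => ?_
      rw [LocalizedModule.mk_add_mk, LocalizedModule.liftOn_mk, LocalizedModule.liftOn_mk,
        LocalizedModule.liftOn_mk]
      simp only [Submonoid.smul_def]
      rw [inv_iff, map_add, hT, hT, Submonoid.coe_mul, map_mul, smul_add, mul_smul, mul_smul]
      have e1 := (inv_iff s (T x) _).mp rfl
      have e2 := (inv_iff s' (T x') _).mp rfl
      conv_lhs => rw [e1, e2]
      rw [smul_comm (σ s') (σ s)] }

theorem locLift_mk (σ : A →* A) (T : M →+ P) (hT : ∀ (s : S) (x : M),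
    T ((s : A) • x) = σ s • T x)
    (hσ : ∀ s : S, IsUnit (algebraMap A (Module.End A P) (σ s))) (x : M) (s : S) :
    σ s • locLift S σ T hT hσ (LocalizedModule.mk x s) = T x :=
  congr_arg (fun f : Module.End A P => f (T x)) (hσ s).mul_val_inv

/-- A divisor of an element of `S` acts invertibly on `M[S⁻¹]`. -/
theorem isUnit_end_of_dvd {s : A} (h : ∃ t ∈ S, s ∣ t) :
    IsUnit (algebraMap A (Module.End A (LocalizedModule S M)) s) := by
  obtain ⟨t, ht, c, rfl⟩ := h
  have h1 := IsLocalizedModule.map_units (LocalizedModule.mkLinearMap S M) ⟨s * c, ht⟩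
  rw [Subtype.coe_mk, map_mul] at h1
  exact (Commute.isUnit_mul_iff ((Commute.all s c).map _)).mp h1 |>.1

end Loc

/-! ### The formalism of `q`-connections -/

section QFormalism

/-- The setting for `q`-connections: a `D`-algebra `A` with commuting `D`-automorphisms
`γ_1, …, γ_d`, an element `q ∈ D` with `q - 1` a nonzerodivisor and `γ_i ≡ 1` modulo `q - 1`, and
units `U_1, …, U_d` with `γ_i (U_j) = q U_j` if `i = j` and `γ_i (U_j) = U_j` otherwise. -/
structure QData (D A : Type*) [CommRing D] [CommRing A] [Algebra D A] (d : ℕ) where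
  q : D
  γ : Fin d → (A ≃ₐ[D] A)
  U : Fin d → Aˣ
  comm : ∀ i j, Commute (γ i) (γ j)
  regular : q - 1 ∈ nonZeroDivisors D
  regular' : algebraMap D A (q - 1) ∈ nonZeroDivisors A
  congr_one : ∀ i a, algebraMap D A (q - 1) ∣ γ i a - a
  γ_U : ∀ i j, γ i (U j : A) = if i = j then algebraMap D A q * U j else (U j : A)

/-- The left `A`-module `qΩ^k`, free on `dlog(U_{i_1}) ⋯ dlog(U_{i_k})` for
`I = {i_1 < ⋯ < i_k}`. -/
abbrev QOmega (A : Type*) (d k : ℕ) : Type _ := {I : Finset (Fin d) // I.card = k} → A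

/-- The coefficient of a `k`-form at a set of indices, zero if the set does not have `k`
elements. -/
def QOmega.coeff {A : Type*} [CommRing A] {d k : ℕ} (I : Finset (Fin d)) :
    QOmega A d k →ₗ[A] A where
  toFun ω := if h : I.card = k then ω ⟨I, h⟩ else 0
  map_add' ω η := by split_ifs <;> simp
  map_smul' a ω := by split_ifs <;> simp

/-- The basis `1`-form `dlog(U_i)`. -/
def QOmega.dlog {A : Type*} [CommRing A] {d : ℕ} (i : Fin d) : QOmega A d 1 :=
  Pi.single ⟨{i}, Finset.card_singleton i⟩ 1

/-- The sign with `dlog(U_I) dlog(U_J) = sgn I J • dlog(U_{I ∪ J})` for disjoint `I`, `J`: the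
parity of the number of inversions. -/
def sgn {d : ℕ} (A : Type*) [CommRing A] (I J : Finset (Fin d)) : A :=
  (-1) ^ ((I ×ˢ J).filter fun t => t.2 < t.1).card

namespace QData

variable {D A : Type*} [CommRing D] [CommRing A] [Algebra D A] {d : ℕ} (Q : QData D A d)

theorem exists_qDer (i : Fin d) (f : A) : ∃ g, algebraMap D A (Q.q - 1) * g = Q.γ i f - f := by
  obtain ⟨g, hg⟩ := Q.congr_one i f
  exact ⟨g, hg.symm⟩

/-- The `q`-derivative `f ↦ (γ_i(f) - f) / (q - 1)`. -/
noncomputable def qDer (i : Fin d) : A →ₗ[D] A where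
  toFun f := (Q.exists_qDer i f).choose
  map_add' f g := by
    refine (mul_cancel_left_mem_nonZeroDivisors Q.regular').mp ?_
    rw [mul_add, (Q.exists_qDer i _).choose_spec, (Q.exists_qDer i _).choose_spec,
      (Q.exists_qDer i _).choose_spec, map_add]
    ring
  map_smul' a f := by
    refine (mul_cancel_left_mem_nonZeroDivisors Q.regular').mp ?_
    rw [RingHom.id_apply, mul_smul_comm, (Q.exists_qDer i _).choose_spec,
      (Q.exists_qDer i _).choose_spec, map_smul, smul_sub]

theorem qDer_spec (i : Fin d) (f : A) :
    algebraMap D A (Q.q - 1) * Q.qDer i f = Q.γ i f - f :=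
  (Q.exists_qDer i f).choose_spec

theorem qDer_mul (i : Fin d) (f g : A) :
    Q.qDer i (f * g) = Q.qDer i f * Q.γ i g + f * Q.qDer i g := by
  refine (mul_cancel_left_mem_nonZeroDivisors Q.regular').mp ?_
  rw [mul_add, ← mul_assoc, mul_left_comm, Q.qDer_spec, Q.qDer_spec, Q.qDer_spec, map_mul]
  ring

/-- `γ_I = ∏_{i ∈ I} γ_i`. -/
noncomputable def γProd (I : Finset (Fin d)) : A ≃ₐ[D] A :=
  I.noncommProd Q.γ fun i _ j _ _ => Q.comm i j

/-- The right action of `A` on `qΩ^k`, with `dlog(U_I) · f = γ_I(f) dlog(U_I)`. -/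
noncomputable def rmul {k : ℕ} (f : A) : QOmega A d k →ₗ[A] QOmega A d k where
  toFun ω I := ω I * Q.γProd I.1 f
  map_add' ω η := by ext I; simp [add_mul]
  map_smul' a ω := by ext I; simp [mul_assoc]

/-- The product `ω ↦ ω · η` of the graded algebra `qΩ^•`, determined by
`dlog(U_I) · f = γ_I(f) dlog(U_I)` and the anticommutativity of the `dlog(U_i)`. -/
noncomputable def wedge {k l m : ℕ} (_h : k + l = m) (η : QOmega A d l) :
    QOmega A d k →ₗ[A] QOmega A d m where
  toFun ω K := ∑ I ∈ K.1.powerset,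
    sgn A I (K.1 \ I) * (QOmega.coeff I ω * Q.γProd I (QOmega.coeff (K.1 \ I) η))
  map_add' ω η := by
    ext K
    simp only [map_add, Pi.add_apply, ← Finset.sum_add_distrib]
    exact Finset.sum_congr rfl fun I _ => by ring
  map_smul' a ω := by
    ext K
    simp only [map_smul, Pi.smul_apply, smul_eq_mul, RingHom.id_apply, Finset.mul_sum]
    exact Finset.sum_congr rfl fun I _ => by ring

/-- The differential of `qΩ^•`, with
`d_q (f dlog(U_I)) = ∑_i ((γ_i(f) - f) / (q - 1)) dlog(U_i) dlog(U_I)`. -/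
noncomputable def dq (k : ℕ) : QOmega A d k →ₗ[D] QOmega A d (k + 1) where
  toFun ω K := ∑ i ∈ K.1,
    sgn A {i} (K.1.erase i) * Q.qDer i (QOmega.coeff (K.1.erase i) ω)
  map_add' ω η := by
    ext K
    simp only [map_add, Pi.add_apply, ← Finset.sum_add_distrib]
    exact Finset.sum_congr rfl fun I _ => by ring
  map_smul' a ω := by
    ext K
    simp only [Pi.smul_apply, RingHom.id_apply, Finset.smul_sum]
    refine Finset.sum_congr rfl fun I _ => ?_
    rw [← algebraMap_smul A a ω, map_smul, algebraMap_smul, map_smul, mul_smul_comm]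

/-- The differential `d_q : A → qΩ^1`, `f ↦ ∑_i ((γ_i(f) - f) / (q - 1)) dlog(U_i)`. -/
noncomputable def dZero (f : A) : QOmega A d 1 := ∑ i, Q.qDer i f • QOmega.dlog i

end QData

section Connection

variable {D A : Type*} [CommRing D] [CommRing A] [Algebra D A] {d : ℕ}

/-- A `q`-connection on an `A`-module `N`: a `D`-linear map `∇ : N → N ⊗ qΩ^1` with
`∇ (x f) = ∇(x) f + x ⊗ d_q f`. -/
structure QConnection (Q : QData D A d) (N : Type*) [AddCommGroup N] [Module A N] [Module D N]
    [IsScalarTower D A N] where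
  toLin : N →ₗ[D] N ⊗[A] QOmega A d 1
  leibniz : ∀ (x : N) (f : A),
    toLin (f • x) = (Q.rmul f).lTensor N (toLin x) + x ⊗ₜ[A] Q.dZero f

variable {Q : QData D A d} {N : Type*} [AddCommGroup N] [Module A N] [Module D N]
    [IsScalarTower D A N]

/-- A `q`-connection is flat if its extension `E` to `N ⊗ qΩ^•`, which satisfies
`E ((n ⊗ ω) · ω') = E (n ⊗ ω) · ω' + (-1) ^ (deg ω) (n ⊗ ω) · d_q ω'`, has square zero. -/
def QConnection.IsFlat (nabla : QConnection Q N) : Prop :=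
  ∃ E : ∀ k : ℕ, N ⊗[A] QOmega A d k →ₗ[D] N ⊗[A] QOmega A d (k + 1),
    (∀ x : N, E 0 (x ⊗ₜ[A] fun _ => 1) = nabla.toLin x) ∧
    (∀ (k l m : ℕ) (h : k + l = m) (x : N) (ω : QOmega A d k) (ω' : QOmega A d l),
      E m ((Q.wedge h ω').lTensor N (x ⊗ₜ[A] ω)) =
        (Q.wedge (show k + 1 + l = m + 1 by omega) ω').lTensor N (E k (x ⊗ₜ[A] ω)) +
        (-1 : A) ^ k • (Q.wedge (show k + (l + 1) = m + 1 by omega) (Q.dq l ω')).lTensor N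
          (x ⊗ₜ[A] ω)) ∧
    ∀ (k : ℕ) (z : N ⊗[A] QOmega A d k), E (k + 1) (E k z) = 0

/-- The map `∇(∂/∂U_i) : N → N`, that is, `U_i⁻¹` times the coefficient of `∇` at `dlog(U_i)`. -/
noncomputable def QConnection.parDer (nabla : QConnection Q N) (i : Fin d) (x : N) : N :=
  ((Q.U i)⁻¹.val) • TensorProduct.rid A N ((QOmega.coeff {i}).lTensor N (nabla.toLin x))

/-- A `q`-connection is `(p, [p]_q)`-adically quasi-nilpotent if the connection `∇ mod q - 1` on
`N / (q - 1) N` is `p`-adically quasi-nilpotent: the iterates of each `∇(∂/∂U_i)` tend to zero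
`p`-adically on every element of `N / (q - 1) N`. -/
def QConnection.IsQuasiNilpotent (p : ℕ) (nabla : QConnection Q N) : Prop :=
  ∀ (i : Fin d) (x : N) (m : ℕ), ∃ n₀ : ℕ, ∀ n ≥ n₀,
    (nabla.parDer i)^[n] x ∈ (Ideal.span {(p : D) ^ m, Q.q - 1} • ⊤ : Submodule D N)

/-- Compatible Frobenius lifts on `D` and `A` with `φ(q) = q ^ p`, commuting with the `γ_i`. -/
structure QFrob (p : ℕ) (Q : QData D A d) where
  φD : D →+* D
  φA : A →+* A
  compat : ∀ a, φA (algebraMap D A a) = algebraMap D A (φD a)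
  φD_q : φD Q.q = Q.q ^ p
  liftD : ∀ a, (p : D) ∣ φD a - a ^ p
  liftA : ∀ a, (p : A) ∣ φA a - a ^ p
  comm : ∀ i a, φA (Q.γ i a) = Q.γ i (φA a)

/-- The element `[p]_q = 1 + q + ⋯ + q ^ (p - 1)` of `D`. -/
def QData.pq (p : ℕ) (Q : QData D A d) : D := ∑ j ∈ Finset.range p, Q.q ^ j

/-- The powers of `[p]_q` in `A`. -/
def QData.pqPowers (p : ℕ) (Q : QData D A d) : Submonoid A :=
  Submonoid.powers (algebraMap D A (Q.pq p))

end Connection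

section Pullback

variable {A : Type*} [CommRing A]

/-- The ring `A`, seen as an `A`-algebra through the endomorphism `φ`. -/
def Twist (_φ : A →+* A) : Type _ := A

noncomputable instance (φ : A →+* A) : CommRing (Twist φ) := inferInstanceAs (CommRing A)

noncomputable instance (φ : A →+* A) : Algebra A (Twist φ) := RingHom.toAlgebra (S := A) φ

/-- The identity of `A`, as a ring isomorphism onto `Twist φ`. -/
def toTwist (φ : A →+* A) : A ≃+* Twist φ := RingEquiv.refl A

theorem smul_toTwist (φ : A →+* A) (a f : A) : a • toTwist φ f = toTwist φ (φ a * f) := rfl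

/-- The pullback `φ^* N`, the tensor product of `N` with `A` along `φ`. -/
def FrobPull (φ : A →+* A) (N : Type*) [AddCommGroup N] [Module A N] : Type _ :=
  Twist φ ⊗[A] N

variable (φ : A →+* A) (N : Type*) [AddCommGroup N] [Module A N]

noncomputable instance : AddCommGroup (FrobPull φ N) :=
  inferInstanceAs (AddCommGroup (Twist φ ⊗[A] N))

/-- The `A`-module structure of `φ^* N`, by multiplication on the factor `A`. -/
noncomputable instance : Module A (FrobPull φ N) :=
  Module.compHom (Twist φ ⊗[A] N) (toTwist φ : A →+* Twist φ)

variable {N}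

/-- The element `f ⊗ x` of `φ^* N`. -/
noncomputable def FrobPull.tmul (f : A) (x : N) : FrobPull φ N := toTwist φ f ⊗ₜ[A] x

theorem FrobPull.smul_tmul (a f : A) (x : N) :
    a • FrobPull.tmul φ f x = FrobPull.tmul φ (a * f) x := rfl

theorem FrobPull.tmul_smul (a f : A) (x : N) :
    FrobPull.tmul φ f (a • x) = FrobPull.tmul φ (φ a * f) x := by
  rw [FrobPull.tmul, ← TensorProduct.smul_tmul]
  rfl

theorem FrobPull.tmul_add (f : A) (x y : N) :
    FrobPull.tmul φ f (x + y) = FrobPull.tmul φ f x + FrobPull.tmul φ f y :=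
  TensorProduct.tmul_add _ _ _

theorem FrobPull.add_tmul (f g : A) (x : N) :
    FrobPull.tmul φ (f + g) x = FrobPull.tmul φ f x + FrobPull.tmul φ g x :=
  TensorProduct.add_tmul _ _ _

/-- Additive maps out of `φ^* N`. -/
noncomputable def FrobPull.lift {P : Type*} [AddCommMonoid P] (T : A →+ N →+ P)
    (hT : ∀ (a f : A) (x : N), T (φ a * f) x = T f (a • x)) : FrobPull φ N →+ P :=
  TensorProduct.liftAddHom (R := A) (M := Twist φ) (N := N) T hT

theorem FrobPull.lift_tmul {P : Type*} [AddCommMonoid P] (T : A →+ N →+ P)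
    (hT : ∀ (a f : A) (x : N), T (φ a * f) x = T f (a • x)) (f : A) (x : N) :
    FrobPull.lift φ T hT (FrobPull.tmul φ f x) = T f x := rfl

theorem FrobPull.induction {motive : FrobPull φ N → Prop} (h0 : motive 0)
    (h1 : ∀ f x, motive (FrobPull.tmul φ f x))
    (h2 : ∀ y z, motive y → motive z → motive (y + z)) (y : FrobPull φ N) : motive y :=
  TensorProduct.induction_on (R := A) (M := Twist φ) (N := N) y h0 h1 h2

/-- The `A`-linear map `1 ⊗ T : φ^* N → P` induced by a `φ`-semilinear map `T : N → P`. -/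
noncomputable def FrobPull.linearize {P : Type*} [AddCommGroup P] [Module A P]
    (T : N →ₛₗ[φ] P) : FrobPull φ N →ₗ[A] P where
  toFun := FrobPull.lift φ
    { toFun := fun f => f • T.toAddMonoidHom
      map_zero' := zero_smul _ _
      map_add' := fun f g => add_smul _ _ _ }
    (fun a f x => by
      change (φ a * f) • T x = f • T (a • x)
      rw [map_smulₛₗ, mul_comm, mul_smul])
  map_add' := map_add _
  map_smul' a y := by
    induction y using FrobPull.induction with
    | h0 => rw [smul_zero, map_zero, smul_zero]
    | h1 f x =>
      rw [FrobPull.smul_tmul, FrobPull.lift_tmul, FrobPull.lift_tmul]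
      exact mul_smul a f (T x)
    | h2 y z hy hz => rw [smul_add, map_add, hy, hz, map_add, smul_add]

end Pullback

end QFormalism


section PhiConnection

variable {D A : Type*} [CommRing D] [CommRing A] [Algebra D A] {d : ℕ} {Q : QData D A d}

theorem QData.γProd_singleton (Q : QData D A d) (i : Fin d) : Q.γProd {i} = Q.γ i := by
  rw [QData.γProd, Finset.noncommProd_singleton]

theorem QOmega.exists_eq_singleton (I : {I : Finset (Fin d) // I.card = 1}) :
    ∃ i, I = ⟨{i}, Finset.card_singleton i⟩ := by
  obtain ⟨i, hi⟩ := Finset.card_eq_one.mp I.2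
  exact ⟨i, Subtype.ext hi⟩

theorem QData.dZero_apply (Q : QData D A d) (f : A) (i : Fin d) :
    Q.dZero f ⟨{i}, Finset.card_singleton i⟩ = Q.qDer i f := by
  rw [QData.dZero, Finset.sum_apply, Finset.sum_eq_single i]
  · simp [QOmega.dlog]
  · intro j _ hj
    rw [Pi.smul_apply, QOmega.dlog, Pi.single_apply, if_neg, smul_zero]
    intro h
    exact hj (Finset.singleton_injective (Subtype.mk.inj h)).symm
  · simp

theorem QData.dZero_mul (Q : QData D A d) (f g : A) :
    Q.dZero (f * g) = Q.rmul g (Q.dZero f) + f • Q.dZero g := by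
  ext I
  obtain ⟨i, rfl⟩ := QOmega.exists_eq_singleton I
  rw [Pi.add_apply, Pi.smul_apply, Q.dZero_apply, Q.dZero_apply, smul_eq_mul, Q.qDer_mul]
  change _ = Q.dZero f _ * Q.γProd {i} g + _
  rw [Q.dZero_apply, Q.γProd_singleton]

theorem QData.dZero_add (Q : QData D A d) (f g : A) : Q.dZero (f + g) = Q.dZero f + Q.dZero g := by
  simp [QData.dZero, add_smul, Finset.sum_add_distrib]

theorem QData.rmul_mul (Q : QData D A d) {k : ℕ} (f g : A) (ω : QOmega A d k) :
    Q.rmul (f * g) ω = Q.rmul g (Q.rmul f ω) := by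
  ext I
  change ω I * Q.γProd I.1 (f * g) = ω I * Q.γProd I.1 f * Q.γProd I.1 g
  rw [map_mul, mul_assoc]

theorem QData.rmul_add (Q : QData D A d) {k : ℕ} (f g : A) :
    (Q.rmul (f + g) : QOmega A d k →ₗ[A] _) = Q.rmul f + Q.rmul g := by
  refine LinearMap.ext fun ω => ?_
  ext I
  change ω I * Q.γProd I.1 (f + g) = ω I * Q.γProd I.1 f + ω I * Q.γProd I.1 g
  rw [map_add, mul_add]

theorem QData.rmul_algebraMap (Q : QData D A d) {k : ℕ} (a : D) (ω : QOmega A d k) :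
    Q.rmul (algebraMap D A a) ω = algebraMap D A a • ω := by
  ext I
  change ω I * Q.γProd I.1 (algebraMap D A a) = algebraMap D A a * ω I
  rw [AlgEquiv.commutes, mul_comm]

theorem QData.dZero_algebraMap (Q : QData D A d) (a : D) : Q.dZero (algebraMap D A a) = 0 := by
  ext I
  obtain ⟨i, rfl⟩ := QOmega.exists_eq_singleton I
  rw [Q.dZero_apply, Pi.zero_apply]
  refine (mul_cancel_left_mem_nonZeroDivisors Q.regular').mp ?_
  rw [Q.qDer_spec, AlgEquiv.commutes, sub_self, mul_zero]

variable {p : ℕ} (Φ : QFrob p Q)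

/-- The map `φ_Ω : ∑ f_i dlog(U_i) ↦ [p]_q ∑ φ(f_i) dlog(U_i)` on `qΩ^1`. -/
def QFrob.φΩ (Φ : QFrob p Q) : QOmega A d 1 →ₛₗ[Φ.φA] QOmega A d 1 where
  toFun ω I := algebraMap D A (Q.pq p) * Φ.φA (ω I)
  map_add' ω η := by ext I; simp [mul_add]
  map_smul' a ω := by ext I; simp [mul_left_comm]

theorem QFrob.φΩ_dZero (f : A) : Φ.φΩ (Q.dZero f) = Q.dZero (Φ.φA f) := by
  ext I
  obtain ⟨i, rfl⟩ := QOmega.exists_eq_singleton I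
  change algebraMap D A (Q.pq p) * Φ.φA (Q.dZero f _) = _
  rw [Q.dZero_apply, Q.dZero_apply]
  refine (mul_cancel_left_mem_nonZeroDivisors Q.regular').mp ?_
  have h1 : (Q.q - 1) * Q.pq p = Q.q ^ p - 1 := by
    rw [QData.pq, mul_comm, geom_sum_mul]
  have h2 : algebraMap D A (Q.q ^ p - 1) = Φ.φA (algebraMap D A (Q.q - 1)) := by
    rw [Φ.compat, map_sub Φ.φD, Φ.φD_q, map_one]
  rw [Q.qDer_spec, ← mul_assoc, ← map_mul, h1, h2, ← map_mul, Q.qDer_spec, map_sub, Φ.comm]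

theorem QFrob.φΩ_rmul (f : A) (ω : QOmega A d 1) :
    Φ.φΩ (Q.rmul f ω) = Q.rmul (Φ.φA f) (Φ.φΩ ω) := by
  ext I
  obtain ⟨i, rfl⟩ := QOmega.exists_eq_singleton I
  change algebraMap D A (Q.pq p) * Φ.φA (ω _ * Q.γProd {i} f) =
    algebraMap D A (Q.pq p) * Φ.φA (ω _) * Q.γProd {i} (Φ.φA f)
  rw [Q.γProd_singleton, map_mul, Φ.comm, mul_assoc]

variable {N : Type*} [AddCommGroup N] [Module A N]

/-- The map `1 ⊗ φ_Ω : N ⊗ qΩ^1 → φ^* N ⊗ qΩ^1`. -/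
noncomputable def QFrob.tensor : N ⊗[A] QOmega A d 1 →+ FrobPull Φ.φA N ⊗[A] QOmega A d 1 :=
  TensorProduct.liftAddHom
    { toFun := fun x =>
        { toFun := fun ω => FrobPull.tmul Φ.φA 1 x ⊗ₜ[A] Φ.φΩ ω
          map_zero' := by rw [map_zero, TensorProduct.tmul_zero]
          map_add' := fun ω η => by rw [map_add, TensorProduct.tmul_add] }
      map_zero' := by
        refine AddMonoidHom.ext fun ω => ?_
        change FrobPull.tmul Φ.φA 1 (0 : N) ⊗ₜ[A] Φ.φΩ ω = 0
        have : FrobPull.tmul Φ.φA 1 (0 : N) = 0 := TensorProduct.tmul_zero _ _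
        rw [this, TensorProduct.zero_tmul]
      map_add' := fun x y => by
        refine AddMonoidHom.ext fun ω => ?_
        change FrobPull.tmul Φ.φA 1 (x + y) ⊗ₜ[A] Φ.φΩ ω = FrobPull.tmul Φ.φA 1 x ⊗ₜ[A] Φ.φΩ ω +
          FrobPull.tmul Φ.φA 1 y ⊗ₜ[A] Φ.φΩ ω
        rw [FrobPull.tmul_add, TensorProduct.add_tmul] }
    (fun a x ω => by
      change FrobPull.tmul Φ.φA 1 (a • x) ⊗ₜ[A] Φ.φΩ ω =
        FrobPull.tmul Φ.φA 1 x ⊗ₜ[A] Φ.φΩ (a • ω)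
      rw [FrobPull.tmul_smul, ← FrobPull.smul_tmul, map_smulₛₗ, TensorProduct.smul_tmul])

theorem QFrob.tensor_tmul (x : N) (ω : QOmega A d 1) :
    Φ.tensor (x ⊗ₜ[A] ω) = FrobPull.tmul Φ.φA 1 x ⊗ₜ[A] Φ.φΩ ω := rfl

theorem QFrob.tensor_rmul (f : A) (z : N ⊗[A] QOmega A d 1) :
    Φ.tensor ((Q.rmul f).lTensor N z) =
      (Q.rmul (Φ.φA f)).lTensor (FrobPull Φ.φA N) (Φ.tensor z) := by
  induction z using TensorProduct.induction_on with
  | zero => simp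
  | tmul x ω =>
    rw [LinearMap.lTensor_tmul, Φ.tensor_tmul, Φ.tensor_tmul, LinearMap.lTensor_tmul, Φ.φΩ_rmul]
  | add y z hy hz => rw [map_add, map_add, hy, hz, map_add, map_add]

variable [Module D N] [IsScalarTower D A N]

/-- The pullback `φ^*∇ : φ^* N → φ^* N ⊗ qΩ^1` of a `q`-connection,
`x ⊗ f ↦ (1 ⊗ φ_Ω)(∇ x) · f + x ⊗ d_q f`. -/
noncomputable def QConnection.frobPull (nabla : QConnection Q N) :
    FrobPull Φ.φA N →+ FrobPull Φ.φA N ⊗[A] QOmega A d 1 :=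
  FrobPull.lift Φ.φA
    { toFun := fun f =>
        { toFun := fun x => (Q.rmul f).lTensor _ (Φ.tensor (nabla.toLin x)) +
            FrobPull.tmul Φ.φA 1 x ⊗ₜ[A] Q.dZero f
          map_zero' := by
            have : FrobPull.tmul Φ.φA 1 (0 : N) = 0 := TensorProduct.tmul_zero _ _
            rw [this, TensorProduct.zero_tmul, map_zero, map_zero, map_zero, zero_add]
          map_add' := fun x y => by
            rw [map_add, map_add, map_add, FrobPull.tmul_add, TensorProduct.add_tmul]
            abel }
      map_zero' := by
        ext x
        change (Q.rmul 0).lTensor _ (Φ.tensor (nabla.toLin x)) +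
            FrobPull.tmul Φ.φA 1 x ⊗ₜ[A] Q.dZero 0 = 0
        have h1 : (Q.rmul 0 : QOmega A d 1 →ₗ[A] _) = 0 := by
          have := Q.rmul_add (k := 1) 0 0
          rwa [add_zero, left_eq_add] at this
        have h2 : Q.dZero 0 = 0 := by
          have := Q.dZero_add 0 0
          rwa [add_zero, left_eq_add] at this
        rw [h1, h2, LinearMap.lTensor_zero, LinearMap.zero_apply, TensorProduct.tmul_zero,
          add_zero]
      map_add' := fun f g => by
        ext x
        change (Q.rmul (f + g)).lTensor _ (Φ.tensor (nabla.toLin x)) +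
            FrobPull.tmul Φ.φA 1 x ⊗ₜ[A] Q.dZero (f + g) =
          ((Q.rmul f).lTensor _ (Φ.tensor (nabla.toLin x)) +
            FrobPull.tmul Φ.φA 1 x ⊗ₜ[A] Q.dZero f) +
          ((Q.rmul g).lTensor _ (Φ.tensor (nabla.toLin x)) +
            FrobPull.tmul Φ.φA 1 x ⊗ₜ[A] Q.dZero g)
        rw [Q.rmul_add, Q.dZero_add, LinearMap.lTensor_add, LinearMap.add_apply,
          TensorProduct.tmul_add]
        abel }
    (fun a f x => by
      change (Q.rmul (Φ.φA a * f)).lTensor _ (Φ.tensor (nabla.toLin x)) +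
          FrobPull.tmul Φ.φA 1 x ⊗ₜ[A] Q.dZero (Φ.φA a * f) =
        (Q.rmul f).lTensor _ (Φ.tensor (nabla.toLin (a • x))) +
          FrobPull.tmul Φ.φA 1 (a • x) ⊗ₜ[A] Q.dZero f
      have h1 : (Q.rmul (Φ.φA a * f) : QOmega A d 1 →ₗ[A] _) =
          (Q.rmul f).comp (Q.rmul (Φ.φA a)) := by
        refine LinearMap.ext fun ω => ?_
        exact Q.rmul_mul _ _ _
      rw [nabla.leibniz, map_add, map_add, Φ.tensor_rmul, Φ.tensor_tmul, Φ.φΩ_dZero,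
        Q.dZero_mul, FrobPull.tmul_smul, ← FrobPull.smul_tmul, TensorProduct.smul_tmul,
        TensorProduct.tmul_add, LinearMap.lTensor_tmul, h1, LinearMap.lTensor_comp,
        LinearMap.comp_apply]
      abel)

theorem QConnection.frobPull_tmul (nabla : QConnection Q N) (f : A) (x : N) :
    nabla.frobPull Φ (FrobPull.tmul Φ.φA f x) =
      (Q.rmul f).lTensor _ (Φ.tensor (nabla.toLin x)) +
        FrobPull.tmul Φ.φA 1 x ⊗ₜ[A] Q.dZero f := rfl

theorem QConnection.frobPull_smul (nabla : QConnection Q N) (a : D) (y : FrobPull Φ.φA N) :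
    nabla.frobPull Φ (algebraMap D A a • y) = algebraMap D A a • nabla.frobPull Φ y := by
  induction y using FrobPull.induction with
  | h0 => simp
  | h1 f x =>
    have h1 : (Q.rmul (f * algebraMap D A a) : QOmega A d 1 →ₗ[A] _) =
        algebraMap D A a • Q.rmul f := by
      refine LinearMap.ext fun ω => ?_
      rw [Q.rmul_mul, Q.rmul_algebraMap, LinearMap.smul_apply]
    rw [FrobPull.smul_tmul, nabla.frobPull_tmul, nabla.frobPull_tmul, mul_comm, h1,
      mul_comm, Q.dZero_mul, Q.dZero_algebraMap, map_zero, zero_add, TensorProduct.tmul_smul,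
      LinearMap.lTensor_smul, LinearMap.smul_apply, smul_add]
  | h2 y z hy hz => rw [smul_add, map_add, hy, hz, map_add, smul_add]

/-- The extension of `∇ : M → M ⊗ qΩ^1` to `M[1/[p]_q] → M[1/[p]_q] ⊗ qΩ^1`. -/
noncomputable def QData.extendLoc (Q : QData D A d) (p : ℕ) {M : Type*} [AddCommGroup M]
    [Module A M] (nabla : M →+ M ⊗[A] QOmega A d 1)
    (h : ∀ (a : D) (x : M), nabla (algebraMap D A a • x) = algebraMap D A a • nabla x) :
    LocalizedModule (Q.pqPowers p) M →+ LocalizedModule (Q.pqPowers p) M ⊗[A] QOmega A d 1 :=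
  locLift (Q.pqPowers p) (MonoidHom.id A)
    (((LocalizedModule.mkLinearMap (Q.pqPowers p) M).rTensor
      (QOmega A d 1)).toAddMonoidHom.comp nabla)
    (fun s x => by
      obtain ⟨n, hn⟩ := s.2
      have hn' : (s : A) = algebraMap D A (Q.pq p ^ n) := by rw [← hn, map_pow]
      simp only [AddMonoidHom.comp_apply, LinearMap.toAddMonoidHom_coe, MonoidHom.id_apply]
      rw [hn', h, map_smul])
    (fun s => by
      have h1 := (isUnit_end_of_dvd (M := M) (Q.pqPowers p) ⟨s, s.2, dvd_refl (s : A)⟩).map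
        (Module.End.rTensorAlgHom A (LocalizedModule (Q.pqPowers p) M) (QOmega A d 1))
      rwa [AlgHom.commutes] at h1)

/-- The `q`-connection on `N[1/[p]_q]`. -/
noncomputable def QConnection.loc (p : ℕ) (nabla : QConnection Q N) :
    LocalizedModule (Q.pqPowers p) N →+ LocalizedModule (Q.pqPowers p) N ⊗[A] QOmega A d 1 :=
  Q.extendLoc p nabla.toLin.toAddMonoidHom (fun a x => by
    change nabla.toLin (algebraMap D A a • x) = algebraMap D A a • nabla.toLin x
    rw [algebraMap_smul, map_smul, algebraMap_smul])

/-- The `q`-connection `φ^*∇` on `(φ^* N)[1/[p]_q]`. -/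
noncomputable def QConnection.frobPullLoc (nabla : QConnection Q N) :
    LocalizedModule (Q.pqPowers p) (FrobPull Φ.φA N) →+
      LocalizedModule (Q.pqPowers p) (FrobPull Φ.φA N) ⊗[A] QOmega A d 1 :=
  Q.extendLoc p (nabla.frobPull Φ) (nabla.frobPull_smul Φ)

/-- A `φ`-module structure on a module with `q`-connection: an `A`-linear isomorphism
`φ_N : (φ^* N)[1/[p]_q] ≃ N[1/[p]_q]` which is compatible with `φ^*∇` and `∇`. -/
structure PhiStructure (nabla : QConnection Q N) where
  iso : LocalizedModule (Q.pqPowers p) (FrobPull Φ.φA N) ≃ₗ[A] LocalizedModule (Q.pqPowers p) N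
  horizontal : ∀ z, nabla.loc p (iso z) =
    (iso.toLinearMap.rTensor (QOmega A d 1)) (nabla.frobPullLoc Φ z)

end PhiConnection

/-! ### The `q`-formalism for `A_R^+` -/

section APlusQ

variable {p : ℕ} [Fact p.Prime] {κ : Type*} [Field κ] [CharP κ p] {d : ℕ}
variable {S : Type*} [CommRing S] [Algebra (RSquare p κ d) S]
variable {Ω : Type*} [Field Ω] [Algebra (PCompl p S) Ω]

/-- The elements `γ_1, …, γ_d` of the geometric part of `Γ_R` fix all `ζ_n` and satisfy
`γ_j (X_i^♭) = ε X_i^♭` if `i = j` and `γ_j (X_i^♭) = X_i^♭` otherwise; they are topological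
generators of the geometric part. -/
structure RootData.IsGeometricBasis (r : RootData p κ d S Ω) (γ : Fin d → r.Gal) : Prop where
  map_ζ : ∀ j n, γ j (r.ζInf n) = r.ζInf n
  map_x : ∀ j i n, γ j (r.xInf i n) = if i = j then r.ζInf n * r.xInf i n else r.xInf i n

theorem RootData.IsGeometricBasis.chi {r : RootData p κ d S Ω} {γ : Fin d → r.Gal}
    (h : r.IsGeometricBasis γ) (j : Fin d) : r.chi (γ j) = 1 :=
  r.chi_eq fun n => by rw [h.map_ζ, r.pow_one]

theorem RootData.IsGeometricBasis.kummer {r : RootData p κ d S Ω} {γ : Fin d → r.Gal}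
    (h : r.IsGeometricBasis γ) (j : Fin d) : r.kummer (γ j) = Pi.single j 1 := by
  ext1 i
  refine r.kummer_eq fun n => ?_
  rw [h.map_x, Pi.single_apply]
  split_ifs
  · rw [r.pow_one]
  · rw [r.pow_zero, one_mul]

theorem dToA_hom_ext {F G : DRing p →+* PowerSeries (PCompl p S)}
    (hX : F PowerSeries.X = G PowerSeries.X) (hX0 : PowerSeries.X ∣ F PowerSeries.X) : F = G :=
  hom_ext_powerSeries (Int.castRingHom ℤ_[p]) (exists_natCast_sub_dvd p) (PCompl.psep S)
    (fun s => by simp) hX hX0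

theorem dToA_X : dToA p κ d S PowerSeries.X = PowerSeries.X := by rw [dToA, PowerSeries.map_X]

theorem IsGammaLift.map_dToA {c : Fin d → ℤ_[p]}
    {E : PowerSeries (PCompl p S) →+* PowerSeries (PCompl p S)}
    (hE : IsGammaLift p κ d S c 1 E) (a : DRing p) : E (dToA p κ d S a) = dToA p κ d S a := by
  have hX : E PowerSeries.X = PowerSeries.X := by
    rw [hE.map_X, qpow_one, add_sub_cancel_left, dToA_X]
  have h1 : E.comp (dToA p κ d S) = dToA p κ d S := by
    refine dToA_hom_ext ?_ ?_
    · rw [RingHom.comp_apply, dToA_X, hX]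
    · rw [RingHom.comp_apply, dToA_X, hX]
  exact RingHom.congr_fun h1 a

theorem IsGammaLift.dvd_sub {c : Fin d → ℤ_[p]} {u : ℤ_[p]}
    {E : PowerSeries (PCompl p S) →+* PowerSeries (PCompl p S)}
    (hE : IsGammaLift p κ d S c u E) (a : PowerSeries (PCompl p S)) :
    dToA p κ d S (1 + PowerSeries.X - 1) ∣ E a - a := by
  rw [add_sub_cancel_left, dToA_X, PowerSeries.X_dvd_iff, map_sub, hE.mod_X, sub_self]

theorem IsGammaLift.map_coord {i : Fin d} {u : ℤ_[p]}
    {E : PowerSeries (PCompl p S) →+* PowerSeries (PCompl p S)}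
    (hE : IsGammaLift p κ d S (Pi.single i 1) u E) (j : Fin d) :
    E (PowerSeries.C (coord p κ d S j)) = if i = j then
      dToA p κ d S (1 + PowerSeries.X) * PowerSeries.C (coord p κ d S j) else
      PowerSeries.C (coord p κ d S j) := by
  rw [coord, hE.map_mono]
  have h2 : ∑ t, (((Pi.single j 1 : Fin d → ℤ) t : ℤ) : ℤ_[p]) *
      (Pi.single i 1 : Fin d → ℤ_[p]) t = if i = j then 1 else 0 := by
    rw [Finset.sum_eq_single i]
    · rw [Pi.single_eq_same, mul_one, Pi.single_apply]
      split_ifs <;> simp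
    · intro t _ ht
      rw [Pi.single_eq_of_ne ht, mul_zero]
    · simp
  rw [h2]
  split_ifs
  · rw [qpow_one]
  · rw [qpow_zero, map_one, one_mul]

theorem C_coord_mul (i : Fin d) : (PowerSeries.C (coord p κ d S i) *
    PowerSeries.C (mono p κ d S (-Pi.single i 1) 1) : PowerSeries (PCompl p S)) = 1 := by
  rw [← map_mul, coord, ← mono_mul, add_neg_cancel, one_mul, mono_zero_one, map_one]

theorem dToA_regular : dToA p κ d S (1 + PowerSeries.X - 1) ∈
    nonZeroDivisors (PowerSeries (PCompl p S)) := by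
  rw [add_sub_cancel_left, dToA_X]
  exact MvPowerSeries.X_mem_nonzeroDivisors

theorem IsFrobLift.map_dToA {F : PowerSeries (PCompl p S) →+* PowerSeries (PCompl p S)}
    (hF : IsFrobLift p κ d S F) {G : DRing p →+* DRing p}
    (hG : G PowerSeries.X = (1 + PowerSeries.X) ^ p - 1) (a : DRing p) :
    F (dToA p κ d S a) = dToA p κ d S (G a) := by
  have h1 : F.comp (dToA p κ d S) = (dToA p κ d S).comp G := by
    refine dToA_hom_ext ?_ ?_
    · rw [RingHom.comp_apply, dToA_X, hF.map_X, RingHom.comp_apply, hG, map_sub, map_pow,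
        map_add, map_one, dToA_X]
    · rw [RingHom.comp_apply, dToA_X]
      exact hF.X_dvd
  exact RingHom.congr_fun h1 a

variable [Algebra.Etale (RSquare p κ d) S] (r : RootData p κ d S Ω)

theorem RootData.act_spec (g : r.Gal) :
    IsGammaLift p κ d S (r.kummer g) (r.chi g) (r.act g) := gammaLift_spec p κ d S _ _

theorem RootData.act_act_inv (g : r.Gal) (a : APlus p κ d S) : r.act g (r.act g⁻¹ a) = a := by
  have : r.act g * r.act g⁻¹ = 1 := by rw [← map_mul, mul_inv_cancel, map_one]
  exact RingHom.congr_fun this a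

theorem RootData.act_inv_act (g : r.Gal) (a : APlus p κ d S) : r.act g⁻¹ (r.act g a) = a := by
  have : r.act g⁻¹ * r.act g = 1 := by rw [← map_mul, inv_mul_cancel, map_one]
  exact RingHom.congr_fun this a

theorem APlus.dvd_act_μ (g : r.Gal) : APlus.μ p κ d S ∣ r.act g (APlus.μ p κ d S) := by
  have h1 : r.act g (APlus.μ p κ d S) = dToA p κ d S (qpow p (r.chi g) - 1) :=
    (r.act_spec g).map_X
  rw [h1]
  exact PowerSeries.X_dvd_iff.mpr (dToA_sub_one_constantCoeff _)

theorem APlus.act_μ_dvd (g : r.Gal) : r.act g (APlus.μ p κ d S) ∣ APlus.μ p κ d S := by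
  obtain ⟨y, hy⟩ := APlus.dvd_act_μ r g⁻¹
  refine ⟨r.act g y, ?_⟩
  rw [← map_mul, ← hy, r.act_act_inv]

variable {r}

theorem RootData.IsGeometricBasis.act_algebraMap {γ : Fin d → r.Gal}
    (h : r.IsGeometricBasis γ) (j : Fin d) (a : DRing p) :
    r.act (γ j) (algebraMap (DRing p) (APlus p κ d S) a) = algebraMap _ _ a := by
  have h1 := r.act_spec (γ j)
  rw [h.chi] at h1
  exact h1.map_dToA a

/-- The `q`-formalism for `A_R^+` over `ℤ_p⟦μ⟧`, with `q = 1 + μ` and `U_i = [X_i^♭]`. -/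
noncomputable def APlus.qData {γ : Fin d → r.Gal} (h : r.IsGeometricBasis γ) :
    QData (DRing p) (APlus p κ d S) d where
  q := 1 + PowerSeries.X
  γ j := AlgEquiv.ofRingEquiv (f := RingEquiv.ofRingHom (r.act (γ j)) (r.act (γ j)⁻¹)
    (RingHom.ext fun a => r.act_act_inv (γ j) a) (RingHom.ext fun a => r.act_inv_act (γ j) a))
    (h.act_algebraMap j)
  U i := Units.mkOfMulEqOne (APlus.U p κ d S i)
    (PowerSeries.C (mono p κ d S (-Pi.single i 1) 1) : PowerSeries (PCompl p S)) (C_coord_mul i)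
  comm i j := by
    ext1 a
    have h1 : r.act (γ i) * r.act (γ j) = r.act (γ j) * r.act (γ i) := by
      refine ((r.act_spec (γ i)).comp (r.act_spec (γ j))).unique ?_
      have := (r.act_spec (γ j)).comp (r.act_spec (γ i))
      rw [h.chi, h.chi, one_smul] at this ⊢
      rwa [add_comm]
    exact RingHom.congr_fun h1 a
  regular := by
    rw [add_sub_cancel_left]
    exact mem_nonZeroDivisors_of_ne_zero PowerSeries.X_ne_zero
  regular' := dToA_regular
  congr_one i a := (r.act_spec (γ i)).dvd_sub a
  γ_U i j := by
    have h1 := r.act_spec (γ i)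
    rw [h.kummer] at h1
    exact h1.map_coord j

/-- The Frobenius of `ℤ_p⟦μ⟧`: identity on `ℤ_p` and `μ ↦ (1 + μ) ^ p - 1`. -/
theorem exists_frobD (p : ℕ) [Fact p.Prime] : ∃ F : DRing p →+* DRing p,
    (∀ a, F (PowerSeries.C a) = PowerSeries.C a) ∧
      F PowerSeries.X = (1 + PowerSeries.X) ^ p - 1 :=
  exists_extend_powerSeries _ _ (by simp)

/-- The Frobenius of `ℤ_p⟦μ⟧`: identity on `ℤ_p` and `μ ↦ (1 + μ) ^ p - 1`. -/
noncomputable def frobD (p : ℕ) [Fact p.Prime] : DRing p →+* DRing p := (exists_frobD p).choose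

theorem frobD_X (p : ℕ) [Fact p.Prime] :
    frobD p PowerSeries.X = (1 + PowerSeries.X) ^ p - 1 := (exists_frobD p).choose_spec.2

/-- The Frobenius lifts on `ℤ_p⟦μ⟧` and `A_R^+`. -/
noncomputable def APlus.qFrob [PerfectRing κ p] {γ : Fin d → r.Gal} (h : r.IsGeometricBasis γ) :
    QFrob p (APlus.qData h) where
  φD := frobD p
  φA := APlus.frob p κ d S
  compat a := (frobLift_spec p κ d S).map_dToA (frobD_X p) a
  φD_q := by
    change frobD p (1 + PowerSeries.X) = (1 + PowerSeries.X) ^ p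
    rw [map_add, map_one, frobD_X, add_sub_cancel]
  liftD a := by
    refine frob_mod_p (Int.castRingHom ℤ_[p]) (exists_natCast_sub_dvd p) (frobD_X p) ?_ a
    intro s
    have h1 : ((p : ℤ_[p])) ∣ (s : ℤ_[p]) - (s : ℤ_[p]) ^ p := by
      have : ((p : ℤ)) ∣ s - s ^ p := by
        rw [← ZMod.intCast_zmod_eq_zero_iff_dvd, Int.cast_sub, Int.cast_pow, ZMod.pow_card,
          sub_self]
      obtain ⟨t, ht⟩ := this
      refine ⟨(t : ℤ_[p]), ?_⟩
      have := congr_arg (Int.cast : ℤ → ℤ_[p]) ht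
      push_cast at this
      exact this
    have h2 : frobD p (PowerSeries.C (Int.castRingHom ℤ_[p] s)) =
        PowerSeries.C (Int.castRingHom ℤ_[p] s) := (exists_frobD p).choose_spec.1 _
    rw [h2, PowerSeries.map_C, ← map_pow, ← map_pow, ← sub_eq_zero, ← map_sub, ← map_sub]
    have h3 : Ideal.Quotient.mk (Ideal.span {(p : ℤ_[p])})
        (Int.castRingHom ℤ_[p] s - Int.castRingHom ℤ_[p] s ^ p) = 0 :=
      Ideal.Quotient.eq_zero_iff_mem.mpr (Ideal.mem_span_singleton.mpr h1)
    rw [h3, map_zero]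
  liftA := (frobLift_spec p κ d S).mod_p
  comm i a := (RingHom.congr_fun ((frobLift_spec p κ d S).comm (r.act_spec (γ i))) a).symm

end APlusQ


/-! ### Wach modules -/

section Wach

variable {p : ℕ} [Fact p.Prime] {κ : Type*} [Field κ] [CharP κ p] {d : ℕ}
variable {S : Type*} [CommRing S] [Algebra (RSquare p κ d) S]

/-- The special fibre `S / p` of the `R^□`-algebra `S` is nonempty and geometrically integral over
`κ`: its base change to an algebraic closure of `κ` is a domain. -/
def GeomIntegralSpecialFibre (p : ℕ) [Fact p.Prime] (κ : Type*) [Field κ] [CharP κ p] (d : ℕ)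
    (S : Type*) [CommRing S] [Algebra (RSquare p κ d) S] : Prop :=
  let _ : Algebra (WittVector p κ) (AlgebraicClosure κ) :=
    ((algebraMap κ (AlgebraicClosure κ)).comp WittVector.constantCoeff).toAlgebra
  let _ : Algebra (WittVector p κ) S :=
    ((algebraMap (RSquare p κ d) S).comp ((algebraMap (Laurent p κ d) (RSquare p κ d)).comp
      AddMonoidAlgebra.singleZeroRingHom)).toAlgebra
  IsDomain (AlgebraicClosure κ ⊗[WittVector p κ] S)

variable [Algebra.Etale (RSquare p κ d) S]

variable (p κ d S) in
theorem APlus.μ_dvd_frob_μ [PerfectRing κ p] :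
    APlus.μ p κ d S ∣ APlus.frob p κ d S (APlus.μ p κ d S) :=
  (frobLift_spec p κ d S).X_dvd

variable (p κ d S) in
/-- The element `[p]_q = 1 + q + ⋯ + q ^ (p - 1)` of `A_R^+`, where `q = 1 + μ`. -/
noncomputable def APlus.pq : APlus p κ d S := ∑ j ∈ Finset.range p, (1 + APlus.μ p κ d S) ^ j

variable (p κ d S) in
theorem APlus.frob_μ [PerfectRing κ p] :
    APlus.frob p κ d S (APlus.μ p κ d S) = APlus.pq p κ d S * APlus.μ p κ d S := by
  have h1 := geom_sum_mul (1 + APlus.μ p κ d S) p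
  rw [add_sub_cancel_left] at h1
  rw [APlus.pq, h1]
  exact (frobLift_spec p κ d S).map_X

variable {Ω : Type*} [Field Ω] [Algebra (PCompl p S) Ω] (r : RootData p κ d S Ω)

theorem APlus.frob_act [PerfectRing κ p] (g : r.Gal) (a : APlus p κ d S) :
    r.act g (APlus.frob p κ d S a) = APlus.frob p κ d S (r.act g a) :=
  RingHom.congr_fun ((frobLift_spec p κ d S).comm (r.act_spec g)) a

variable {N : Type*} [AddCommGroup N] [Module (APlus p κ d S) N]

/-- The extension of a semilinear action of `Γ_R` on `N` to `N[1/t]`, where `t ∈ A_R^+` is such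
that `g(t)` divides `t` for all `g`. -/
noncomputable def RootData.actLoc (act : r.Gal →* AddMonoid.End N)
    (act_smul : ∀ g (f : APlus p κ d S) (x : N), act g (f • x) = r.act g f • act g x)
    (t : APlus p κ d S) (ht : ∀ g, r.act g t ∣ t) (g : r.Gal) :
    LocalizedModule (Submonoid.powers t) N →+ LocalizedModule (Submonoid.powers t) N :=
  locLift (Submonoid.powers t) (r.act g : APlus p κ d S →* APlus p κ d S)
    ((LocalizedModule.mkLinearMap (Submonoid.powers t) N).toAddMonoidHom.comp (act g))
    (fun s x => by
      change LocalizedModule.mkLinearMap (Submonoid.powers t) N (act g ((s : APlus p κ d S) • x)) =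
        r.act g (s : APlus p κ d S) •
          LocalizedModule.mkLinearMap (Submonoid.powers t) N (act g x)
      rw [act_smul, map_smul])
    (fun s => by
      obtain ⟨n, hn⟩ := s.2
      refine isUnit_end_of_dvd _ ⟨s, s.2, ?_⟩
      have h1 : r.act g t ^ n ∣ t ^ n := pow_dvd_pow_of_dvd (ht g) n
      rw [← _root_.map_pow] at h1
      simp only at hn
      rw [hn] at h1
      exact h1)

/-- The submodule `μ ^ b N` of a localization `N[1/t]` on which `μ` acts invertibly. -/
noncomputable def muPow (t : APlus p κ d S) (N : Type*) [AddCommGroup N]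
    [Module (APlus p κ d S) N] (b : ℤ) :
    Submodule (APlus p κ d S) (LocalizedModule (Submonoid.powers t) N) :=
  ((LinearMap.range (LocalizedModule.mkLinearMap (Submonoid.powers t) N)).map
      (LinearMap.lsmul _ _ (APlus.μ p κ d S ^ b.toNat))).comap
    (LinearMap.lsmul _ _ (APlus.μ p κ d S ^ (-b).toNat))

/-- A Wach module over `A_R^+` with weights in `[a, b]`: a finitely generated `A_R^+`-module with
a continuous semilinear action of `Γ_R` and a Frobenius `φ : N[1/μ] → N[1/φ(μ)]`. -/
structure WachModule [PerfectRing κ p] (a b : ℤ) (N : Type*) [AddCommGroup N]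
    [Module (APlus p κ d S) N] where
  le : a ≤ b
  finite : Module.Finite (APlus p κ d S) N
  act : r.Gal →* AddMonoid.End N
  act_smul : ∀ (g : r.Gal) (f : APlus p κ d S) (x : N), act g (f • x) = r.act g f • act g x
  continuous_act :
    let _ : TopologicalSpace N :=
      (Ideal.span {(p : APlus p κ d S), APlus.μ p κ d S}).adicModuleTopology N
    Continuous fun t : r.Gal × N => act t.1 t.2
  regular_p : ∀ x : N, (p : APlus p κ d S) • x = 0 → x = 0
  regular_μ_mod_p : ∀ x y : N, APlus.μ p κ d S • x = (p : APlus p κ d S) • y →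
    ∃ z, x = (p : APlus p κ d S) • z
  regular_μ : ∀ x : N, APlus.μ p κ d S • x = 0 → x = 0
  regular_p_mod_μ : ∀ x y : N, (p : APlus p κ d S) • x = APlus.μ p κ d S • y →
    ∃ z, x = APlus.μ p κ d S • z
  trivial_mod_μ : ∀ (g : r.Gal) (x : N), ∃ y, act g x - x = APlus.μ p κ d S • y
  φ : LocalizedModule (Submonoid.powers (APlus.μ p κ d S)) N →ₛₗ[APlus.frob p κ d S]
    LocalizedModule (Submonoid.powers (APlus.frob p κ d S (APlus.μ p κ d S))) N
  φ_comm : ∀ (g : r.Gal) (z : LocalizedModule (Submonoid.powers (APlus.μ p κ d S)) N),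
    φ (r.actLoc act act_smul (APlus.μ p κ d S) (APlus.act_μ_dvd r) g z) =
      r.actLoc act act_smul (APlus.frob p κ d S (APlus.μ p κ d S))
        (fun g => by
          rw [APlus.frob_act]
          exact map_dvd _ (APlus.act_μ_dvd r g)) g (φ z)
  φ_mem : ∀ z ∈ muPow (APlus.μ p κ d S) N b,
    φ z ∈ muPow (APlus.frob p κ d S (APlus.μ p κ d S)) N b
  φ_injective : Function.Injective
    (FrobPull.linearize (APlus.frob p κ d S) (φ.comp (muPow (APlus.μ p κ d S) N b).subtype))
  φ_coker : ∀ z ∈ muPow (APlus.frob p κ d S (APlus.μ p κ d S)) N b,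
    APlus.pq p κ d S ^ (b - a).toNat • z ∈ LinearMap.range
      (FrobPull.linearize (APlus.frob p κ d S) (φ.comp (muPow (APlus.μ p κ d S) N b).subtype))

variable {r}

theorem WachModule.exists_diff [PerfectRing κ p] {a b : ℤ} (W : WachModule r a b N)
    (g : r.Gal) (x : N) : ∃ y, APlus.μ p κ d S • y = W.act g x - x := by
  obtain ⟨y, hy⟩ := W.trivial_mod_μ g x
  exact ⟨y, hy.symm⟩

/-- The element `(g(x) - x) / μ` of a Wach module. -/
noncomputable def WachModule.diff [PerfectRing κ p] {a b : ℤ} (W : WachModule r a b N)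
    (g : r.Gal) (x : N) : N := (W.exists_diff g x).choose

/-- The canonical map `N[1/[p]_q] → N[1/φ(μ)]`. -/
noncomputable def APlus.locIncl [PerfectRing κ p] {γ : Fin d → r.Gal} (h : r.IsGeometricBasis γ)
    (N : Type*) [AddCommGroup N] [Module (APlus p κ d S) N] :
    LocalizedModule ((APlus.qData h).pqPowers p) N →ₗ[APlus p κ d S]
      LocalizedModule (Submonoid.powers (APlus.frob p κ d S (APlus.μ p κ d S))) N :=
  LocalizedModule.lift _ (LocalizedModule.mkLinearMap _ N) (fun s => by
    obtain ⟨n, hn⟩ := s.2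
    refine isUnit_end_of_dvd _ ⟨_, ⟨n, rfl⟩, ?_⟩
    rw [← hn, APlus.frob_μ]
    refine pow_dvd_pow_of_dvd (Dvd.intro (APlus.μ p κ d S) ?_) n
    congr 1
    rw [QData.pq, APlus.pq, map_sum]
    refine Finset.sum_congr rfl fun j _ => ?_
    rw [map_pow]
    congr 1
    have h1 : dToA p κ d S (1 + PowerSeries.X) = 1 + PowerSeries.X := by
      rw [map_add, map_one, dToA_X]
    exact h1)

end Wach

end WachQ

open WachQ

/-! Because `Γ_R` acts trivially modulo `μ` and `N` is `μ`-torsion free, `(γ_i - 1)/μ` is a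
well-defined operator on `N`. Semilinearity of `γ_i` turns into a twisted Leibniz rule for it, which
is the rule of a `q`-connection. The `γ_i` commute, as is checked on the generators of `R_∞[1/p]`
(`RootData.IsGeometricBasis.mul_comm`), hence so do these operators. The connection extends to forms
by an explicit formula on coefficients (`extend`); its graded Leibniz rule is sign bookkeeping
(`extend_leibniz`), and its square vanishes because the terms indexed by `(i, j)` and `(j, i)`
cancel (`extend_extend`).

For the Frobenius, stability of `μ^b N` together with `φ(μ) = [p]_q μ` gives `φ(N) ⊆ [p]_q^(-b) N`
(`exists_pq_pow_smul_φ`). As `N` has no `μ`-torsion, `N[1/[p]_q]` embeds in `N[1/φ(μ)]`, so `φ`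
takes values in `N[1/[p]_q]`. Injectivity and bounded cokernel of the linearization make it an
isomorphism once `[p]_q` is inverted. Since `φ` commutes with `γ_i`, dividing `φ((γ_i - 1) x) = (γ_i
- 1) φ(x)` by `μ` yields `der_i ∘ φ = [p]_q φ ∘ der_i` (`Frobenius.der`). The factor `[p]_q` is the
one in `φ_Ω`, and horizontality follows (`loc_linearize`).

Quasi-nilpotence is a consequence of the Frobenius structure (Dwork's trick). Modulo `μ` one has
`[p]_q ≡ p`, so a derivative of a Frobenius image is `p` times a Frobenius image, after clearing
denominators; such images span `N/μN` up to a bounded power of `p`. On the coefficient ring `R`, the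
`p`-th iterate of `∂/∂U_i` is zero modulo `p`: on Laurent monomials it produces a product of `p`
consecutive integers, and, being a derivation modulo `p`, it then vanishes modulo `p` on the étale
algebra as well (`dvd_iterate_of_map_mono`). So every `p` iterations gain a factor `p` on the span
of Frobenius images, and `p`-torsion freeness of `N/μN` carries this over to all elements
(`exists_iterate_eq_pow_smul`).

The first and last arguments are carried out for abstract data, `QData.SemiAction` and
`QData.SemiAction.Frobenius`, which a Wach module is shown to provide. -/

namespace WachQ

/-! ### Forms with values in a module, through their coefficients. -/

section Forms

variable {A : Type*} [CommRing A] {d : ℕ} {N : Type*} [AddCommGroup N] [Module A N]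

/-- The coefficient in `N` at a set of indices of a `k`-form with values in `N`. -/
noncomputable def QOmega.comp (N : Type*) [AddCommGroup N] [Module A N] {k : ℕ}
    (I : Finset (Fin d)) : N ⊗[A] QOmega A d k →ₗ[A] N :=
  (TensorProduct.rid A N).toLinearMap ∘ₗ (QOmega.coeff I).lTensor N

theorem QOmega.comp_tmul {k : ℕ} (I : Finset (Fin d)) (x : N) (ω : QOmega A d k) :
    QOmega.comp N I (x ⊗ₜ[A] ω) = QOmega.coeff I ω • x := by
  simp [QOmega.comp]

theorem QOmega.coeff_apply {k : ℕ} (I : {I : Finset (Fin d) // I.card = k}) (ω : QOmega A d k) :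
    QOmega.coeff I.1 ω = ω I := by
  simp [QOmega.coeff, I.2]

theorem QOmega.coeff_of_ne {k : ℕ} {I : Finset (Fin d)} (h : I.card ≠ k) (ω : QOmega A d k) :
    QOmega.coeff I ω = 0 := by
  simp [QOmega.coeff, h]

theorem QOmega.coeff_dlog (i : Fin d) (I : Finset (Fin d)) :
    QOmega.coeff I (QOmega.dlog i : QOmega A d 1) = if I = {i} then 1 else 0 := by
  by_cases h : I.card = 1
  · rw [QOmega.coeff_apply ⟨I, h⟩, QOmega.dlog, Pi.single_apply]
    simp only [Subtype.mk.injEq]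
  · rw [QOmega.coeff_of_ne h, if_neg]
    rintro rfl
    exact h (Finset.card_singleton i)

theorem QOmega.comp_eq_piScalarRight {k : ℕ} (z : N ⊗[A] QOmega A d k)
    (I : {I : Finset (Fin d) // I.card = k}) :
    QOmega.comp N I.1 z = TensorProduct.piScalarRight A A N _ z I := by
  induction z using TensorProduct.induction_on with
  | zero => simp
  | tmul x ω => simp [QOmega.comp_tmul, QOmega.coeff_apply]
  | add y z hy hz => rw [map_add, map_add, hy, hz, Pi.add_apply]

/-- The default value zero in the wrong degree allows sums over all subsets of indices without a
condition on their cardinality. -/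
theorem QOmega.comp_of_ne {k : ℕ} {I : Finset (Fin d)} (h : I.card ≠ k)
    (z : N ⊗[A] QOmega A d k) : QOmega.comp N I z = 0 := by
  induction z using TensorProduct.induction_on with
  | zero => simp
  | tmul x ω => rw [QOmega.comp_tmul, QOmega.coeff_of_ne h, zero_smul]
  | add y z hy hz => rw [map_add, hy, hz, add_zero]

/-- `qΩ^k` is free of finite rank, so `N ⊗ qΩ^k` is a finite power of `N` for an arbitrary module
`N`. Identities between forms are checked on coefficients from here on. -/
theorem QOmega.comp_ext {k : ℕ} {z z' : N ⊗[A] QOmega A d k}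
    (h : ∀ I : {I : Finset (Fin d) // I.card = k}, QOmega.comp N I.1 z = QOmega.comp N I.1 z') :
    z = z' := by
  refine (TensorProduct.piScalarRight A A N _).injective ?_
  ext I
  rw [← QOmega.comp_eq_piScalarRight, ← QOmega.comp_eq_piScalarRight, h]

/-- The form with values in `N` with given coefficients. -/
noncomputable def QOmega.ofComp {k : ℕ} :
    ({I : Finset (Fin d) // I.card = k} → N) ≃ₗ[A] N ⊗[A] QOmega A d k :=
  (TensorProduct.piScalarRight A A N _).symm

theorem QOmega.comp_ofComp {k : ℕ} (f : {I : Finset (Fin d) // I.card = k} → N)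
    (I : {I : Finset (Fin d) // I.card = k}) : QOmega.comp N I.1 (QOmega.ofComp (A := A) f) = f I := by
  rw [QOmega.comp_eq_piScalarRight, QOmega.ofComp, LinearEquiv.apply_symm_apply]

end Forms

/-! ### Signs of products of basis forms. -/

section Sign

variable {A : Type*} [CommRing A] {d : ℕ}

/-- The number of inversions is a count of pairs, hence additive over disjoint unions in either
variable. -/
theorem sgn_union_left {I J K : Finset (Fin d)} (h : Disjoint I J) :
    sgn A (I ∪ J) K = sgn A I K * sgn A J K := by
  rw [sgn, sgn, sgn, ← pow_add, Finset.union_product, Finset.filter_union,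
    Finset.card_union_of_disjoint]
  refine Finset.disjoint_filter_filter (Finset.disjoint_product.mpr (Or.inl h))

theorem sgn_union_right {I J K : Finset (Fin d)} (h : Disjoint J K) :
    sgn A I (J ∪ K) = sgn A I J * sgn A I K := by
  rw [sgn, sgn, sgn, ← pow_add, Finset.product_union, Finset.filter_union,
    Finset.card_union_of_disjoint]
  refine Finset.disjoint_filter_filter (Finset.disjoint_product.mpr (Or.inr h))

/-- For disjoint sets, each pair of indices is an inversion in exactly one of the two orders, so the
two inversion counts add up to the number of all pairs. -/
theorem sgn_mul_sgn_swap {I J : Finset (Fin d)} (h : Disjoint I J) :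
    sgn A I J * sgn A J I = (-1) ^ (I.card * J.card) := by
  rw [sgn, sgn, ← pow_add]
  have h1 : ((J ×ˢ I).filter fun t => t.2 < t.1).card =
      ((I ×ˢ J).filter fun t => ¬ t.2 < t.1).card := by
    refine Finset.card_bij' (fun t _ => t.swap) (fun t _ => t.swap) ?_ ?_ (by simp) (by simp)
    · rintro ⟨a, b⟩ hab
      simp only [Finset.mem_filter, Finset.mem_product, Prod.swap_prod_mk] at hab ⊢
      exact ⟨⟨hab.1.2, hab.1.1⟩, by omega⟩
    · rintro ⟨a, b⟩ hab
      simp only [Finset.mem_filter, Finset.mem_product, Prod.swap_prod_mk] at hab ⊢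
      have : a ≠ b := Finset.disjoint_iff_ne.mp h a hab.1.1 b hab.1.2
      exact ⟨⟨hab.1.2, hab.1.1⟩, by omega⟩
  rw [h1, Finset.card_filter_add_card_filter_not, Finset.card_product]

theorem sgn_mul_self (I J : Finset (Fin d)) : sgn A I J * sgn A I J = 1 := by
  rw [sgn, ← mul_pow, neg_one_mul, neg_neg, one_pow]

theorem sgn_empty_right (I : Finset (Fin d)) : sgn A I ∅ = 1 := by simp [sgn]

end Sign

/-! ### Coefficients of products and of the differential. -/

section Wedge

variable {D A : Type*} [CommRing D] [CommRing A] [Algebra D A] {d : ℕ}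
variable {N : Type*} [AddCommGroup N] [Module A N]

theorem QData.γProd_insert (Q : QData D A d) {i : Fin d} {I : Finset (Fin d)}
    (h : i ∉ I) (f : A) : Q.γProd (insert i I) f = Q.γ i (Q.γProd I f) := by
  exact AlgEquiv.congr_fun (Finset.noncommProd_insert_of_notMem I i Q.γ
    (fun i _ j _ _ => Q.comm i j) h) f

theorem QData.qDer_γ (Q : QData D A d) (i j : Fin d) (f : A) :
    Q.qDer i (Q.γ j f) = Q.γ j (Q.qDer i f) := by
  refine (mul_cancel_left_mem_nonZeroDivisors Q.regular').mp ?_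
  have h1 : Q.γ i (Q.γ j f) = Q.γ j (Q.γ i f) := AlgEquiv.congr_fun (Q.comm i j) f
  have h2 := congr_arg (Q.γ j) (Q.qDer_spec i f)
  rw [map_mul, AlgEquiv.commutes, map_sub (Q.γ j)] at h2
  rw [Q.qDer_spec, h2, h1]

/-- Needed when a derivative falls on the right factor of a product, which carries the twist `γ_I`.
It comes from the commutation of the `γ_i`, which also fix `q - 1`. -/
theorem QData.qDer_γProd (Q : QData D A d) (i : Fin d) (I : Finset (Fin d)) (f : A) :
    Q.qDer i (Q.γProd I f) = Q.γProd I (Q.qDer i f) := by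
  induction I using Finset.induction_on with
  | empty =>
    have h1 : ∀ g : A, Q.γProd ∅ g = g :=
      AlgEquiv.congr_fun (Finset.noncommProd_empty Q.γ fun i _ j _ _ => Q.comm i j)
    rw [h1, h1]
  | insert j I hj ih => rw [Q.γProd_insert hj, Q.γProd_insert hj, Q.qDer_γ, ih]

theorem QData.coeff_wedge (Q : QData D A d) {k l m : ℕ} (h : k + l = m)
    (ω : QOmega A d k) (η : QOmega A d l) (K : {K : Finset (Fin d) // K.card = m}) :
    QOmega.coeff K.1 (Q.wedge h η ω) = ∑ I ∈ K.1.powerset,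
      sgn A I (K.1 \ I) * (QOmega.coeff I ω * Q.γProd I (QOmega.coeff (K.1 \ I) η)) :=
  QOmega.coeff_apply K _

theorem QData.coeff_dq (Q : QData D A d) {k : ℕ} (ω : QOmega A d k)
    (K : {K : Finset (Fin d) // K.card = k + 1}) :
    QOmega.coeff K.1 (Q.dq k ω) = ∑ i ∈ K.1,
      sgn A {i} (K.1.erase i) * Q.qDer i (QOmega.coeff (K.1.erase i) ω) :=
  QOmega.coeff_apply K _

theorem QData.comp_wedge (Q : QData D A d) {k l m : ℕ} (h : k + l = m) (η : QOmega A d l) (z : N ⊗[A] QOmega A d k)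
    (K : {K : Finset (Fin d) // K.card = m}) :
    QOmega.comp N K.1 ((Q.wedge h η).lTensor N z) = ∑ I ∈ K.1.powerset,
      (sgn A I (K.1 \ I) * Q.γProd I (QOmega.coeff (K.1 \ I) η)) • QOmega.comp N I z := by
  induction z using TensorProduct.induction_on with
  | zero => simp
  | tmul x ω =>
    rw [LinearMap.lTensor_tmul, QOmega.comp_tmul, Q.coeff_wedge, Finset.sum_smul]
    refine Finset.sum_congr rfl fun I _ => ?_
    rw [QOmega.comp_tmul, ← mul_smul]
    congr 1
    ring
  | add y z hy hz =>
    rw [map_add, map_add, hy, hz, ← Finset.sum_add_distrib]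
    simp only [map_add, smul_add]

end Wedge

/-! ### Flat `q`-connections from commuting semilinear operators. -/

section SemiAction

variable {D A : Type*} [CommRing D] [CommRing A] [Algebra D A] {d : ℕ}

/-- Commuting semilinear operators on an `A`-module `N`, over the automorphisms `γ_i` of `A`, with
the operators `der i = (act i - 1) / (q - 1)`. -/
structure QData.SemiAction (Q : QData D A d) (N : Type*) [AddCommGroup N] [Module A N] where
  act : Fin d → AddMonoid.End N
  act_smul : ∀ i (f : A) x, act i (f • x) = Q.γ i f • act i x
  act_comm : ∀ i j x, act i (act j x) = act j (act i x)
  regular : ∀ x : N, algebraMap D A (Q.q - 1) • x = 0 → x = 0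
  der : Fin d → N → N
  der_spec : ∀ i x, algebraMap D A (Q.q - 1) • der i x = act i x - x

namespace QData.SemiAction

variable {Q : QData D A d} {N : Type*} [AddCommGroup N] [Module A N] (T : Q.SemiAction N)

-- The operators `der i` are quotients by `q - 1`, so their identities are verified after
-- multiplication by `q - 1`, where they become identities between the `act i`.
include T in
theorem cancel {x y : N} (h : algebraMap D A (Q.q - 1) • x = algebraMap D A (Q.q - 1) • y) :
    x = y := by
  rw [← sub_eq_zero]
  refine T.regular _ ?_
  rw [smul_sub, h, sub_self]

theorem der_add (i : Fin d) (x y : N) : T.der i (x + y) = T.der i x + T.der i y := by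
  refine T.cancel ?_
  rw [smul_add, T.der_spec, T.der_spec, T.der_spec, map_add]
  abel

/-- This form of the twisted Leibniz rule, with `γ_i` on the scalar, matches the right action on
forms. -/
theorem der_smul (i : Fin d) (f : A) (x : N) :
    T.der i (f • x) = Q.γ i f • T.der i x + Q.qDer i f • x := by
  refine T.cancel ?_
  rw [smul_add, smul_comm, T.der_spec, T.der_spec, T.act_smul, ← mul_smul, Q.qDer_spec]
  rw [smul_sub, sub_smul]
  abel

/-- The twist is moved from the scalar to the vector. Modulo `q - 1`, where `act i` is the identity,
this is the ordinary Leibniz rule, and it serves in that form for quasi-nilpotence. -/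
theorem der_smul' (i : Fin d) (f : A) (x : N) :
    T.der i (f • x) = f • T.der i x + Q.qDer i f • T.act i x := by
  refine T.cancel ?_
  rw [smul_add, smul_comm, T.der_spec, T.der_spec, T.act_smul, ← mul_smul, Q.qDer_spec]
  rw [smul_sub, sub_smul]
  abel

theorem der_smul_algebraMap (i : Fin d) (a : D) (x : N) :
    T.der i (algebraMap D A a • x) = algebraMap D A a • T.der i x := by
  refine T.cancel ?_
  rw [smul_comm, T.der_spec, T.der_spec, T.act_smul, AlgEquiv.commutes, smul_sub]

theorem der_sgn_smul (i : Fin d) (I J : Finset (Fin d)) (x : N) :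
    T.der i (sgn A I J • x) = sgn A I J • T.der i x := by
  have h : sgn A I J = algebraMap D A (sgn D I J) := by
    rw [sgn, sgn, map_pow, map_neg, map_one]
  rw [h, T.der_smul_algebraMap]

/-- Multiplied by `(q - 1)^2`, both sides become `(γ_i - 1)(γ_j - 1)`, which is symmetric; hence the
two cancellations. -/
theorem der_comm (i j : Fin d) (x : N) : T.der i (T.der j x) = T.der j (T.der i x) := by
  refine T.cancel (T.cancel ?_)
  have key : ∀ i j, algebraMap D A (Q.q - 1) • algebraMap D A (Q.q - 1) • T.der i (T.der j x) =
      T.act i (T.act j x) - T.act i x - T.act j x + x := by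
    intro i j
    rw [← T.der_smul_algebraMap, T.der_spec, T.der_spec, map_sub]
    abel
  rw [key, key, T.act_comm]
  abel

/-- `der i` as an additive map. -/
noncomputable def derHom (i : Fin d) : N →+ N := AddMonoidHom.mk' (T.der i) (T.der_add i)

theorem derHom_apply (i : Fin d) (x : N) : T.derHom i x = T.der i x := rfl

variable [Module D N] [IsScalarTower D A N]

/-- The `q`-connection `x ↦ ∑ i, der i x ⊗ dlog(U_i)`. -/
noncomputable def connection : QConnection Q N where
  toLin :=
    { toFun := fun x => ∑ i, T.der i x ⊗ₜ[A] QOmega.dlog i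
      map_add' := fun x y => by
        simp only [T.der_add, TensorProduct.add_tmul, Finset.sum_add_distrib]
      map_smul' := fun a x => by
        rw [RingHom.id_apply, ← algebraMap_smul A a x, ← algebraMap_smul A a (∑ i, _),
          Finset.smul_sum]
        simp only [T.der_smul_algebraMap, TensorProduct.smul_tmul'] }
  leibniz x f := by
    have h1 : ∀ i, Q.rmul f (QOmega.dlog i) = Q.γ i f • (QOmega.dlog i : QOmega A d 1) := by
      intro i
      ext I
      change (QOmega.dlog i : QOmega A d 1) I * Q.γProd I.1 f = Q.γ i f * (QOmega.dlog i : QOmega A d 1) I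
      rw [QOmega.dlog, Pi.single_apply]
      split_ifs with h
      · rw [h, Q.γProd_singleton, mul_comm]
      · rw [zero_mul, mul_zero]
    change ∑ i, T.der i (f • x) ⊗ₜ[A] QOmega.dlog i =
      (Q.rmul f).lTensor N (∑ i, T.der i x ⊗ₜ[A] QOmega.dlog i) + _
    simp only [map_sum, LinearMap.lTensor_tmul, h1, T.der_smul, QData.dZero,
      TensorProduct.tmul_sum, TensorProduct.add_tmul, Finset.sum_add_distrib,
      TensorProduct.tmul_smul, TensorProduct.smul_tmul']

theorem connection_apply (x : N) :
    T.connection.toLin x = ∑ i, T.der i x ⊗ₜ[A] QOmega.dlog i := rfl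

/-- The extension of the `q`-connection to forms of all degrees. -/
noncomputable def extend (k : ℕ) : N ⊗[A] QOmega A d k →ₗ[D] N ⊗[A] QOmega A d (k + 1) where
  toFun z := QOmega.ofComp fun K => ∑ i ∈ K.1,
    sgn A {i} (K.1.erase i) • T.der i (QOmega.comp N (K.1.erase i) z)
  map_add' z w := by
    rw [← map_add]
    congr 1
    ext K
    simp only [map_add, T.der_add, smul_add, Finset.sum_add_distrib, Pi.add_apply]
  map_smul' a z := by
    rw [RingHom.id_apply, ← algebraMap_smul A a z, ← algebraMap_smul A a (QOmega.ofComp _),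
      ← map_smul]
    congr 1
    ext K
    simp only [map_smul, T.der_smul_algebraMap, Pi.smul_apply, Finset.smul_sum]
    exact Finset.sum_congr rfl fun i _ => smul_comm _ _ _

theorem comp_extend {k : ℕ} (z : N ⊗[A] QOmega A d k)
    (K : {K : Finset (Fin d) // K.card = k + 1}) :
    QOmega.comp N K.1 (T.extend k z) =
      ∑ i ∈ K.1, sgn A {i} (K.1.erase i) • T.der i (QOmega.comp N (K.1.erase i) z) :=
  QOmega.comp_ofComp _ K

theorem extend_zero (x : N) : T.extend 0 (x ⊗ₜ[A] fun _ => 1) = T.connection.toLin x := by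
  refine QOmega.comp_ext fun K => ?_
  obtain ⟨i, rfl⟩ := QOmega.exists_eq_singleton K
  rw [T.comp_extend, T.connection_apply, map_sum, Finset.sum_singleton, Finset.sum_eq_single i]
  · rw [QOmega.comp_tmul, QOmega.comp_tmul, QOmega.coeff_dlog, if_pos rfl, one_smul]
    have h1 : ({i} : Finset (Fin d)).erase i = ∅ := by simp
    simp only [h1]
    rw [sgn_empty_right, one_smul, QOmega.coeff_apply ⟨∅, Finset.card_empty⟩, one_smul]
  · intro j _ hj
    rw [QOmega.comp_tmul, QOmega.coeff_dlog, if_neg, zero_smul]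
    intro h
    exact hj (Finset.singleton_injective h).symm
  · simp

/-- A coefficient of the square is a sum over ordered pairs of distinct indices of second
derivatives, which are symmetric in the pair while the sign is antisymmetric. -/
theorem extend_extend (k : ℕ) (z : N ⊗[A] QOmega A d k) :
    T.extend (k + 1) (T.extend k z) = 0 := by
  refine QOmega.comp_ext fun K => ?_
  rw [T.comp_extend, map_zero]
  have h1 : ∀ i ∈ K.1, sgn A {i} (K.1.erase i) •
      T.der i (QOmega.comp N (K.1.erase i) (T.extend k z)) =
      ∑ j ∈ K.1.erase i, (sgn A {i} (K.1.erase i) * sgn A {j} ((K.1.erase i).erase j)) •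
        T.der i (T.der j (QOmega.comp N ((K.1.erase i).erase j) z)) := by
    intro i hi
    have hc : (K.1.erase i).card = k + 1 := by
      rw [Finset.card_erase_of_mem hi, K.2, Nat.add_sub_cancel]
    rw [T.comp_extend z ⟨_, hc⟩, ← T.derHom_apply, map_sum, Finset.smul_sum]
    refine Finset.sum_congr rfl fun j _ => ?_
    rw [T.derHom_apply, mul_smul]
    congr 1
    exact T.der_sgn_smul i _ _ _
  rw [Finset.sum_congr rfl h1, Finset.sum_sigma']
  -- The involution exchanges the order in which `i` and `j` are removed; it has no fixed point
  -- since `i ≠ j`.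
  refine Finset.sum_involution (fun t _ => ⟨t.2, t.1⟩) ?_ ?_ ?_ ?_
  · rintro ⟨i, j⟩ h
    simp only [Finset.mem_sigma, Finset.mem_erase] at h
    obtain ⟨hi, hji, hj⟩ := h
    simp only
    rw [Finset.erase_right_comm (a := j), T.der_comm j i, ← add_smul]
    set L := (K.1.erase i).erase j with hL
    have hiL : i ∉ L := by simp [hL]
    have hjL : j ∉ L := by simp [hL]
    have e1 : K.1.erase i = {j} ∪ L := by
      ext t
      simp only [hL, Finset.mem_erase, Finset.mem_union, Finset.mem_singleton]
      by_cases h : t = j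
      · subst h; simp [hji, hj]
      · simp [h]
    have e2 : K.1.erase j = {i} ∪ L := by
      ext t
      simp only [hL, Finset.mem_erase, Finset.mem_union, Finset.mem_singleton]
      by_cases h : t = i
      · subst h; simp [hji.symm, hi]
      · simp [h]
    have e3 := sgn_mul_sgn_swap (A := A) (I := {i}) (J := {j}) (by simpa using hji.symm)
    rw [Finset.card_singleton, Finset.card_singleton, mul_one, pow_one] at e3
    -- With `L = K \ {i, j}`, both products contain `sgn {i} L * sgn {j} L`; the remaining factors
    -- `sgn {i} {j}` and `sgn {j} {i}` are opposite.
    have e4 : sgn A {i} (K.1.erase i) * sgn A {j} L + sgn A {j} (K.1.erase j) * sgn A {i} L = 0 := by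
      rw [e1, e2, sgn_union_right (by simpa using hjL), sgn_union_right (by simpa using hiL)]
      have e5 := sgn_mul_self (A := A) {i} {j}
      have e6 : sgn A {j} {i} = - sgn A {i} {j} := by
        calc sgn A {j} {i} = (sgn A {i} {j} * sgn A {i} {j}) * sgn A {j} {i} := by rw [e5, one_mul]
          _ = sgn A {i} {j} * (sgn A {i} {j} * sgn A {j} {i}) := by ring
          _ = _ := by rw [e3]; ring
      rw [e6]
      ring
    rw [e4, zero_smul]
  · rintro ⟨i, j⟩ h _ h2
    simp only [Finset.mem_sigma, Finset.mem_erase] at h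
    exact h.2.1 (congr_arg Sigma.fst h2)
  · rintro ⟨i, j⟩ h
    simp only [Finset.mem_sigma, Finset.mem_erase] at h ⊢
    exact ⟨h.2.2, h.2.1.symm, h.1⟩
  · rintro ⟨i, j⟩ h
    rfl

/-- The twisted Leibniz rule splits a derivative of `γ_I(ω'_J) • z_I` in two. The terms in which
`z_I` is differentiated carry `γ_i γ_I = γ_{I ∪ {i}}` and assemble to `E(z) · ω'`. The terms in
which `ω'_J` is differentiated assemble to `z · d_q ω'`, and moving `dlog(U_i)` past the `k` factors
of `dlog(U_I)` produces the sign `(-1)^k`. -/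
theorem extend_leibniz (k l m : ℕ) (h : k + l = m) (x : N) (ω : QOmega A d k)
    (ω' : QOmega A d l) :
    T.extend m ((Q.wedge h ω').lTensor N (x ⊗ₜ[A] ω)) =
      (Q.wedge (show k + 1 + l = m + 1 by omega) ω').lTensor N (T.extend k (x ⊗ₜ[A] ω)) +
      (-1 : A) ^ k • (Q.wedge (show k + (l + 1) = m + 1 by omega) (Q.dq l ω')).lTensor N
        (x ⊗ₜ[A] ω) := by
  refine QOmega.comp_ext fun K => ?_
  set z := x ⊗ₜ[A] ω with hz
  have hcard : ∀ i ∈ K.1, (K.1.erase i).card = m := by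
    intro i hi
    rw [Finset.card_erase_of_mem hi, K.2, Nat.add_sub_cancel]
  -- all three terms are sums over `i ∈ K` and `I ⊆ K \ {i}`
  have e1 : QOmega.comp N K.1 (T.extend m ((Q.wedge h ω').lTensor N z)) =
      ∑ i ∈ K.1, ∑ I ∈ (K.1.erase i).powerset,
        ((sgn A {i} (K.1.erase i) * sgn A I (K.1.erase i \ I) *
          Q.γ i (Q.γProd I (QOmega.coeff (K.1.erase i \ I) ω'))) • T.der i (QOmega.comp N I z) +
        (sgn A {i} (K.1.erase i) * sgn A I (K.1.erase i \ I) *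
          Q.γProd I (Q.qDer i (QOmega.coeff (K.1.erase i \ I) ω'))) • QOmega.comp N I z) := by
    rw [T.comp_extend]
    refine Finset.sum_congr rfl fun i hi => ?_
    rw [Q.comp_wedge h ω' z ⟨_, hcard i hi⟩, ← T.derHom_apply, map_sum, Finset.smul_sum]
    refine Finset.sum_congr rfl fun I _ => ?_
    rw [T.derHom_apply, mul_smul, T.der_sgn_smul, T.der_smul, Q.qDer_γProd, smul_add, smul_add,
      mul_smul, mul_smul, mul_smul, mul_smul]
  have e2 : QOmega.comp N K.1 ((Q.wedge (show k + 1 + l = m + 1 by omega) ω').lTensor N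
      (T.extend k z)) = ∑ i ∈ K.1, ∑ I ∈ (K.1.erase i).powerset,
        (sgn A {i} (K.1.erase i) * sgn A I (K.1.erase i \ I) *
          Q.γ i (Q.γProd I (QOmega.coeff (K.1.erase i \ I) ω'))) •
            T.der i (QOmega.comp N I z) := by
    rw [Q.comp_wedge]
    have h1 : ∀ I ∈ K.1.powerset,
        (sgn A I (K.1 \ I) * Q.γProd I (QOmega.coeff (K.1 \ I) ω')) •
          QOmega.comp N I (T.extend k z) =
        ∑ i ∈ I, (sgn A I (K.1 \ I) * Q.γProd I (QOmega.coeff (K.1 \ I) ω') *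
          sgn A {i} (I.erase i)) • T.der i (QOmega.comp N (I.erase i) z) := by
      intro I _
      by_cases hI : I.card = k + 1
      · rw [T.comp_extend z ⟨I, hI⟩, Finset.smul_sum]
        exact Finset.sum_congr rfl fun i _ => (mul_smul _ _ _).symm
      -- Off degree `k + 1` the left side is zero by default, and so is each term on the right,
      -- since `I \ {i}` does not have `k` elements.
      · rw [QOmega.comp_of_ne hI, smul_zero]
        symm
        refine Finset.sum_eq_zero fun i hi => ?_
        rw [QOmega.comp_of_ne (k := k), ← T.derHom_apply, map_zero, smul_zero]
        rw [Finset.card_erase_of_mem hi]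
        have := Finset.card_pos.mpr ⟨i, hi⟩
        omega
    rw [Finset.sum_congr rfl h1, Finset.sum_sigma', Finset.sum_sigma']
    -- Choosing a subset of `K` and then an element `i` of it amounts to choosing `i` in `K` and
    -- then a subset of `K \ {i}`.
    refine Finset.sum_bij' (fun t _ => ⟨t.2, t.1.erase t.2⟩) (fun t _ => ⟨insert t.1 t.2, t.1⟩)
      ?_ ?_ ?_ ?_ ?_
    · rintro ⟨I, i⟩ ht
      simp only [Finset.mem_sigma, Finset.mem_powerset] at ht ⊢
      exact ⟨ht.1 ht.2, Finset.erase_subset_erase _ ht.1⟩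
    · rintro ⟨i, I⟩ ht
      simp only [Finset.mem_sigma, Finset.mem_powerset] at ht ⊢
      exact ⟨Finset.insert_subset ht.1 (ht.2.trans (Finset.erase_subset _ _)),
        Finset.mem_insert_self _ _⟩
    · rintro ⟨I, i⟩ ht
      simp only [Finset.mem_sigma, Finset.mem_powerset] at ht
      simp only [Finset.insert_erase ht.2]
    · rintro ⟨i, I⟩ ht
      simp only [Finset.mem_sigma, Finset.mem_powerset] at ht
      have : i ∉ I := fun hi => Finset.notMem_erase i K.1 (ht.2 hi)
      simp only [Finset.erase_insert this]
    · rintro ⟨I, i⟩ ht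
      simp only [Finset.mem_sigma, Finset.mem_powerset] at ht
      obtain ⟨hIK, hi⟩ := ht
      simp only
      obtain ⟨I', hiI', rfl⟩ : ∃ I', i ∉ I' ∧ insert i I' = I :=
        ⟨I.erase i, Finset.notMem_erase _ _, Finset.insert_erase hi⟩
      rw [Finset.erase_insert hiI']
      have hJ : K.1.erase i \ I' = K.1 \ insert i I' := by
        ext t
        simp only [Finset.mem_sdiff, Finset.mem_erase, Finset.mem_insert]
        tauto
      have hK : K.1.erase i = I' ∪ (K.1 \ insert i I') := by
        ext t
        simp only [Finset.mem_sdiff, Finset.mem_erase, Finset.mem_insert, Finset.mem_union]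
        constructor
        · tauto
        · rintro (h | h)
          · exact ⟨fun h' => hiI' (h' ▸ h), hIK (Finset.mem_insert_of_mem h)⟩
          · tauto
      have hd : Disjoint I' (K.1 \ insert i I') :=
        Finset.disjoint_sdiff.mono_left (Finset.subset_insert _ _)
      -- With `J = K \ (I' ∪ {i})`, both signs expand to `sgn {i} I' * sgn {i} J * sgn I' J`.
      rw [hJ, hK, Q.γProd_insert hiI', sgn_union_right hd, Finset.insert_eq,
        sgn_union_left (by simpa using hiI')]
      congr 1
      ring
  have e3 : QOmega.comp N K.1 ((-1 : A) ^ k •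
      (Q.wedge (show k + (l + 1) = m + 1 by omega) (Q.dq l ω')).lTensor N z) =
      ∑ i ∈ K.1, ∑ I ∈ (K.1.erase i).powerset,
        (sgn A {i} (K.1.erase i) * sgn A I (K.1.erase i \ I) *
          Q.γProd I (Q.qDer i (QOmega.coeff (K.1.erase i \ I) ω'))) • QOmega.comp N I z := by
    rw [map_smul, Q.comp_wedge, Finset.smul_sum]
    have h1 : ∀ I ∈ K.1.powerset, (-1 : A) ^ k •
        (sgn A I (K.1 \ I) * Q.γProd I (QOmega.coeff (K.1 \ I) (Q.dq l ω'))) •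
          QOmega.comp N I z = ∑ i ∈ K.1 \ I,
        (sgn A {i} (K.1.erase i) * sgn A I (K.1.erase i \ I) *
          Q.γProd I (Q.qDer i (QOmega.coeff (K.1.erase i \ I) ω'))) • QOmega.comp N I z := by
      intro I hI
      by_cases hk : I.card = k
      · have hc : (K.1 \ I).card = l + 1 := by
          rw [Finset.card_sdiff_of_subset (Finset.mem_powerset.mp hI), hk, K.2]
          omega
        rw [Q.coeff_dq ω' ⟨_, hc⟩, map_sum, ← mul_smul, Finset.mul_sum, Finset.mul_sum,
          Finset.sum_smul]
        refine Finset.sum_congr rfl fun i hi => ?_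
        congr 1
        rw [Finset.mem_sdiff] at hi
        set J := (K.1 \ I).erase i with hJ
        have hJ' : K.1.erase i \ I = J := by rw [hJ, Finset.erase_sdiff_comm]
        have hiI : i ∉ I := hi.2
        have hK : K.1.erase i = I ∪ J := by
          ext t
          rw [← hJ']
          simp only [Finset.mem_union, Finset.mem_sdiff, Finset.mem_erase]
          constructor
          · tauto
          · rintro (h | h)
            · exact ⟨fun h' => hiI (h' ▸ h), (Finset.mem_powerset.mp hI) h⟩
            · tauto
        have hKI : K.1 \ I = {i} ∪ J := by
          rw [hJ, ← Finset.insert_eq, Finset.insert_erase (Finset.mem_sdiff.mpr hi)]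
        have hd : Disjoint I J := Finset.disjoint_sdiff.mono_right (Finset.erase_subset _ _)
        have hiJ : i ∉ J := Finset.notMem_erase _ _
        rw [hJ', hK, hKI, sgn_union_right hd, sgn_union_right (by simpa using hiJ), map_mul]
        -- The sign of `d_q ω'` passes through `γ_I` unchanged. The factor `(-1)^k` is written as
        -- `sgn {i} I * sgn I {i}`, and the second factor cancels the `sgn I {i}` coming from `sgn I
        -- ({i} ∪ J)`.
        have e4 : Q.γProd I (sgn A {i} J) = sgn A {i} J := by
          rw [sgn, map_pow, map_neg, map_one]
        have e5 := sgn_mul_sgn_swap (A := A) (I := {i}) (J := I) (by simpa using hiI)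
        rw [Finset.card_singleton, one_mul, hk] at e5
        have e6 := sgn_mul_self (A := A) I {i}
        rw [e4, ← e5]
        linear_combination (sgn A {i} I * sgn A I J * sgn A {i} J *
          Q.γProd I (Q.qDer i (QOmega.coeff J ω'))) * e6
      · rw [QOmega.comp_of_ne hk]
        simp
    rw [Finset.sum_congr rfl h1, Finset.sum_sigma', Finset.sum_sigma']
    -- The double sum is reordered: `I ⊆ K` with `i ∈ K \ I` is the same as `i ∈ K` with `I ⊆ K \
    -- {i}`.
    refine Finset.sum_bij' (fun t _ => ⟨t.2, t.1⟩) (fun t _ => ⟨t.2, t.1⟩) ?_ ?_ ?_ ?_ ?_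
    · rintro ⟨I, i⟩ ht
      simp only [Finset.mem_sigma, Finset.mem_powerset, Finset.mem_sdiff] at ht ⊢
      exact ⟨ht.2.1, Finset.subset_erase.mpr ⟨ht.1, ht.2.2⟩⟩
    · rintro ⟨i, I⟩ ht
      simp only [Finset.mem_sigma, Finset.mem_powerset, Finset.mem_sdiff,
        Finset.subset_erase] at ht ⊢
      exact ⟨ht.2.1, ht.1, ht.2.2⟩
    · simp
    · simp
    · simp
  rw [map_add, e1, e2, e3, ← Finset.sum_add_distrib]
  exact Finset.sum_congr rfl fun i _ => Finset.sum_add_distrib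

theorem connection_isFlat : T.connection.IsFlat :=
  ⟨T.extend, T.extend_zero, T.extend_leibniz, T.extend_extend⟩

end QData.SemiAction
end SemiAction

/-! ### A nilpotence criterion, and iterates of a derivation modulo `p`. -/

section Nilpotence

/-- Criterion for the quasi-nilpotence of a connection-like operator `∂` on a `p`-torsion free
module: up to bounded powers of `p`, the module is spanned by a set `Y` with `∂ Y ⊆ p Y`. -/
theorem exists_iterate_eq_pow_smul {A M : Type*} [CommRing A] [AddCommGroup M] [Module A M] (p : ℕ)
    (δ : A → A) (T : M →+ M) (hT : ∀ (f : A) (m : M), T (f • m) = δ f • m + f • T m)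
    (Y : Set M) (hY : ∀ y ∈ Y, ∃ y' ∈ Submodule.span A Y, T y = (p : A) • y')
    (hδ : ∀ f, ∃ g : A, ∀ m : M, δ^[p] f • m = (p : A) • g • m)
    (hp : ∀ m : M, (p : A) • m = 0 → m = 0) (h : ℕ)
    (hspan : ∀ m : M, (p : A) ^ h • m ∈ Submodule.span A Y) (x : M) (m : ℕ) :
    ∃ n₀ : ℕ, ∀ n ≥ n₀, ∃ y, T^[n] x = (p : A) ^ m • y := by
  have hspan_T : ∀ m ∈ Submodule.span A Y, T m ∈ Submodule.span A Y := by
    intro m hm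
    induction hm using Submodule.span_induction with
    | mem y hy =>
      obtain ⟨y', hy', h1⟩ := hY y hy
      rw [h1]
      exact Submodule.smul_mem _ _ hy'
    | zero => rw [map_zero]; exact zero_mem _
    | add a b _ _ ha hb => rw [map_add]; exact add_mem ha hb
    | smul f a ha ha' =>
      rw [hT]
      exact add_mem (Submodule.smul_mem _ _ ha) (Submodule.smul_mem _ _ ha')
  have hTp : ∀ m, T ((p : A) • m) = (p : A) • T m := by
    intro m
    rw [Nat.cast_smul_eq_nsmul, map_nsmul, Nat.cast_smul_eq_nsmul]
  have hTpow : ∀ j m, T ((p : A) ^ j • m) = (p : A) ^ j • T m := by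
    intro j m
    rw [← Nat.cast_pow, Nat.cast_smul_eq_nsmul, map_nsmul, Nat.cast_smul_eq_nsmul]
  have hTpow' : ∀ n j m, T^[n] ((p : A) ^ j • m) = (p : A) ^ j • T^[n] m := by
    intro n j m
    induction n generalizing m with
    | zero => rfl
    | succ n ih => rw [Function.iterate_succ_apply, hTpow, ih, Function.iterate_succ_apply]
  -- Up to `p` times the span, all derivatives of `f • y` fall on `f`, because one that hits `y`
  -- already produces a factor `p`.
  have hgen : ∀ (k : ℕ) (f : A), ∀ y ∈ Y, ∃ w ∈ Submodule.span A Y,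
      T^[k] (f • y) = δ^[k] f • y + (p : A) • w := by
    intro k f y hy
    induction k with
    | zero => exact ⟨0, zero_mem _, by simp⟩
    | succ k ih =>
      obtain ⟨w, hw, h1⟩ := ih
      obtain ⟨y', hy', h2⟩ := hY y hy
      refine ⟨δ^[k] f • y' + T w, add_mem (Submodule.smul_mem _ _ hy')
        (hspan_T w hw), ?_⟩
      rw [Function.iterate_succ_apply', h1, map_add, hT, hTp, h2, Function.iterate_succ_apply',
        smul_add, smul_comm (δ^[k] f), add_assoc]
  have hiter_add : ∀ k a b, T^[k] (a + b) = T^[k] a + T^[k] b := by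
    intro k a b
    induction k generalizing a b with
    | zero => rfl
    | succ k ih => rw [Function.iterate_succ_apply, map_add, ih]; rfl
  -- The induction runs over sums of multiples `f • y`, as `T^[p]` is additive but not linear. The
  -- main term `δ^[p] f • y` is divisible by `p` by `hδ`.
  have hstep : ∀ m ∈ Submodule.span A Y, ∃ w ∈ Submodule.span A Y, T^[p] m = (p : A) • w := by
    intro m hm
    induction hm using Submodule.closure_induction with
    | zero => exact ⟨0, zero_mem _, by rw [smul_zero, iterate_map_zero]⟩
    | add a b _ _ ha hb =>
      obtain ⟨v, hv, h1⟩ := ha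
      obtain ⟨w, hw, h2⟩ := hb
      exact ⟨v + w, add_mem hv hw, by rw [hiter_add, h1, h2, smul_add]⟩
    | smul_mem f y hy =>
      obtain ⟨w, hw, h1⟩ := hgen p f y hy
      obtain ⟨g, hg⟩ := hδ f
      refine ⟨g • y + w, add_mem (Submodule.smul_mem _ _ (Submodule.subset_span hy)) hw, ?_⟩
      rw [h1, hg, smul_add]
  have hiter : ∀ (j : ℕ), ∀ m ∈ Submodule.span A Y, ∃ w ∈ Submodule.span A Y,
      T^[p * j] m = (p : A) ^ j • w := by
    intro j m hm
    induction j with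
    | zero => exact ⟨m, hm, by simp⟩
    | succ j ih =>
      obtain ⟨w, hw, h1⟩ := ih
      obtain ⟨v, hv, h2⟩ := hstep w hw
      refine ⟨v, hv, ?_⟩
      rw [Nat.mul_succ, Nat.add_comm, Function.iterate_add_apply, h1, hTpow', h2, ← mul_smul,
        pow_succ]
  -- Each block of `p` iterations gains one factor `p`. Besides the `m` factors wanted, `h` more are
  -- needed, since only `p ^ h • x` is known to lie in the span and `p ^ h` has to be divided out at
  -- the end.
  refine ⟨p * (m + h), fun n hn => ?_⟩
  obtain ⟨w, -, hw⟩ := hiter (m + h) _ (hspan x)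
  obtain ⟨t, rfl⟩ := Nat.exists_eq_add_of_le hn
  refine ⟨T^[t] w, ?_⟩
  have hpow : ∀ (j : ℕ) (z : M), (p : A) ^ j • z = 0 → z = 0 := by
    intro j z hz
    induction j with
    | zero => simpa using hz
    | succ j ih => rw [pow_succ', mul_smul] at hz; exact ih (hp _ hz)
  rw [← sub_eq_zero]
  refine hpow h _ ?_
  rw [smul_sub, ← hTpow', Nat.add_comm, Function.iterate_add_apply, hw, hTpow', ← mul_smul,
    ← pow_add, Nat.add_comm h, sub_self]

/-- Leibniz rule for the iterates of a derivation. -/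
theorem iterate_leibniz {R : Type*} [CommRing R] (T : R →+ R)
    (hT : ∀ a b, T (a * b) = T a * b + a * T b) (n : ℕ) (a b : R) :
    T^[n] (a * b) =
      ∑ ij ∈ Finset.HasAntidiagonal.antidiagonal n, (n.choose ij.1 : R) * (T^[ij.1] a * T^[ij.2] b) := by
  induction n with
  | zero => simp
  | succ n ih =>
    rw [Finset.sum_antidiagonal_choose_succ_mul (fun i j => T^[i] a * T^[j] b) n,
      Function.iterate_succ_apply', ih, map_sum, ← Finset.sum_add_distrib]
    refine Finset.sum_congr rfl fun ij hij => ?_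
    rw [Nat.choose_symm_of_eq_add (Finset.HasAntidiagonal.mem_antidiagonal.mp hij).symm,
      ← nsmul_eq_mul, map_nsmul, hT, nsmul_eq_mul, Function.iterate_succ_apply',
      Function.iterate_succ_apply']
    have : T^[ij.1 + 1] a = T (T^[ij.1] a) := Function.iterate_succ_apply' _ _ _
    ring

/-- The `p`-th iterate of a derivation is a derivation modulo `p`. -/
theorem dvd_iterate_leibniz {R : Type*} [CommRing R] {p : ℕ} (hp : p.Prime) (T : R →+ R)
    (hT : ∀ a b, T (a * b) = T a * b + a * T b) (a b : R) :
    (p : R) ∣ T^[p] (a * b) - (T^[p] a * b + a * T^[p] b) := by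
  obtain ⟨m, rfl⟩ := Nat.exists_eq_succ_of_ne_zero hp.ne_zero
  rw [iterate_leibniz T hT, Finset.Nat.sum_antidiagonal_eq_sum_range_succ
    (fun i j => ((m.succ.choose i : ℕ) : R) * (T^[i] a * T^[j] b)), Finset.sum_range_succ,
    Finset.sum_range_succ']
  simp only [Nat.choose_self, Nat.choose_zero_right, Nat.cast_one, one_mul, Nat.sub_self,
    Nat.sub_zero, Function.iterate_zero, id_eq]
  -- The two extreme terms of the Leibniz formula are the derivation terms; what remains has the
  -- binomial coefficients strictly between, all divisible by `p`.
  rw [show ∀ x y z : R, x + y + z - (z + y) = x from fun x y z => by ring]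
  refine Finset.dvd_sum fun k hk => ?_
  refine (Nat.cast_dvd_cast ?_).mul_right _
  rw [Finset.mem_range] at hk
  exact hp.dvd_choose_self (Nat.succ_ne_zero k) (by omega)

end Nilpotence

/-! ### Derivations modulo an ideal on unramified algebras. -/

section Unramified

/-- A derivation modulo an ideal vanishes modulo that ideal on a formally unramified algebra if it
does so on the base. -/
theorem mem_of_formallyUnramified {R₀ S R : Type*} [CommRing R₀] [CommRing S] [CommRing R]
    [Algebra R₀ S] [Algebra.FormallyUnramified R₀ S] (i : S →+* R) (J : Ideal R) (T : R →+ R)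
    (hT : ∀ a b, T (a * b) - (T a * b + a * T b) ∈ J) (h0 : ∀ r, T (i (algebraMap R₀ S r)) ∈ J)
    (s : S) : T (i s) ∈ J := by
  let _ : Algebra S (R ⧸ J) := ((Ideal.Quotient.mk J).comp i).toAlgebra
  let _ : Algebra R₀ (R ⧸ J) :=
    (((Ideal.Quotient.mk J).comp i).comp (algebraMap R₀ S)).toAlgebra
  have : IsScalarTower R₀ S (R ⧸ J) := IsScalarTower.of_algebraMap_eq fun _ => rfl
  have hmul : ∀ a b, Ideal.Quotient.mk J (T (a * b)) = Ideal.Quotient.mk J (T a) *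
      Ideal.Quotient.mk J b + Ideal.Quotient.mk J a * Ideal.Quotient.mk J (T b) := by
    intro a b
    rw [← map_mul, ← map_mul, ← map_add, Ideal.Quotient.mk_eq_mk_iff_sub_mem]
    exact hT a b
  have hr : ∀ r, Ideal.Quotient.mk J (T (i (algebraMap R₀ S r))) = 0 := fun r =>
    Ideal.Quotient.eq_zero_iff_mem.mpr (h0 r)
  -- The map `T`, which need not be a derivation, becomes one modulo `J`; vanishing on the base
  -- modulo `J` makes it `R₀`-linear.
  let δ : Derivation R₀ S (R ⧸ J) := Derivation.mk'
    { toFun := fun s => Ideal.Quotient.mk J (T (i s))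
      map_add' := fun s t => by simp only [map_add]
      map_smul' := fun r s => by
        rw [Algebra.smul_def, map_mul, hmul, hr, zero_mul, zero_add]
        rfl }
    (fun s t => by
      change Ideal.Quotient.mk J (T (i (s * t))) =
        Ideal.Quotient.mk J (i s) * Ideal.Quotient.mk J (T (i t)) +
        Ideal.Quotient.mk J (i t) * Ideal.Quotient.mk J (T (i s))
      rw [map_mul, hmul]
      ring)
  have h1 : δ = 0 := by
    -- The derivation factors through the Kähler differentials, which vanish for a formally
    -- unramified algebra.
    have h2 : δ.liftKaehlerDifferential = 0 := by
      refine LinearMap.ext fun x => ?_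
      rw [Subsingleton.elim x 0, map_zero, map_zero]
    rw [← δ.liftKaehlerDifferential_comp, h2]
    ext
    rfl
  rw [← Ideal.Quotient.eq_zero_iff_mem]
  exact DFunLike.congr_fun h1 s

/-- Among `p` consecutive integers one is divisible by `p`: the factor whose index is the residue of
`n` modulo `p`. -/
theorem dvd_prod_range_sub {p : ℕ} (hp : p.Prime) (n : ℤ) :
    (p : ℤ) ∣ ∏ j ∈ Finset.range p, (n - j) := by
  have hp0 : (p : ℤ) ≠ 0 := by exact_mod_cast hp.ne_zero
  have h1 := Int.emod_nonneg n hp0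
  have h2 := Int.emod_lt_of_pos n (b := (p : ℤ)) (by exact_mod_cast hp.pos)
  have h3 : (n % p).toNat ∈ Finset.range p := by
    rw [Finset.mem_range]
    omega
  refine dvd_trans ?_ (Finset.dvd_prod_of_mem _ h3)
  rw [Int.toNat_of_nonneg h1]
  exact Int.dvd_self_sub_emod

end Unramified

/-! ### Iterates of `∂/∂U_i` on `A_R^+`. -/

section CoordinateDerivation

variable {p : ℕ} [Fact p.Prime] {κ : Type*} [Field κ] [CharP κ p] {d : ℕ}
variable {S : Type*} [CommRing S] [Algebra (RSquare p κ d) S]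

/-- A derivation `T` of `R` with `T (w X ^ n) = n_i w X ^ (n - e_i)` satisfies `T ^ p = 0` modulo
`p`. -/
theorem dvd_iterate_of_map_mono [Algebra.Etale (RSquare p κ d) S] (i : Fin d)
    (T : PCompl p S →+ PCompl p S) (hT : ∀ a b, T (a * b) = T a * b + a * T b)
    (hmono : ∀ n w, T (mono p κ d S n w) =
      ((n i : ℤ) : PCompl p S) * mono p κ d S (n - Pi.single i 1) w) (a : PCompl p S) :
    (p : PCompl p S) ∣ T^[p] a := by
  have hp : p.Prime := Fact.out
  have hTint : ∀ (k : ℤ) a, T (k * a) = k * T a := by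
    intro k a
    rw [← zsmul_eq_mul, map_zsmul, zsmul_eq_mul]
  have hiter : ∀ k n w, T^[k] (mono p κ d S n w) =
      ((∏ j ∈ Finset.range k, (n i - j) : ℤ) : PCompl p S) *
        mono p κ d S (n - k • Pi.single i 1) w := by
    intro k n w
    induction k with
    | zero => simp
    | succ k ih =>
      rw [Function.iterate_succ_apply', ih, hTint, hmono, Finset.prod_range_succ, Int.cast_mul,
        mul_assoc, succ_nsmul, sub_sub]
      simp
  have hpT : ∀ k a, T^[k] ((p : PCompl p S) * a) = p * T^[k] a := by
    intro k a
    induction k generalizing a with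
    | zero => rfl
    | succ k ih =>
      have := hTint p a
      rw [Int.cast_natCast] at this
      rw [Function.iterate_succ_apply, this, ih]
      rfl
  have hadd : ∀ k a b, T^[k] (a + b) = T^[k] a + T^[k] b := by
    intro k a b
    induction k generalizing a b with
    | zero => rfl
    | succ k ih => rw [Function.iterate_succ_apply, map_add, ih]; rfl
  let Tp : PCompl p S →+ PCompl p S := AddMonoidHom.mk' (T^[p]) (hadd p)
  -- `T^[p]` preserves multiples of `p`, so the claim depends only on the class modulo `p`, and
  -- density of the subrings modulo `p^1` suffices.
  have happrox : ∀ {a b c : PCompl p S}, a - b = (p : PCompl p S) ^ 1 * c →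
      (p : PCompl p S) ∣ T^[p] b → (p : PCompl p S) ∣ T^[p] a := by
    intro a b c h hb
    rw [pow_one] at h
    rw [← sub_add_cancel a b, h, hadd, hpT]
    exact dvd_add (dvd_mul_right _ _) hb
  -- On a monomial the coefficient of `T^[p]` is the product of the `p` consecutive integers `n_i,
  -- n_i - 1, …`.
  have hlaurent : ∀ l : Laurent p κ d, (p : PCompl p S) ∣ T^[p] (ofLaurent p κ d S l) := by
    intro l
    induction l using AddMonoidAlgebra.induction_linear with
    | zero => rw [map_zero, iterate_map_zero]; exact dvd_zero _
    | add f g hf hg => rw [map_add, hadd]; exact dvd_add hf hg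
    | single n w =>
      change _ ∣ T^[p] (mono p κ d S n w)
      rw [hiter]
      obtain ⟨c, hc⟩ := dvd_prod_range_sub hp (n i)
      rw [hc, Int.cast_mul, Int.cast_natCast, mul_assoc]
      exact dvd_mul_right _ _
  -- `T^[p]` is a derivation modulo `p`. It vanishes there on `R^□`, by density of Laurent
  -- polynomials, hence on the étale algebra `S`.
  have hS : ∀ s : S, Tp (algebraMap S (PCompl p S) s) ∈ Ideal.span {(p : PCompl p S)} := by
    refine mem_of_formallyUnramified (R₀ := RSquare p κ d) _ _ Tp ?_ ?_
    · intro a b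
      rw [Ideal.mem_span_singleton]
      exact dvd_iterate_leibniz hp T hT a b
    · intro x
      rw [Ideal.mem_span_singleton]
      obtain ⟨l, c, hc⟩ := PCompl.exists_sub_dvd 1 x
      have hc' := congr_arg ((algebraMap S (PCompl p S)).comp (algebraMap (RSquare p κ d) S)) hc
      rw [map_sub, map_mul, map_pow, map_natCast] at hc'
      exact happrox hc' (hlaurent l)
  obtain ⟨s, c, hc⟩ := PCompl.exists_sub_dvd 1 a
  exact happrox hc (Ideal.mem_span_singleton.mp (hS s))

variable {Ω : Type*} [Field Ω] [Algebra (PCompl p S) Ω] [Algebra.Etale (RSquare p κ d) S]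
variable {r : RootData p κ d S Ω} {γ : Fin d → r.Gal} (h : r.IsGeometricBasis γ)

theorem APlus.algebraMap_X :
    algebraMap (DRing p) (APlus p κ d S) PowerSeries.X = APlus.μ p κ d S := dToA_X

theorem APlus.algebraMap_q_sub_one :
    algebraMap (DRing p) (APlus p κ d S) ((APlus.qData h).q - 1) = APlus.μ p κ d S := by
  change algebraMap (DRing p) (APlus p κ d S) (1 + PowerSeries.X - 1) = _
  rw [add_sub_cancel_left, APlus.algebraMap_X]

/-- Reduction modulo `μ`, `A_R^+ → R`. -/
noncomputable def APlus.const : APlus p κ d S →+* PCompl p S :=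
  (PowerSeries.constantCoeff : PowerSeries (PCompl p S) →+* PCompl p S)

/-- The inclusion `R → A_R^+`. -/
noncomputable def APlus.ofR : PCompl p S →+* APlus p κ d S :=
  (PowerSeries.C : PCompl p S →+* PowerSeries (PCompl p S))

theorem APlus.const_ofR (a : PCompl p S) : APlus.const (κ := κ) (d := d) (APlus.ofR a) = a :=
  PowerSeries.constantCoeff_C a

theorem APlus.const_μ : APlus.const (APlus.μ p κ d S) = 0 := PowerSeries.constantCoeff_X

theorem APlus.exists_eq_ofR_add (f : APlus p κ d S) :
    ∃ g, f = APlus.ofR (APlus.const f) + APlus.μ p κ d S * g := by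
  have h1 : ∀ f : PowerSeries (PCompl p S), ∃ g,
      f = PowerSeries.C (PowerSeries.constantCoeff f) + PowerSeries.X * g := by
    intro f
    have h2 : PowerSeries.X ∣ f - PowerSeries.C (PowerSeries.constantCoeff f) := by
      rw [PowerSeries.X_dvd_iff]
      simp
    obtain ⟨g, hg⟩ := h2
    exact ⟨g, eq_add_of_sub_eq' hg⟩
  exact h1 f

theorem APlus.const_act (g : r.Gal) (f : APlus p κ d S) :
    APlus.const (r.act g f) = APlus.const f := (r.act_spec g).mod_X f

/-- The `q`-derivative `∂/∂U_i` of `A_R^+`. -/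
noncomputable def APlus.par (i : Fin d) (f : APlus p κ d S) : APlus p κ d S :=
  ((APlus.qData h).U i)⁻¹.val * (APlus.qData h).qDer i f

theorem APlus.par_add (i : Fin d) (f g : APlus p κ d S) :
    APlus.par h i (f + g) = APlus.par h i f + APlus.par h i g := by
  rw [APlus.par, map_add, mul_add, APlus.par, APlus.par]

theorem APlus.par_μ_mul (i : Fin d) (f : APlus p κ d S) :
    APlus.par h i (APlus.μ p κ d S * f) = APlus.μ p κ d S * APlus.par h i f := by
  rw [APlus.par, ← APlus.algebraMap_X, ← Algebra.smul_def, map_smul, Algebra.smul_def, APlus.par]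
  ring

/-- Since `∂/∂U_i` commutes with multiplication by `μ`, it descends to an operator on `R = A_R^+/μ`.
-/
theorem APlus.const_par (i : Fin d) (f : APlus p κ d S) :
    APlus.const (APlus.par h i f) = APlus.const (APlus.par h i (APlus.ofR (APlus.const f))) := by
  obtain ⟨g, hg⟩ := APlus.exists_eq_ofR_add f
  conv_lhs => rw [hg]
  rw [APlus.par_add, APlus.par_μ_mul, map_add, map_mul, APlus.const_μ, zero_mul, add_zero]

/-- Because `γ_i` is trivial modulo `μ`, the twisted Leibniz rule reduces to the ordinary one. -/
theorem APlus.const_par_mul (i : Fin d) (f g : APlus p κ d S) :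
    APlus.const (APlus.par h i (f * g)) =
      APlus.const (APlus.par h i f) * APlus.const g +
        APlus.const f * APlus.const (APlus.par h i g) := by
  have h1 : APlus.const ((APlus.qData h).γ i g) = APlus.const g := APlus.const_act (γ i) g
  rw [APlus.par, QData.qDer_mul, map_mul, map_add, map_mul, map_mul, h1, APlus.par, APlus.par,
    map_mul, map_mul]
  ring

/-- On the monomial `γ_i` multiplies by `(1 + μ)^(n_i)`, whose coefficient of `μ` is `n_i`. -/
theorem APlus.const_qDer_mono (i : Fin d) (n : Fin d → ℤ) (w : WittVector p κ) :
    APlus.const ((APlus.qData h).qDer i (APlus.ofR (mono p κ d S n w))) =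
      ((n i : ℤ) : PCompl p S) * mono p κ d S n w := by
  have h1 := (APlus.qData h).qDer_spec i (APlus.ofR (mono p κ d S n w))
  rw [APlus.algebraMap_q_sub_one] at h1
  have h2 : (APlus.qData h).γ i (APlus.ofR (mono p κ d S n w)) =
      dToA p κ d S (qpow p (n i : ℤ_[p])) * PowerSeries.C (mono p κ d S n w) := by
    have h3 := (r.act_spec (γ i)).map_mono n w
    rw [h.kummer, Finset.sum_eq_single i, Pi.single_eq_same, mul_one] at h3
    · exact h3
    · intro t _ ht
      rw [Pi.single_eq_of_ne ht, mul_zero]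
    · simp
  rw [h2] at h1
  -- The constant term of the `q`-derivative is the coefficient of `μ` in `γ_i(f) - f`.
  have h4 := congr_arg (PowerSeries.coeff (R := PCompl p S) 1) h1
  have h5 : PowerSeries.coeff (R := PCompl p S) 1 (APlus.μ p κ d S *
      (APlus.qData h).qDer i (APlus.ofR (mono p κ d S n w))) =
      APlus.const ((APlus.qData h).qDer i (APlus.ofR (mono p κ d S n w))) :=
    (PowerSeries.coeff_succ_X_mul 0 _).trans (PowerSeries.coeff_zero_eq_constantCoeff_apply _)
  rw [← h5, h4]
  change PowerSeries.coeff 1 (dToA p κ d S (qpow p (n i : ℤ_[p])) *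
    PowerSeries.C (mono p κ d S n w) - PowerSeries.C (mono p κ d S n w)) = _
  rw [map_sub, PowerSeries.coeff_mul_C, dToA, PowerSeries.coeff_map, qpow_coeff,
    Ring.choose_one_right, map_intCast, PowerSeries.coeff_C, if_neg one_ne_zero, sub_zero]

theorem APlus.const_par_mono (i : Fin d) (n : Fin d → ℤ) (w : WittVector p κ) :
    APlus.const (APlus.par h i (APlus.ofR (mono p κ d S n w))) =
      ((n i : ℤ) : PCompl p S) * mono p κ d S (n - Pi.single i 1) w := by
  have h1 : APlus.const (((APlus.qData h).U i)⁻¹.val) = mono p κ d S (-Pi.single i 1) 1 :=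
    PowerSeries.constantCoeff_C _
  rw [APlus.par, map_mul, h1, APlus.const_qDer_mono, mul_left_comm, ← mono_mul, one_mul,
    neg_add_eq_sub]

/-- Reduction modulo `μ` turns `∂/∂U_i` into a derivation of `R` with the expected values on
monomials, to which `dvd_iterate_of_map_mono` applies. -/
theorem APlus.exists_par_iterate_eq (i : Fin d) (f : APlus p κ d S) :
    ∃ g g', (APlus.par h i)^[p] f = (p : APlus p κ d S) * g + APlus.μ p κ d S * g' := by
  let T : PCompl p S →+ PCompl p S :=
    AddMonoidHom.mk' (fun a => APlus.const (APlus.par h i (APlus.ofR a)))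
      (fun a b => by simp only [map_add, APlus.par_add])
  have hT : ∀ a, T a = APlus.const (APlus.par h i (APlus.ofR a)) := fun _ => rfl
  have h1 : ∀ k f, APlus.const ((APlus.par h i)^[k] f) = T^[k] (APlus.const f) := by
    intro k f
    induction k with
    | zero => rfl
    | succ k ih =>
      rw [Function.iterate_succ_apply', Function.iterate_succ_apply', ← ih, hT, APlus.const_par]
  have h2 := dvd_iterate_of_map_mono (κ := κ) i T
    (fun a b => by
      rw [hT, hT, hT, map_mul, APlus.const_par_mul, APlus.const_ofR, APlus.const_ofR])
    (APlus.const_par_mono h i) (APlus.const f)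
  obtain ⟨c, hc⟩ := h2
  obtain ⟨g', hg'⟩ := APlus.exists_eq_ofR_add ((APlus.par h i)^[p] f)
  refine ⟨APlus.ofR c, g', ?_⟩
  rw [hg', h1, hc, map_mul, map_natCast]

end CoordinateDerivation

/-! ### Frobenius structures: the isomorphism, horizontality and quasi-nilpotence. -/

section Frobenius

variable {D A : Type*} [CommRing D] [CommRing A] [Algebra D A] {d : ℕ}
variable {Q : QData D A d} {N : Type*} [AddCommGroup N] [Module A N] {p : ℕ}

theorem QData.q_sub_one_mul_pq (Q : QData D A d) (p : ℕ) :
    (Q.q - 1) * Q.pq p = Q.q ^ p - 1 := by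
  rw [QData.pq, mul_comm, geom_sum_mul]

/-- `[p]_q` is a sum of `p` powers of `q`, each congruent to `1` modulo `q - 1`. This is what turns
divisibility by `[p]_q` into divisibility by `p` in `N/(q-1)N`. -/
theorem QData.exists_pq_pow_eq (Q : QData D A d) (p n : ℕ) :
    ∃ c : A, algebraMap D A (Q.pq p) ^ n = (p : A) ^ n + algebraMap D A (Q.q - 1) * c := by
  have h1 : Q.q - 1 ∣ Q.pq p - p := by
    have h2 : Q.pq p - p = ∑ j ∈ Finset.range p, (Q.q ^ j - 1 ^ j) := by
      simp [QData.pq]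
    rw [h2]
    exact Finset.dvd_sum fun j _ => sub_dvd_pow_sub_pow _ _ _
  obtain ⟨c, hc⟩ := h1.trans (sub_dvd_pow_sub_pow (Q.pq p) p n)
  refine ⟨algebraMap D A c, ?_⟩
  rw [← map_mul, ← hc]
  simp

/-- `φ(q - 1) = q^p - 1`, a geometric sum times `q - 1`: the source of the factor `[p]_q` in the
compatibility of Frobenius and connection. -/
theorem QFrob.φA_q_sub_one (Φ : QFrob p Q) : Φ.φA (algebraMap D A (Q.q - 1)) =
    algebraMap D A (Q.pq p) * algebraMap D A (Q.q - 1) := by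
  rw [Φ.compat, map_sub, Φ.φD_q, map_one, ← Q.q_sub_one_mul_pq, map_mul, mul_comm]

/-- A power of `[p]_q`, as an element of the submonoid of powers. -/
def QData.pqPow (Q : QData D A d) (p n : ℕ) : Q.pqPowers p :=
  ⟨algebraMap D A (Q.pq p) ^ n, n, rfl⟩

/-- Multiplication by a power of `[p]_q` is injective after inverting `[p]_q`. -/
theorem QData.pq_pow_smul_cancel {Q : QData D A d} (n : ℕ)
    {x y : LocalizedModule (Q.pqPowers p) N}
    (h : algebraMap D A (Q.pq p) ^ n • x = algebraMap D A (Q.pq p) ^ n • y) : x = y := by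
  have h1 := IsLocalizedModule.map_units (LocalizedModule.mkLinearMap (Q.pqPowers p) N)
    (Q.pqPow p n)
  exact ((Module.End.isUnit_iff _).mp h1).injective h

theorem QData.exists_pq_pow_smul_eq_zero {Q : QData D A d} {x : N}
    (h : LocalizedModule.mkLinearMap (Q.pqPowers p) N x = 0) :
    ∃ k, algebraMap D A (Q.pq p) ^ k • x = 0 := by
  obtain ⟨⟨_, k, rfl⟩, hk⟩ := (IsLocalizedModule.eq_zero_iff (Q.pqPowers p)
    (LocalizedModule.mkLinearMap (Q.pqPowers p) N)).mp h
  exact ⟨k, hk⟩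

theorem QData.exists_pq_pow_smul_eq {Q : QData D A d} (z : LocalizedModule (Q.pqPowers p) N) :
    ∃ (n : ℕ) (x : N), algebraMap D A (Q.pq p) ^ n • z =
      LocalizedModule.mkLinearMap (Q.pqPowers p) N x := by
  obtain ⟨⟨x, ⟨_, n, rfl⟩⟩, hx⟩ := IsLocalizedModule.surj (Q.pqPowers p)
    (LocalizedModule.mkLinearMap (Q.pqPowers p) N) z
  exact ⟨n, x, hx⟩

/-- Absence of `(q - 1)`-torsion persists after inverting `[p]_q`, so the cancellation argument is
also available in `N[1/[p]_q]`. -/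
theorem QData.SemiAction.loc_cancel (T : Q.SemiAction N) {x y : LocalizedModule (Q.pqPowers p) N}
    (h : algebraMap D A (Q.q - 1) • x = algebraMap D A (Q.q - 1) • y) : x = y := by
  rw [← sub_eq_zero, ← smul_sub] at h
  rw [← sub_eq_zero]
  obtain ⟨n, z, hz⟩ := QData.exists_pq_pow_smul_eq (x - y)
  refine QData.pq_pow_smul_cancel n ?_
  rw [smul_zero, hz]
  have h1 : LocalizedModule.mkLinearMap (Q.pqPowers p) N (algebraMap D A (Q.q - 1) • z) = 0 := by
    rw [map_smul, ← hz, smul_comm, h, smul_zero]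
  obtain ⟨k, hk⟩ := QData.exists_pq_pow_smul_eq_zero h1
  rw [smul_comm] at hk
  refine QData.pq_pow_smul_cancel k ?_
  rw [← map_smul, T.regular _ hk, map_zero, smul_zero]

theorem QFrob.rmul_φΩ_dlog (Φ : QFrob p Q) (f : A) (i : Fin d) :
    Q.rmul f (Φ.φΩ (QOmega.dlog i)) =
      (algebraMap D A (Q.pq p) * Q.γ i f) • (QOmega.dlog i : QOmega A d 1) := by
  ext I
  change algebraMap D A (Q.pq p) * Φ.φA ((QOmega.dlog i : QOmega A d 1) I) * Q.γProd I.1 f =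
    algebraMap D A (Q.pq p) * Q.γ i f * (QOmega.dlog i : QOmega A d 1) I
  rw [QOmega.dlog, Pi.single_apply]
  split_ifs with h
  · rw [h, Q.γProd_singleton, map_one, mul_one, mul_one]
  · rw [map_zero, mul_zero, mul_zero, zero_mul]

/-- A Frobenius `F : N → N[1/[p]_q]`, commuting with the operators of a semilinear action on `N`,
with bounded denominators, whose linearization is injective with bounded cokernel. -/
structure QData.SemiAction.Frobenius (T : Q.SemiAction N) (Φ : QFrob p Q) where
  F : N →ₛₗ[Φ.φA] LocalizedModule (Q.pqPowers p) N
  -- Commutation is expressed through a numerator `y` of `F x`, which avoids extending the action to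
  -- `N[1/[p]_q]`; the denominator lies in `D`, hence is fixed by the `γ_i`.
  comm : ∀ i n x y, algebraMap D A (Q.pq p) ^ n • F x = LocalizedModule.mkLinearMap _ N y →
    algebraMap D A (Q.pq p) ^ n • F (T.act i x) = LocalizedModule.mkLinearMap _ N (T.act i y)
  denom : ℕ
  denom_spec : ∀ x, ∃ y, algebraMap D A (Q.pq p) ^ denom • F x = LocalizedModule.mkLinearMap _ N y
  injective : Function.Injective (FrobPull.linearize Φ.φA F)
  height : ℕ
  height_spec : ∀ x, algebraMap D A (Q.pq p) ^ height • LocalizedModule.mkLinearMap _ N x ∈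
    LinearMap.range (FrobPull.linearize Φ.φA F)

theorem FrobPull.linearize_tmul (φ : A →+* A) {P : Type*} [AddCommGroup P] [Module A P]
    (T : N →ₛₗ[φ] P) (f : A) (x : N) :
    FrobPull.linearize φ T (FrobPull.tmul φ f x) = f • T x := rfl

namespace QData.SemiAction.Frobenius

variable {T : Q.SemiAction N} {Φ : QFrob p Q} (E : T.Frobenius Φ)

/-- This is `der_i ∘ φ = [p]_q φ ∘ der_i` with denominators cleared. After multiplication by `q - 1`
it is the commutation of `φ` with `γ_i`, and the exponent `n + 1` absorbs the `[p]_q` in `φ(q - 1) =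
[p]_q (q - 1)`. -/
theorem der (i : Fin d) (n : ℕ) (x y : N)
    (h : algebraMap D A (Q.pq p) ^ n • E.F x = LocalizedModule.mkLinearMap _ N y) :
    algebraMap D A (Q.pq p) ^ (n + 1) • E.F (T.der i x) =
      LocalizedModule.mkLinearMap _ N (T.der i y) := by
  refine T.loc_cancel ?_
  rw [← (LocalizedModule.mkLinearMap _ N).map_smul, T.der_spec,
    map_sub (LocalizedModule.mkLinearMap _ N), ← h, ← E.comm i n x y h, ← smul_sub, ← map_sub E.F,
    ← T.der_spec, E.F.map_smulₛₗ, Φ.φA_q_sub_one, ← mul_smul, ← mul_smul]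
  congr 1
  ring

/-- The linearization of the Frobenius, after inverting `[p]_q`. -/
noncomputable def isoHom :
    LocalizedModule (Q.pqPowers p) (FrobPull Φ.φA N) →ₗ[A] LocalizedModule (Q.pqPowers p) N :=
  LocalizedModule.lift _ (FrobPull.linearize Φ.φA E.F)
    (IsLocalizedModule.map_units (LocalizedModule.mkLinearMap (Q.pqPowers p) N))

theorem isoHom_mk (y : FrobPull Φ.φA N) :
    E.isoHom (LocalizedModule.mkLinearMap _ _ y) = FrobPull.linearize Φ.φA E.F y :=
  LinearMap.congr_fun (LocalizedModule.lift_comp (Q.pqPowers p) (FrobPull.linearize Φ.φA E.F)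
    (IsLocalizedModule.map_units (LocalizedModule.mkLinearMap (Q.pqPowers p) N))) y

/-- An injective linearization stays injective on the localization, and a cokernel killed by a power
of `[p]_q` disappears there. -/
theorem isoHom_bijective : Function.Bijective E.isoHom := by
  constructor
  · rw [injective_iff_map_eq_zero]
    intro z hz
    obtain ⟨n, y, hy⟩ := QData.exists_pq_pow_smul_eq z
    refine QData.pq_pow_smul_cancel n ?_
    have h1 := E.isoHom_mk y
    rw [← hy, map_smul, hz, smul_zero] at h1
    rw [hy, (injective_iff_map_eq_zero _).mp E.injective y h1.symm, map_zero, smul_zero]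
  · intro z
    obtain ⟨n, x, hx⟩ := QData.exists_pq_pow_smul_eq z
    -- The preimage of `z = x/[p]_q^n` is `w/[p]_q^(height + n)`, where `w` maps to `[p]_q^height
    -- x`.
    obtain ⟨w, hw⟩ := E.height_spec x
    have h1 := (IsLocalizedModule.map_units
      (LocalizedModule.mkLinearMap (Q.pqPowers p) (FrobPull Φ.φA N))
      (Q.pqPow p (E.height + n)))
    obtain ⟨y, hy⟩ := ((Module.End.isUnit_iff _).mp h1).surjective
      (LocalizedModule.mkLinearMap _ _ w)
    refine ⟨y, QData.pq_pow_smul_cancel (E.height + n) ?_⟩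
    change algebraMap D A (Q.pq p) ^ (E.height + n) • y = _ at hy
    rw [← map_smul, hy, E.isoHom_mk, hw, ← hx, ← mul_smul, pow_add]

/-- The isomorphism `(φ^* N)[1/[p]_q] ≃ N[1/[p]_q]` induced by the Frobenius. -/
noncomputable def iso :
    LocalizedModule (Q.pqPowers p) (FrobPull Φ.φA N) ≃ₗ[A] LocalizedModule (Q.pqPowers p) N :=
  LinearEquiv.ofBijective E.isoHom E.isoHom_bijective

theorem iso_mk (y : FrobPull Φ.φA N) :
    E.iso (LocalizedModule.mkLinearMap _ _ y) = FrobPull.linearize Φ.φA E.F y := E.isoHom_mk y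

end QData.SemiAction.Frobenius

/-- The localized connection is computed by clearing denominators, which pass through it because
`[p]_q` lies in `D`. -/
theorem QData.extendLoc_smul_mk (Q : QData D A d) {M : Type*} [AddCommGroup M]
    [Module A M] (nabla : M →+ M ⊗[A] QOmega A d 1)
    (h : ∀ (a : D) (x : M), nabla (algebraMap D A a • x) = algebraMap D A a • nabla x)
    (n : ℕ) (z : LocalizedModule (Q.pqPowers p) M) (x : M)
    (hz : algebraMap D A (Q.pq p) ^ n • z = LocalizedModule.mkLinearMap _ M x) :
    algebraMap D A (Q.pq p) ^ n • Q.extendLoc p nabla h z =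
      (LocalizedModule.mkLinearMap (Q.pqPowers p) M).rTensor (QOmega A d 1) (nabla x) := by
  have hz' : z = LocalizedModule.mk x (Q.pqPow p n) := by
    refine QData.pq_pow_smul_cancel n ?_
    rw [hz, LocalizedModule.smul'_mk]
    exact (LocalizedModule.mk_cancel (Q.pqPow p n) x).symm
  rw [hz', QData.extendLoc]
  exact locLift_mk (Q.pqPowers p) (MonoidHom.id A) _ _ _ x (Q.pqPow p n)

theorem QData.pq_pow_smul_cancel_form {Q : QData D A d} (n : ℕ)
    {x y : LocalizedModule (Q.pqPowers p) N ⊗[A] QOmega A d 1}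
    (h : algebraMap D A (Q.pq p) ^ n • x = algebraMap D A (Q.pq p) ^ n • y) : x = y := by
  refine QOmega.comp_ext fun I => QData.pq_pow_smul_cancel n ?_
  rw [← map_smul, h, map_smul]

variable [Module D N] [IsScalarTower D A N]

theorem QConnection.pq_pow_smul_loc (nabla : QConnection Q N) (n : ℕ)
    (z : LocalizedModule (Q.pqPowers p) N) (x : N)
    (hz : algebraMap D A (Q.pq p) ^ n • z = LocalizedModule.mkLinearMap _ N x) :
    algebraMap D A (Q.pq p) ^ n • nabla.loc p z =
      (LocalizedModule.mkLinearMap (Q.pqPowers p) N).rTensor (QOmega A d 1) (nabla.toLin x) :=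
  Q.extendLoc_smul_mk _ _ n z x hz

theorem QConnection.pq_pow_smul_frobPullLoc (nabla : QConnection Q N) (Φ : QFrob p Q) (n : ℕ)
    (z : LocalizedModule (Q.pqPowers p) (FrobPull Φ.φA N)) (x : FrobPull Φ.φA N)
    (hz : algebraMap D A (Q.pq p) ^ n • z = LocalizedModule.mkLinearMap _ _ x) :
    algebraMap D A (Q.pq p) ^ n • nabla.frobPullLoc Φ z =
      (LocalizedModule.mkLinearMap (Q.pqPowers p) (FrobPull Φ.φA N)).rTensor (QOmega A d 1)
        (nabla.frobPull Φ x) :=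
  Q.extendLoc_smul_mk _ _ n z x hz

namespace QData.SemiAction.Frobenius

variable {T : Q.SemiAction N} {Φ : QFrob p Q} (E : T.Frobenius Φ)

/-- Horizontality on generators: the `i`-th coefficient of `∇(f φ(x))` is `γ_i(f) [p]_q φ(der_i x) +
qDer_i(f) φ(x)`, whose two terms are those of `φ^*∇`. -/
theorem loc_linearize (y : FrobPull Φ.φA N) :
    T.connection.loc p (FrobPull.linearize Φ.φA E.F y) =
      (FrobPull.linearize Φ.φA E.F).rTensor (QOmega A d 1) (T.connection.frobPull Φ y) := by
  induction y using FrobPull.induction with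
  | h0 => simp only [map_zero]
  | h2 y z hy hz => simp only [map_add, hy, hz]
  | h1 f x =>
    obtain ⟨y, hy⟩ := E.denom_spec x
    refine QData.pq_pow_smul_cancel_form E.denom ?_
    rw [T.connection.pq_pow_smul_loc E.denom _ (f • y) (by
        rw [FrobPull.linearize_tmul, smul_comm, hy, map_smul]),
      T.connection.frobPull_tmul, T.connection_apply, T.connection_apply]
    simp only [map_sum, map_add, LinearMap.lTensor_tmul, LinearMap.rTensor_tmul, Φ.tensor_tmul,
      QFrob.rmul_φΩ_dlog, FrobPull.linearize_tmul, one_smul, T.der_smul, QData.dZero,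
      TensorProduct.tmul_sum, Finset.smul_sum, smul_add, map_smul, ← hy, ← E.der _ _ _ _ hy,
      TensorProduct.add_tmul, TensorProduct.tmul_smul, TensorProduct.smul_tmul',
      Finset.sum_add_distrib, ← mul_smul]
    congr 1
    · refine Finset.sum_congr rfl fun i _ => ?_
      congr 2
      ring
    · refine Finset.sum_congr rfl fun i _ => ?_
      congr 2
      ring

/-- The `φ`-module structure induced by the Frobenius. -/
noncomputable def phiStructure : PhiStructure Φ T.connection where
  iso := E.iso
  horizontal z := by
    obtain ⟨n, y, hy⟩ := QData.exists_pq_pow_smul_eq z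
    -- Both sides are compared after multiplication by a power of `[p]_q` that clears the
    -- denominators of `z` and of its image. The exponent `m + n` does the work, and `E.denom` is a
    -- common extra factor, split off by `h7`.
    refine QData.pq_pow_smul_cancel_form (n + E.denom) ?_
    obtain ⟨m, x, hx⟩ := QData.exists_pq_pow_smul_eq (FrobPull.linearize Φ.φA E.F y)
    have h1 : E.iso (algebraMap D A (Q.pq p) ^ n • z) = FrobPull.linearize Φ.φA E.F y := by
      rw [hy, E.iso_mk]
    have h2 : algebraMap D A (Q.pq p) ^ (m + n) • E.iso z = LocalizedModule.mkLinearMap _ _ x := by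
      rw [pow_add, mul_smul, ← map_smul, h1, hx]
    refine QData.pq_pow_smul_cancel_form m ?_
    have h3 := T.connection.pq_pow_smul_loc _ _ _ h2
    have h4 := T.connection.pq_pow_smul_loc _ _ _ hx
    have h5 := T.connection.pq_pow_smul_frobPullLoc Φ _ _ _ hy
    have h6 : (E.iso.toLinearMap.rTensor (QOmega A d 1))
        ((LocalizedModule.mkLinearMap (Q.pqPowers p) (FrobPull Φ.φA N)).rTensor (QOmega A d 1)
        (T.connection.frobPull Φ y)) =
        (FrobPull.linearize Φ.φA E.F).rTensor (QOmega A d 1) (T.connection.frobPull Φ y) := by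
      rw [← LinearMap.comp_apply, ← LinearMap.rTensor_comp]
      congr 2
      exact LinearMap.ext E.iso_mk
    have h7 : ∀ w : LocalizedModule (Q.pqPowers p) N ⊗[A] QOmega A d 1,
        algebraMap D A (Q.pq p) ^ m • algebraMap D A (Q.pq p) ^ (n + E.denom) • w =
        algebraMap D A (Q.pq p) ^ E.denom • algebraMap D A (Q.pq p) ^ (m + n) • w := by
      intro w
      rw [← mul_smul, ← mul_smul]
      congr 1
      ring
    rw [h7, h3, h7, pow_add _ m n, mul_smul, ← map_smul _ (algebraMap D A (Q.pq p) ^ n), h5, h6,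
      ← E.loc_linearize, h4]

end QData.SemiAction.Frobenius

theorem QData.SemiAction.parDer_connection (T : Q.SemiAction N) (i : Fin d) (x : N) :
    T.connection.parDer i x = (Q.U i)⁻¹.val • T.der i x := by
  have h1 : QOmega.comp N {i} (T.connection.toLin x) = T.der i x := by
    rw [T.connection_apply, map_sum, Finset.sum_eq_single i]
    · rw [QOmega.comp_tmul, QOmega.coeff_dlog, if_pos rfl, one_smul]
    · intro j _ hj
      rw [QOmega.comp_tmul, QOmega.coeff_dlog, if_neg, zero_smul]
      intro h
      exact hj (Finset.singleton_injective h).symm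
    · simp
  exact congr_arg _ h1

/-- The criterion `exists_iterate_eq_pow_smul` is applied to `N/(q-1)N`, where the twisted Leibniz
rule becomes the ordinary one; the hypotheses are those of the criterion lifted to `N`. -/
theorem QData.SemiAction.isQuasiNilpotent (T : Q.SemiAction N)
    (hp : ∀ x y : N, (p : A) • x = algebraMap D A (Q.q - 1) • y →
      ∃ z, x = algebraMap D A (Q.q - 1) • z)
    (hδ : ∀ i f, ∃ g g', (fun f => (Q.U i)⁻¹.val * Q.qDer i f)^[p] f =
      (p : A) * g + algebraMap D A (Q.q - 1) * g')
    (Y : Set N) (hY : ∀ i, ∀ y ∈ Y, ∃ y' ∈ Submodule.span A Y, ∃ z,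
      T.der i y = (p : A) • y' + algebraMap D A (Q.q - 1) • z)
    (h : ℕ) (hspan : ∀ x, ∃ z, (p : A) ^ h • x + algebraMap D A (Q.q - 1) • z ∈
      Submodule.span A Y) :
    T.connection.IsQuasiNilpotent p := by
  intro i x m
  set K := LinearMap.range (LinearMap.lsmul A N (algebraMap D A (Q.q - 1))) with hK
  have hmk : ∀ x y : N, K.mkQ x = K.mkQ y ↔ ∃ z, x - y = algebraMap D A (Q.q - 1) • z := by
    intro x y
    rw [Submodule.mkQ_apply, Submodule.mkQ_apply, Submodule.Quotient.eq, hK, LinearMap.mem_range]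
    exact exists_congr fun z => eq_comm
  have hμ : ∀ z, K.mkQ (algebraMap D A (Q.q - 1) • z) = 0 := by
    intro z
    rw [← map_zero K.mkQ, hmk]
    exact ⟨z, sub_zero _⟩
  let P : N → N := T.connection.parDer i
  have hP : ∀ x, P x = (Q.U i)⁻¹.val • T.der i x := T.parDer_connection i
  have hPadd : ∀ x y, P (x + y) = P x + P y := by
    intro x y
    rw [hP, hP, hP, T.der_add, smul_add]
  have hPμ : ∀ z, P (algebraMap D A (Q.q - 1) • z) = algebraMap D A (Q.q - 1) • P z := by
    intro z
    rw [hP, hP, T.der_smul_algebraMap, smul_comm]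
  have hsurj := K.mkQ_surjective
  -- The operator descends through a set-theoretic section; independence of the lift holds because
  -- it is additive and commutes with `q - 1`.
  let B₀ : (N ⧸ K) → (N ⧸ K) := fun m => K.mkQ (P (Function.surjInv hsurj m))
  have hB₀ : ∀ x, B₀ (K.mkQ x) = K.mkQ (P x) := by
    intro x
    obtain ⟨z, hz⟩ := (hmk _ _).mp (Function.surjInv_eq hsurj (K.mkQ x))
    change K.mkQ (P (Function.surjInv hsurj (K.mkQ x))) = _
    rw [eq_add_of_sub_eq hz, hPadd, hPμ, map_add, hμ, zero_add]
  let B : (N ⧸ K) →+ (N ⧸ K) := AddMonoidHom.mk' B₀ (by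
    intro a b
    obtain ⟨x, rfl⟩ := hsurj a
    obtain ⟨y, rfl⟩ := hsurj b
    rw [← map_add, hB₀, hB₀, hB₀, hPadd, map_add])
  have hB : ∀ x, B (K.mkQ x) = K.mkQ (P x) := hB₀
  have hact : ∀ x, K.mkQ (T.act i x) = K.mkQ x := by
    intro x
    rw [hmk]
    exact ⟨_, (T.der_spec i x).symm⟩
  have hBiter : ∀ n x, B^[n] (K.mkQ x) = K.mkQ (P^[n] x) := by
    intro n x
    induction n generalizing x with
    | zero => rfl
    | succ n ih => rw [Function.iterate_succ_apply, hB, ih, Function.iterate_succ_apply]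
  obtain ⟨n₀, hn₀⟩ := exists_iterate_eq_pow_smul p (fun f => (Q.U i)⁻¹.val * Q.qDer i f) B
    (by
      intro f a
      obtain ⟨x, rfl⟩ := hsurj a
      rw [← map_smul, hB, hB, hP, hP, T.der_smul', smul_add, map_add, add_comm, ← mul_smul,
        map_smul, hact, ← map_smul, ← map_smul, smul_comm f])
    (K.mkQ '' Y)
    (by
      rintro _ ⟨y, hy, rfl⟩
      obtain ⟨y', hy', z, hz⟩ := hY i y hy
      refine ⟨K.mkQ ((Q.U i)⁻¹.val • y'), ?_, ?_⟩
      · rw [← Submodule.map_span]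
        exact Submodule.mem_map_of_mem (Submodule.smul_mem _ _ hy')
      · rw [hB, hP, hz, smul_add, smul_comm _ (algebraMap D A (Q.q - 1)), map_add, hμ, add_zero,
          smul_comm, map_smul])
    (by
      intro f
      obtain ⟨g, g', hg⟩ := hδ i f
      refine ⟨g, fun a => ?_⟩
      obtain ⟨x, rfl⟩ := hsurj a
      rw [hg, ← map_smul, add_smul, mul_smul, mul_smul, map_add, hμ, add_zero, map_smul, map_smul])
    (by
      -- `p`-torsion freeness of the quotient, which is the hypothesis `hp` read in `N`.
      intro a ha
      obtain ⟨x, rfl⟩ := hsurj a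
      rw [← map_smul, ← map_zero K.mkQ, hmk] at ha
      obtain ⟨y, hy⟩ := ha
      rw [sub_zero] at hy
      obtain ⟨z, hz⟩ := hp x y hy
      rw [hz, hμ])
    h
    (by
      intro a
      obtain ⟨x, rfl⟩ := hsurj a
      obtain ⟨z, hz⟩ := hspan x
      have := Submodule.mem_map_of_mem (f := K.mkQ) hz
      rwa [Submodule.map_span, map_add, hμ, add_zero, map_smul] at this)
    (K.mkQ x) m
  refine ⟨n₀, fun n hn => ?_⟩
  obtain ⟨a, ha⟩ := hn₀ n hn
  obtain ⟨y, rfl⟩ := hsurj a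
  rw [hBiter, ← map_smul, hmk] at ha
  obtain ⟨z, hz⟩ := ha
  change P^[n] x ∈ _
  rw [eq_add_of_sub_eq hz]
  refine add_mem ?_ ?_
  · rw [algebraMap_smul]
    exact Submodule.smul_mem_smul (Ideal.subset_span (by simp)) trivial
  · rw [← map_natCast (algebraMap D A), ← map_pow, algebraMap_smul]
    exact Submodule.smul_mem_smul (Ideal.subset_span (by simp)) trivial

/-- Dwork's trick, with `Y` the set of numerators of Frobenius images for the denominator
`[p]_q^denom`. The relation between Frobenius and derivative gives `der_i Y ⊆ p Y` modulo `q - 1`,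
and the bounds on denominators and cokernel make `Y` span up to `p^(denom + height)`. -/
theorem QData.SemiAction.Frobenius.isQuasiNilpotent {T : Q.SemiAction N} {Φ : QFrob p Q}
    (E : T.Frobenius Φ)
    (hp : ∀ x y : N, (p : A) • x = algebraMap D A (Q.q - 1) • y →
      ∃ z, x = algebraMap D A (Q.q - 1) • z)
    (hδ : ∀ i f, ∃ g g', (fun f => (Q.U i)⁻¹.val * Q.qDer i f)^[p] f =
      (p : A) * g + algebraMap D A (Q.q - 1) * g') :
    T.connection.IsQuasiNilpotent p := by
  let Y : Set N := {y | ∃ x, algebraMap D A (Q.pq p) ^ E.denom • E.F x =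
    LocalizedModule.mkLinearMap _ N y}
  -- The set `Y` contains the kernel of `N → N[1/[p]_q]`, as numerators of zero, so equalities in
  -- the localization suffice for membership in its span.
  have hzero : ∀ t, LocalizedModule.mkLinearMap (Q.pqPowers p) N t = 0 → t ∈ Y := by
    intro t ht
    exact ⟨0, by rw [map_zero, smul_zero, ht]⟩
  have hppow : ∀ k (x y : N), (p : A) ^ k • x = algebraMap D A (Q.q - 1) • y →
      ∃ z, x = algebraMap D A (Q.q - 1) • z := by
    intro k
    induction k with
    | zero => exact fun x y h => ⟨y, by simpa using h⟩
    | succ k ih =>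
      intro x y h
      rw [pow_succ', mul_smul] at h
      obtain ⟨z, hz⟩ := hp _ _ h
      exact ih _ _ hz
  -- An element killed by `[p]_q^k` is killed by `p^k` modulo `q - 1`, hence lies in `(q - 1) N` by
  -- `p`-torsion freeness of the quotient.
  have hker : ∀ t, LocalizedModule.mkLinearMap (Q.pqPowers p) N t = 0 →
      ∃ z, t = algebraMap D A (Q.q - 1) • z := by
    intro t ht
    obtain ⟨k, hk⟩ := QData.exists_pq_pow_smul_eq_zero ht
    obtain ⟨c, hc⟩ := Q.exists_pq_pow_eq (A := A) p k
    rw [hc, add_smul] at hk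
    refine hppow k t (-(c • t)) ?_
    rw [eq_neg_of_add_eq_zero_left hk, mul_smul, smul_neg]
  refine T.isQuasiNilpotent hp hδ Y ?_ (E.denom + E.height) ?_
  · rintro i y ⟨x, hx⟩
    obtain ⟨y', hy'⟩ := E.denom_spec (T.der i x)
    have h1 := E.der i _ _ _ hx
    -- `der_i y` and `[p]_q y'` have the same image in `N[1/[p]_q]`, so they agree modulo `q - 1`,
    -- where `[p]_q` becomes `p`.
    rw [pow_succ', mul_smul, hy', ← map_smul, ← sub_eq_zero, ← map_sub] at h1
    obtain ⟨z, hz⟩ := hker _ h1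
    obtain ⟨c, hc⟩ := Q.exists_pq_pow_eq (A := A) p 1
    rw [pow_one, pow_one] at hc
    refine ⟨y', Submodule.subset_span ⟨_, hy'⟩, c • y' - z, ?_⟩
    rw [hc, add_smul, mul_smul] at hz
    rw [smul_sub, ← hz]
    abel
  · have hlin : ∀ w : FrobPull Φ.φA N, ∃ v ∈ Submodule.span A Y,
        algebraMap D A (Q.pq p) ^ E.denom • FrobPull.linearize Φ.φA E.F w =
          LocalizedModule.mkLinearMap _ N v := by
      intro w
      induction w using FrobPull.induction with
      | h0 => exact ⟨0, zero_mem _, by rw [map_zero, smul_zero, map_zero]⟩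
      | h1 f x =>
        obtain ⟨y, hy⟩ := E.denom_spec x
        refine ⟨f • y, Submodule.smul_mem _ _ (Submodule.subset_span ⟨x, hy⟩), ?_⟩
        rw [FrobPull.linearize_tmul, smul_comm, hy, map_smul]
      | h2 y z hy hz =>
        obtain ⟨v, hv, h1⟩ := hy
        obtain ⟨w, hw, h2⟩ := hz
        exact ⟨v + w, add_mem hv hw, by rw [map_add, smul_add, h1, h2, map_add]⟩
    intro x
    obtain ⟨w, hw⟩ := E.height_spec x
    obtain ⟨v, hv, hv'⟩ := hlin w
    obtain ⟨c, hc⟩ := Q.exists_pq_pow_eq (A := A) p (E.denom + E.height)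
    refine ⟨c • x, ?_⟩
    rw [← mul_smul, ← add_smul, ← hc, ← sub_add_cancel (algebraMap D A (Q.pq p) ^ _ • x) v]
    refine add_mem (Submodule.subset_span (hzero _ ?_)) hv
    rw [map_sub, ← hv', hw, map_smul, ← mul_smul, pow_add, sub_self]

end Frobenius

/-! ### Functoriality of the Frobenius pullback. -/

section FrobPullCongr

variable {A : Type*} [CommRing A] (φ : A →+* A) {M N : Type*} [AddCommGroup M] [Module A M]
  [AddCommGroup N] [Module A N]

/-- Functoriality of `φ^*` for isomorphisms. -/
noncomputable def FrobPull.congr (e : N ≃ₗ[A] M) : FrobPull φ N ≃+ FrobPull φ M :=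
  (LinearEquiv.lTensor (Twist φ) e).toAddEquiv

theorem FrobPull.congr_tmul (e : N ≃ₗ[A] M) (f : A) (x : N) :
    FrobPull.congr φ e (FrobPull.tmul φ f x) = FrobPull.tmul φ f (e x) := rfl

end FrobPullCongr

/-! ### Wach modules carry a semilinear action with Frobenius. -/

section WachModule

variable {p : ℕ} [Fact p.Prime] {κ : Type*} [Field κ] [CharP κ p] {d : ℕ}
variable {S : Type*} [CommRing S] [Algebra (RSquare p κ d) S] [Algebra.Etale (RSquare p κ d) S]
variable {Ω : Type*} [Field Ω] [Algebra (PCompl p S) Ω] {r : RootData p κ d S Ω}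
variable {γ : Fin d → r.Gal} (h : r.IsGeometricBasis γ)
variable {N : Type*} [AddCommGroup N] [Module (APlus p κ d S) N]

/-- An automorphism over `R` is determined on the adjoined generators, and its value at `1/p` is
forced. -/
theorem RootData.gal_ext {g g' : r.Gal} (hζ : ∀ n, g (r.ζInf n) = g' (r.ζInf n))
    (hx : ∀ i n, g (r.xInf i n) = g' (r.xInf i n)) : g = g' := by
  have h1 : (g : r.RInf →ₐ[PCompl p S] r.RInf) = g' := by
    refine AlgHom.adjoin_ext ?_
    rintro y ((⟨n, rfl⟩ | ⟨⟨i, n⟩, rfl⟩) | hy)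
    · exact hζ n
    · exact hx i n
    · rw [Set.mem_singleton_iff] at hy
      subst hy
      set u : r.RInf := ⟨(p : Ω)⁻¹, _⟩ with hu
      change g u = g' u
      -- If `p` vanished in `Ω`, the adjoined element would be `0⁻¹ = 0`; otherwise it is the
      -- inverse of `p`, which every automorphism fixes.
      by_cases hp : (p : Ω) = 0
      · have : u = 0 := Subtype.ext (by rw [hu]; simp [hp])
        rw [this, _root_.map_zero, _root_.map_zero]
      · have h2 : (p : r.RInf) * u = 1 := Subtype.ext (by rw [hu]; simp [hp])
        have h3 : ∀ g : r.Gal, (p : r.RInf) * g u = 1 := by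
          intro g
          rw [← map_natCast g p, ← map_mul, h2, map_one]
        refine mul_left_cancel₀ (left_ne_zero_of_mul_eq_one h2) ?_
        rw [h3, h3]
  exact AlgEquiv.ext fun y => AlgHom.congr_fun h1 y

include h in
theorem RootData.IsGeometricBasis.mul_comm (i j : Fin d) : γ i * γ j = γ j * γ i := by
  rcases eq_or_ne i j with rfl | hij
  · rfl
  refine RootData.gal_ext (fun n => ?_) (fun k n => ?_)
  · rw [AlgEquiv.mul_apply, AlgEquiv.mul_apply, h.map_ζ, h.map_ζ, h.map_ζ]
  · rw [AlgEquiv.mul_apply, AlgEquiv.mul_apply, h.map_x, h.map_x]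
    by_cases hi : k = i
    · subst hi
      simp [h.map_x, h.map_ζ, hij]
    · by_cases hj : k = j
      · subst hj
        simp [h.map_x, h.map_ζ, hi]
      · simp [h.map_x, hi, hj]

theorem APlus.algebraMap_pq :
    algebraMap (DRing p) (APlus p κ d S) ((APlus.qData h).pq p) = APlus.pq p κ d S := by
  rw [QData.pq, APlus.pq, map_sum]
  refine Finset.sum_congr rfl fun j _ => ?_
  have h1 := APlus.algebraMap_q_sub_one h
  rw [map_sub, map_one, sub_eq_iff_eq_add'] at h1
  rw [map_pow, h1]

section Action

variable (act : r.Gal →* AddMonoid.End N)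
    (act_smul : ∀ g (f : APlus p κ d S) (x : N), act g (f • x) = r.act g f • act g x)
    (t : APlus p κ d S) (ht : ∀ g, r.act g t ∣ t) (g : r.Gal)

theorem RootData.actLoc_mk (x : N) :
    r.actLoc act act_smul t ht g (LocalizedModule.mkLinearMap _ N x) =
      LocalizedModule.mkLinearMap _ N (act g x) := by
  have h1 : r.act g ((1 : Submonoid.powers t) : APlus p κ d S) •
      r.actLoc act act_smul t ht g (LocalizedModule.mk x 1) =
      LocalizedModule.mkLinearMap _ N (act g x) := by
    rw [RootData.actLoc]
    exact locLift_mk _ _ _ _ _ _ _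
  rw [OneMemClass.coe_one, map_one, one_smul] at h1
  exact h1

/-- For `z = x/s`, both sides are compared after multiplication by `g(s)`, which divides `s` and
therefore acts bijectively on the localization. -/
theorem RootData.actLoc_smul (f : APlus p κ d S)
    (z : LocalizedModule (Submonoid.powers t) N) :
    r.actLoc act act_smul t ht g (f • z) = r.act g f • r.actLoc act act_smul t ht g z := by
  induction z with | h x s => ?_
  have key : ∀ x, r.act g (s : APlus p κ d S) •
      r.actLoc act act_smul t ht g (LocalizedModule.mk x s) =
      LocalizedModule.mkLinearMap _ N (act g x) := by
    intro x
    rw [RootData.actLoc]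
    exact locLift_mk _ _ _ _ _ _ _
  have hs : r.act g (s : APlus p κ d S) ∣ s := by
    obtain ⟨n, hn⟩ := s.2
    simp only at hn
    rw [← hn, _root_.map_pow]
    exact pow_dvd_pow_of_dvd (ht g) n
  refine ((Module.End.isUnit_iff _).mp
    (isUnit_end_of_dvd (Submonoid.powers t) (M := N) ⟨s, s.2, hs⟩)).injective
      (?_ : r.act g (s : APlus p κ d S) •
        r.actLoc act act_smul t ht g (f • LocalizedModule.mk x s) =
        r.act g (s : APlus p κ d S) •
          r.act g f • r.actLoc act act_smul t ht g (LocalizedModule.mk x s))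
  rw [LocalizedModule.smul'_mk, key, smul_comm, key, act_smul, map_smul]

end Action

/-- The integer power `μ^b` is encoded by the truncations `b.toNat` and `(-b).toNat`, at least one
of which is zero, so no negative exponent appears. -/
theorem mem_muPow {t : APlus p κ d S} {b : ℤ} {z : LocalizedModule (Submonoid.powers t) N} :
    z ∈ muPow t N b ↔ ∃ x, APlus.μ p κ d S ^ (-b).toNat • z =
      APlus.μ p κ d S ^ b.toNat • LocalizedModule.mkLinearMap _ N x := by
  constructor
  · rintro ⟨_, ⟨x, rfl⟩, hx⟩
    exact ⟨x, hx.symm⟩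
  · rintro ⟨x, hx⟩
    exact ⟨_, ⟨x, rfl⟩, hx.symm⟩

/-- The element `μ ^ b x` of `N[1/μ]`. -/
noncomputable def muPowHom (p : ℕ) [Fact p.Prime] (κ : Type*) [Field κ] [CharP κ p] (d : ℕ)
    (S : Type*) [CommRing S] [Algebra (RSquare p κ d) S] (b : ℤ) (N : Type*) [AddCommGroup N] [Module (APlus p κ d S) N] :
    N →ₗ[APlus p κ d S] LocalizedModule (Submonoid.powers (APlus.μ p κ d S)) N :=
  LocalizedModule.divBy ⟨APlus.μ p κ d S ^ (-b).toNat, _, rfl⟩ ∘ₗ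
    LinearMap.lsmul _ _ (APlus.μ p κ d S ^ b.toNat) ∘ₗ LocalizedModule.mkLinearMap _ N

theorem μ_pow_smul_muPowHom (b : ℤ) (x : N) :
    APlus.μ p κ d S ^ (-b).toNat • muPowHom p κ d S b N x =
      APlus.μ p κ d S ^ b.toNat •
        LocalizedModule.mkLinearMap (Submonoid.powers (APlus.μ p κ d S)) N x :=
  LocalizedModule.mul_by_divBy (⟨APlus.μ p κ d S ^ (-b).toNat, _, rfl⟩ :
    Submonoid.powers (APlus.μ p κ d S)) _

theorem μ_pow_bijective (n : ℕ) : Function.Bijective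
    fun z : LocalizedModule (Submonoid.powers (APlus.μ p κ d S)) N => APlus.μ p κ d S ^ n • z :=
  (Module.End.isUnit_iff _).mp (IsLocalizedModule.map_units
    (LocalizedModule.mkLinearMap (Submonoid.powers (APlus.μ p κ d S)) N)
    (⟨APlus.μ p κ d S ^ n, n, rfl⟩ : Submonoid.powers (APlus.μ p κ d S)))

variable [PerfectRing κ p]

/-- Divisors of `φ(μ)` act bijectively on `N[1/φ(μ)]`. -/
theorem APlus.bijective_smul {f : APlus p κ d S} (n : ℕ)
    (hf : f ∣ APlus.frob p κ d S (APlus.μ p κ d S)) :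
    Function.Bijective fun z : LocalizedModule
      (Submonoid.powers (APlus.frob p κ d S (APlus.μ p κ d S))) N => f ^ n • z :=
  (Module.End.isUnit_iff _).mp (isUnit_end_of_dvd (M := N)
    (Submonoid.powers (APlus.frob p κ d S (APlus.μ p κ d S)))
    ⟨_, ⟨n, rfl⟩, pow_dvd_pow_of_dvd hf n⟩)

theorem APlus.pq_dvd_frob_μ :
    APlus.pq p κ d S ∣ APlus.frob p κ d S (APlus.μ p κ d S) := ⟨_, APlus.frob_μ p κ d S⟩

variable (p κ d S) in
theorem APlus.frob_μ_pow (n : ℕ) : APlus.frob p κ d S (APlus.μ p κ d S) ^ n =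
    APlus.pq p κ d S ^ n * APlus.μ p κ d S ^ n := by
  rw [APlus.frob_μ, mul_pow]

theorem APlus.locIncl_mk (x : N) :
    APlus.locIncl h N (LocalizedModule.mkLinearMap _ N x) = LocalizedModule.mkLinearMap _ N x := by
  rw [APlus.locIncl, ← LinearMap.comp_apply, LocalizedModule.lift_comp]

namespace WachModule

variable {a b : ℤ} (W : WachModule r a b N)

theorem μ_smul_diff (g : r.Gal) (x : N) :
    APlus.μ p κ d S • W.diff g x = W.act g x - x := (W.exists_diff g x).choose_spec

/-- The action of `γ_1, …, γ_d` on a Wach module. -/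
noncomputable def semiAction : (APlus.qData h).SemiAction N where
  act i := W.act (γ i)
  act_smul i f x := W.act_smul (γ i) f x
  act_comm i j x := by
    have h1 : W.act (γ i) * W.act (γ j) = W.act (γ j) * W.act (γ i) := by
      rw [← map_mul, h.mul_comm, map_mul]
    exact DFunLike.congr_fun h1 x
  regular x hx := by
    rw [APlus.algebraMap_q_sub_one] at hx
    exact W.regular_μ x hx
  der i := W.diff (γ i)
  der_spec i x := by
    rw [APlus.algebraMap_q_sub_one]
    exact W.μ_smul_diff (γ i) x

include W in
theorem μ_pow_smul_eq_zero (n : ℕ) {x : N} (hx : APlus.μ p κ d S ^ n • x = 0) : x = 0 := by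
  induction n with
  | zero => simpa using hx
  | succ n ih =>
    rw [pow_succ', mul_smul] at hx
    exact ih (W.regular_μ _ hx)

-- By `φ(μ)^k = [p]_q^k μ^k` and absence of `μ`-torsion, whatever is killed by a power of `φ(μ)` is
-- already killed by a power of `[p]_q`.
include W in
theorem locIncl_injective : Function.Injective (APlus.locIncl h N) := by
  rw [injective_iff_map_eq_zero]
  intro z hz
  obtain ⟨n, x, hx⟩ := QData.exists_pq_pow_smul_eq z
  refine QData.pq_pow_smul_cancel n ?_
  have h1 := APlus.locIncl_mk h x
  rw [← hx, map_smul, hz, smul_zero] at h1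
  obtain ⟨⟨_, k, rfl⟩, hk⟩ := (IsLocalizedModule.eq_zero_iff
    (Submonoid.powers (APlus.frob p κ d S (APlus.μ p κ d S)))
    (LocalizedModule.mkLinearMap _ N)).mp h1.symm
  change APlus.frob p κ d S (APlus.μ p κ d S) ^ k • x = 0 at hk
  rw [APlus.frob_μ, mul_pow, mul_comm, mul_smul] at hk
  have h2 := W.μ_pow_smul_eq_zero k hk
  rw [hx, smul_zero]
  refine QData.pq_pow_smul_cancel k ?_
  rw [← map_smul, APlus.algebraMap_pq, h2, map_zero, smul_zero]

/-- The isomorphism `N ≃ μ ^ b N`. -/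
noncomputable def muPowEquiv : N ≃ₗ[APlus p κ d S] muPow (APlus.μ p κ d S) N b :=
  LinearEquiv.ofBijective ((muPowHom p κ d S b N).codRestrict _
    fun x => mem_muPow.mpr ⟨x, μ_pow_smul_muPowHom b x⟩) (by
    constructor
    · rw [injective_iff_map_eq_zero]
      intro x hx
      have h1 := μ_pow_smul_muPowHom (p := p) (κ := κ) (d := d) (S := S) b x
      have h2 : muPowHom p κ d S b N x = 0 := congr_arg Subtype.val hx
      rw [h2, smul_zero] at h1
      have h3 := (μ_pow_bijective b.toNat).injective (h1.symm.trans (smul_zero _).symm)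
      obtain ⟨⟨_, k, rfl⟩, hk⟩ := (IsLocalizedModule.eq_zero_iff
        (Submonoid.powers (APlus.μ p κ d S)) (LocalizedModule.mkLinearMap _ N)).mp h3
      exact W.μ_pow_smul_eq_zero k hk
    · rintro ⟨z, hz⟩
      obtain ⟨x, hx⟩ := mem_muPow.mp hz
      refine ⟨x, Subtype.ext ((μ_pow_bijective (-b).toNat).injective ?_)⟩
      exact (μ_pow_smul_muPowHom (p := p) (κ := κ) (d := d) (S := S) b x).trans hx.symm)

/-- This is `φ(μ^b x) = φ(μ)^b φ(x)`, with negative powers moved across. -/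
theorem frob_μ_pow_smul_φ_muPowEquiv (x : N) :
    APlus.frob p κ d S (APlus.μ p κ d S) ^ (-b).toNat • W.φ (W.muPowEquiv x) =
      APlus.frob p κ d S (APlus.μ p κ d S) ^ b.toNat •
        W.φ (LocalizedModule.mkLinearMap _ N x) := by
  rw [← map_pow, ← map_pow, ← W.φ.map_smulₛₗ, ← W.φ.map_smulₛₗ]
  exact congr_arg W.φ (μ_pow_smul_muPowHom b x)

/-- As `φ(μ)^b φ(x)` lies in `μ^b N` and `φ(μ)^b = [p]_q^b μ^b`, cancelling `μ^b` leaves `φ(x) ∈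
[p]_q^(-b) N`. -/
theorem exists_pq_pow_smul_φ (x : N) : ∃ y, APlus.pq p κ d S ^ b.toNat •
    W.φ (LocalizedModule.mkLinearMap _ N x) = LocalizedModule.mkLinearMap _ N y := by
  obtain ⟨y, hy⟩ := mem_muPow.mp (W.φ_mem _ (W.muPowEquiv x).2)
  -- For `b ≥ 0` the numerator is `y` itself; for `b < 0` there is no denominator and `φ(x)` is
  -- divisible by `[p]_q^(-b)`.
  refine ⟨APlus.pq p κ d S ^ (-b).toNat • y, ?_⟩
  refine (APlus.bijective_smul b.toNat (APlus.μ_dvd_frob_μ p κ d S)).injective ?_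
  have h1 := W.frob_μ_pow_smul_φ_muPowEquiv x
  rw [APlus.frob_μ_pow, APlus.frob_μ_pow, mul_smul, hy] at h1
  rw [map_smul, smul_comm _ (APlus.pq p κ d S ^ (-b).toNat), h1, mul_comm, mul_smul]

theorem φ_mem_range (x : N) :
    W.φ (LocalizedModule.mkLinearMap _ N x) ∈ LinearMap.range (APlus.locIncl h N) := by
  obtain ⟨y, hy⟩ := W.exists_pq_pow_smul_φ x
  have h1 := IsLocalizedModule.map_units (LocalizedModule.mkLinearMap
    ((APlus.qData h).pqPowers p) N) ((APlus.qData h).pqPow p b.toNat)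
  obtain ⟨z, hz⟩ := ((Module.End.isUnit_iff _).mp h1).surjective
    (LocalizedModule.mkLinearMap _ N y)
  change algebraMap (DRing p) (APlus p κ d S) ((APlus.qData h).pq p) ^ b.toNat • z = _ at hz
  refine ⟨z, (APlus.bijective_smul b.toNat APlus.pq_dvd_frob_μ).injective ?_⟩
  rw [hy, ← map_smul, ← APlus.algebraMap_pq h, hz, APlus.locIncl_mk]

/-- The Frobenius of a Wach module, as a map `N → N[1/[p]_q]`. -/
noncomputable def frobHom : N →ₛₗ[APlus.frob p κ d S]
    LocalizedModule ((APlus.qData h).pqPowers p) N :=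
  (LinearEquiv.ofInjective _ (W.locIncl_injective h)).symm.toLinearMap.comp
    ((W.φ.comp (LocalizedModule.mkLinearMap _ N)).codRestrict
      (LinearMap.range (APlus.locIncl h N)) (W.φ_mem_range h))

theorem locIncl_frobHom (x : N) :
    APlus.locIncl h N (W.frobHom h x) = W.φ (LocalizedModule.mkLinearMap _ N x) :=
  congr_arg Subtype.val ((LinearEquiv.ofInjective _ (W.locIncl_injective h)).apply_symm_apply
    ⟨_, W.φ_mem_range h x⟩)

/-- The linearizations on `μ^b N` and on `N` differ by the factor `φ(μ)^b`; this carries injectivity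
and the cokernel bound from the former to the latter. -/
theorem frob_μ_pow_smul_linearize (y : FrobPull (APlus.frob p κ d S) N) :
    APlus.frob p κ d S (APlus.μ p κ d S) ^ (-b).toNat •
      FrobPull.linearize (APlus.frob p κ d S)
        (W.φ.comp (muPow (APlus.μ p κ d S) N b).subtype) (FrobPull.congr _ W.muPowEquiv y) =
    APlus.frob p κ d S (APlus.μ p κ d S) ^ b.toNat •
      APlus.locIncl h N (FrobPull.linearize (APlus.frob p κ d S) (W.frobHom h) y) := by
  induction y using FrobPull.induction with
  | h0 => simp only [map_zero, smul_zero]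
  | h2 y z hy hz => simp only [map_add, smul_add, hy, hz]
  | h1 f x =>
    rw [FrobPull.congr_tmul, FrobPull.linearize_tmul, FrobPull.linearize_tmul, map_smul,
      locIncl_frobHom, smul_comm, smul_comm _ f]
    exact congr_arg _ (W.frob_μ_pow_smul_φ_muPowEquiv x)

/-- The Frobenius structure of a Wach module. -/
noncomputable def frobenius : (W.semiAction h).Frobenius (APlus.qFrob h) where
  F := W.frobHom h
  comm i n x y hxy := by
    refine W.locIncl_injective h ?_
    have h1 : algebraMap (DRing p) (APlus p κ d S) ((APlus.qData h).pq p) ^ n •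
        W.φ (LocalizedModule.mkLinearMap _ N x) = LocalizedModule.mkLinearMap _ N y := by
      rw [← W.locIncl_frobHom h, ← map_smul, ← APlus.locIncl_mk h]
      exact congr_arg (APlus.locIncl h N) hxy
    -- The action of `γ_i` on `N[1/φ(μ)]` is applied to the equation `h1` for the numerator; it
    -- fixes `[p]_q`, which comes from `D`.
    have h2 := W.φ_comm (γ i) (LocalizedModule.mkLinearMap _ N x)
    rw [RootData.actLoc_mk] at h2
    have h3 := congr_arg (r.actLoc W.act W.act_smul (APlus.frob p κ d S (APlus.μ p κ d S))
        (fun g => by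
          rw [APlus.frob_act]
          exact map_dvd _ (APlus.act_μ_dvd r g)) (γ i)) h1
    rw [RootData.actLoc_smul, RootData.actLoc_mk, ← h2, _root_.map_pow, h.act_algebraMap] at h3
    rw [map_smul, APlus.locIncl_mk]
    exact (congr_arg _ (W.locIncl_frobHom h _)).trans h3
  denom := b.toNat
  denom_spec x := by
    obtain ⟨y, hy⟩ := W.exists_pq_pow_smul_φ x
    refine ⟨y, W.locIncl_injective h ?_⟩
    rw [map_smul, APlus.locIncl_mk, APlus.algebraMap_pq, ← hy]
    exact congr_arg _ (W.locIncl_frobHom h x)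
  injective := by
    rw [injective_iff_map_eq_zero]
    intro y hy
    have h1 := W.frob_μ_pow_smul_linearize h y
    have h2 : FrobPull.linearize (APlus.frob p κ d S) (W.frobHom h) y = 0 := hy
    rw [h2, map_zero, smul_zero] at h1
    have h3 := (APlus.bijective_smul (-b).toNat dvd_rfl).injective (h1.trans (smul_zero _).symm)
    have h4 := (injective_iff_map_eq_zero _).mp W.φ_injective _ h3
    exact (map_eq_zero_iff _ (FrobPull.congr _ W.muPowEquiv).injective).mp h4
  -- Cancelling `μ^b` in `[p]_q^(b-a) μ^b x = φ(μ)^b (1 ⊗ φ)(y)` leaves `[p]_q^(b-a) x = [p]_q^b (1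
  -- ⊗ φ)(y)`. For `b ≥ 0` the factor `[p]_q^b` goes into the preimage, and for `b < 0` it moves to
  -- the left and raises the exponent by `-b`.
  height := (-b).toNat + (b - a).toNat
  height_spec x := by
    obtain ⟨z, hz⟩ := (APlus.bijective_smul (N := N) (-b).toNat
      (APlus.μ_dvd_frob_μ p κ d S)).surjective
      (APlus.μ p κ d S ^ b.toNat • LocalizedModule.mkLinearMap _ N x)
    simp only at hz
    obtain ⟨w, hw⟩ := W.φ_coker z (mem_muPow.mpr ⟨x, hz⟩)
    obtain ⟨y, rfl⟩ := (FrobPull.congr _ W.muPowEquiv).surjective w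
    have h1 := W.frob_μ_pow_smul_linearize h y
    refine ⟨APlus.pq p κ d S ^ b.toNat • y, W.locIncl_injective h ?_⟩
    refine (APlus.bijective_smul b.toNat (APlus.μ_dvd_frob_μ p κ d S)).injective ?_
    rw [hw, APlus.frob_μ_pow, APlus.frob_μ_pow] at h1
    have h2 : APlus.μ p κ d S ^ b.toNat • APlus.pq p κ d S ^ b.toNat • APlus.locIncl h N
        (FrobPull.linearize (APlus.frob p κ d S) (W.frobHom h) y) =
        APlus.pq p κ d S ^ ((-b).toNat + (b - a).toNat) • APlus.μ p κ d S ^ b.toNat •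
          LocalizedModule.mkLinearMap _ N x := by
      rw [← hz, ← mul_smul, mul_comm (APlus.μ p κ d S ^ _), ← h1, ← mul_smul, ← mul_smul]
      congr 1
      ring
    have h3 : APlus.locIncl h N (FrobPull.linearize (APlus.frob p κ d S) (W.frobHom h)
        (APlus.pq p κ d S ^ b.toNat • y)) = APlus.pq p κ d S ^ b.toNat •
        APlus.locIncl h N (FrobPull.linearize (APlus.frob p κ d S) (W.frobHom h) y) := by
      rw [map_smul, map_smul]
    rw [map_smul, APlus.locIncl_mk, APlus.algebraMap_pq]
    exact (congr_arg _ h3).trans (h2.trans (smul_comm _ _ _))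

end WachModule
end WachModule
end WachQ

/-! ### The theorem. -/

open WachQ
theorem mainTheorem10 (p : ℕ) [Fact p.Prime] (κ : Type*) [Field κ] [CharP κ p] [PerfectRing κ p]
    (d : ℕ) (S : Type*) [CommRing S] [Algebra (RSquare p κ d) S]
    [Algebra.Etale (RSquare p κ d) S] (hS : GeomIntegralSpecialFibre p κ d S)
    (Ω : Type*) [Field Ω] [IsAlgClosed Ω] [Algebra (PCompl p S) Ω] [FaithfulSMul (PCompl p S) Ω]
    [Algebra.IsAlgebraic (PCompl p S) Ω] (r : RootData p κ d S Ω)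
    (γ : Fin d → r.Gal) (hγ : r.IsGeometricBasis γ)
    (a b : ℤ) (N : Type*) [AddCommGroup N] [Module (APlus p κ d S) N] [Module (DRing p) N]
    [IsScalarTower (DRing p) (APlus p κ d S) N] (W : WachModule r a b N) :
    ∃ nabla : QConnection (APlus.qData hγ) N,
      (∀ x : N, nabla.toLin x = ∑ i, W.diff (γ i) x ⊗ₜ[APlus p κ d S] QOmega.dlog i) ∧
      nabla.IsFlat ∧ nabla.IsQuasiNilpotent p ∧
      ∃ Φ : PhiStructure (APlus.qFrob hγ) nabla, ∀ x : N,
        APlus.locIncl hγ N (Φ.iso (LocalizedModule.mk (FrobPull.tmul _ 1 x) 1)) =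
          W.φ (LocalizedModule.mk x 1) := by
  refine ⟨(W.semiAction hγ).connection, fun x => rfl, (W.semiAction hγ).connection_isFlat,
    (W.frobenius hγ).isQuasiNilpotent ?_ ?_, (W.frobenius hγ).phiStructure, fun x => ?_⟩
  · rw [APlus.algebraMap_q_sub_one]
    exact W.regular_p_mod_μ
  -- The bound on `p`-th iterates concerns the coefficient ring only and does not involve `N`.
  · rw [APlus.algebraMap_q_sub_one]
    exact APlus.exists_par_iterate_eq hγ
  · have h1 := (W.frobenius hγ).iso_mk (FrobPull.tmul (APlus.qFrob hγ).φA 1 x)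
    rw [FrobPull.linearize_tmul, one_smul] at h1
    exact (congr_arg (APlus.locIncl hγ N) h1).trans (W.locIncl_frobHom hγ x)
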